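/- **Setting.** For $x,z\in\mathbb R^n$ let $\operatorname{dist}(x,z)=\min\{\|x-z\|_2,\|x+z\|_2\}$. Let $x^\dagger\in\mathbb R^n\setminus\{0\}$ be $s$-sparse with $2s\le n$, let $x^\dagger_{\min}$ be the smallest absolute value of its nonzero entries, and put $\mathcal E(\delta)=\{z\in\mathbb R^n:\operatorname{dist}(z,x^\dagger)\le\delta\|x^\dagger\|_2,\ \|z\|_0\le s\}$. Let $a_1,\dots,a_m\in\mathbb C^n$ be i.i.d. $\mathcal{CN}(0,I)$ (all real and imaginary parts independent $N(0,1/2)$) and $y_j=|\langle a_j,x^\dagger\rangle|^2$. For an index set $I$ let $f_I(z)=\frac1{4|I|}\sum_{j\in I}(|\langle a_j,z\rangle|^2-y_j)^2$, let $F_I(z)$ be the vector with entries $\frac{1}{2\sqrt{|I|}}(|\langle a_j,z\rangle|^2-y_j)$, $j\in I$, and $J_I(z)$ its Jacobian, with rows $\frac1{\sqrt{|I|}}(a_{jR}a_{jR}^\top z+a_{jI}a_{jI}^\top z)^\top$, where $a_{jR},a_{jI}$ are the real and imaginary parts of $a_j$. Let $\mathcal H_s$ keep $s$ entries of largest magnitude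 and set the others to zero (any measurable rule for ties). **Resampled GraHTP.** Let $\mathcal I_1,\dots,\mathcal I_{2K}\subseteq\{1,\dots,m\}$ be disjoint batches of equal size $M=\lfloor m/(2K)\rfloor$. From a fixed $z^0$, for $k=0,\dots,K-1$: put $u^k=\mathcal H_s\big(z^k-\mu^k\nabla f_{\mathcal I_{2k+1}}(z^k)\big)$ and $S_{k+1}=\operatorname{supp}u^k$; choose $z^{k,0}=g_k(z^k,u^k)$, where $g_k$ is a fixed measurable map with $\operatorname{supp}g_k(z,u)=\operatorname{supp}u$ and $\operatorname{dist}(g_k(z,u),x^\dagger)\le\operatorname{dist}(u,x^\dagger)$ for all $z,u$ (for example $z^{k,0}=u^k$); and let $z^{k+1}$ be any minimizer of $\|J_{\mathcal I_{2k+2}}(z^{k,0})(z-z^{k,0})+F_{\mathcal I_{2k+2}}(z^{k,0})\|_2^2$ over $\operatorname{supp}z\subseteq S_{k+1}$. **Corollary.** There are universal constants $0<\mu_1<\mu_2$ and $\delta,\beta,C_0,C_5,C_6,C_7,C_8>0$ with $\beta\delta<1$ such that for all $n,s,x^\dagger$ as above there is an integer $0\le K_0\le C_0\big(1+\log(\|x^\dagger\|_2/x^\dagger_{\min})\big)$,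 and for every $\epsilon\in(0,1)$ there is an integer $K\ge\max(1,K_0)$ with $$K\le C_0\Big(1+\max\{0,\log\log(1/\epsilon)\}+\log(\|x^\dagger\|_2/x^\dagger_{\min})\Big),$$ such that the following holds. If $m\ge C_5Ks\log(n/s)$, $\mu^k\in(\mu_1/\|x^\dagger\|_2^2,\mu_2/\|x^\dagger\|_2^2)$ for all $k<K$ and $z^0\in\mathcal E(\delta)$, then with probability at least $$1-K\Big(C_6M^{-1}+C_7\exp\big(-C_8M/\log M\big)\Big),\qquad M=\lfloor m/(2K)\rfloor,$$ resampled GraHTP yields an $\epsilon$-solution, $\operatorname{dist}(z^K,x^\dagger)\le\epsilon\|x^\dagger\|_2$, and converges quadratically after $K_0$ iterations: for $K_0\le k<K$, $\operatorname{dist}(z^k,x^\dagger)\le\delta\|x^\dagger\|_2$ and $\operatorname{dist}(z^{k+1},x^\dagger)\le\frac{\beta}{\|x^\dagger\|_2}\operatorname{dist}(z^k,x^\dagger)^2$. -/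

import Mathlib

open MeasureTheory ProbabilityTheory

namespace GraHTP

/-- The signal space `ℝⁿ` with the Euclidean norm. -/
abbrev Signal (n : ℕ) : Type := EuclideanSpace ℝ (Fin n)

/-- The space `ℂⁿ` of sensing vectors. -/
abbrev Sensing (n : ℕ) : Type := EuclideanSpace ℂ (Fin n)

/-- The standard complex Gaussian law on `ℂ`: the real and imaginary parts are independent
`N(0, 1/2)` variables. -/
noncomputable def complexGaussian : Measure ℂ :=
  ((gaussianReal 0 (1 / 2)).prod (gaussianReal 0 (1 / 2))).map
    (fun p : ℝ × ℝ => (⟨p.1, p.2⟩ : ℂ))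

/-- The law `CN(0, I)` on `ℂⁿ`: independent standard complex Gaussian coordinates. -/
noncomputable def stdComplexGaussian (n : ℕ) : Measure (Sensing n) :=
  (Measure.pi (fun _ : Fin n => complexGaussian)).map (WithLp.toLp 2)

/-- A real vector regarded as a complex one. -/
noncomputable def toComplex {n : ℕ} (z : Signal n) : Sensing n :=
  WithLp.toLp 2 (fun i => ((z i : ℝ) : ℂ))

/-- The real part of a complex vector. -/
noncomputable def rePart {n : ℕ} (a : Sensing n) : Signal n :=
  WithLp.toLp 2 (fun i => (a i).re)

/-- The imaginary part of a complex vector. -/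
noncomputable def imPart {n : ℕ} (a : Sensing n) : Signal n :=
  WithLp.toLp 2 (fun i => (a i).im)

/-- The phaseless measurement `|⟨a, z⟩|²`. -/
noncomputable def intensity {n : ℕ} (a : Sensing n) (z : Signal n) : ℝ :=
  ‖inner ℂ a (toComplex z)‖ ^ 2

/-- The support of a vector. -/
noncomputable def supp {n : ℕ} (z : Signal n) : Finset (Fin n) := {i | z i ≠ 0}

/-- `dist(x, z) = min (‖x - z‖, ‖x + z‖)`, the distance up to a global sign. -/
noncomputable def signDist {n : ℕ} (x z : Signal n) : ℝ := min ‖x - z‖ ‖x + z‖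

/-- The smallest absolute value of a nonzero component (meaningful for `x ≠ 0`). -/
noncomputable def minEntry {n : ℕ} (x : Signal n) : ℝ :=
  sInf {r : ℝ | ∃ i, x i ≠ 0 ∧ r = |x i|}

/-- The basin of attraction `E(δ)` around `± x`. -/
def basin {n : ℕ} (s : ℕ) (x : Signal n) (δ : ℝ) : Set (Signal n) :=
  {z | signDist z x ≤ δ * ‖x‖ ∧ (supp z).card ≤ s}

/-- The intensity loss `f(z) = 1/(4|I|) ∑_{j ∈ I} (|⟨a_j, z⟩|² - y_j)²` of the data indexed
by `I`. -/
noncomputable def loss {n m : ℕ} (a : Fin m → Sensing n) (y : Fin m → ℝ) (I : Finset (Fin m))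
    (z : Signal n) : ℝ :=
  1 / (4 * (I.card : ℝ)) * ∑ j ∈ I, (intensity (a j) z - y j) ^ 2

/-- The residual `F_j(z) = (|⟨a_j, z⟩|² - y_j) / (2 √|I|)`. -/
noncomputable def residual {n m : ℕ} (a : Fin m → Sensing n) (y : Fin m → ℝ)
    (I : Finset (Fin m)) (z : Signal n) (j : Fin m) : ℝ :=
  1 / (2 * √(I.card : ℝ)) * (intensity (a j) z - y j)

/-- The `j`-th row `(a_{jR} a_{jR}ᵀ z + a_{jI} a_{jI}ᵀ z) / √|I|` of the Jacobian `J(z)`. -/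
noncomputable def jacobianRow {n m : ℕ} (a : Fin m → Sensing n) (I : Finset (Fin m))
    (z : Signal n) (j : Fin m) : Signal n :=
  (1 / √(I.card : ℝ)) •
    ((inner ℝ (rePart (a j)) z : ℝ) • rePart (a j) + (inner ℝ (imPart (a j)) z : ℝ) • imPart (a j))

/-- The linearized objective `‖J(w) (z - w) + F(w)‖²` of a Gauss–Newton step at `w`. -/
noncomputable def gaussNewtonObjective {n m : ℕ} (a : Fin m → Sensing n) (y : Fin m → ℝ)
    (I : Finset (Fin m)) (w z : Signal n) : ℝ :=
  ∑ j ∈ I, ((inner ℝ (jacobianRow a I w j) (z - w) : ℝ) + residual a y I w j) ^ 2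

/-- `z'` is the outcome of a Gauss–Newton step from `w` on the support set `S`. -/
def IsGaussNewtonStep {n m : ℕ} (a : Fin m → Sensing n) (y : Fin m → ℝ) (I : Finset (Fin m))
    (S : Finset (Fin n)) (w z' : Signal n) : Prop :=
  supp z' ⊆ S ∧ IsMinOn (gaussNewtonObjective a y I w) {z | supp z ⊆ S} z'

/-- `H` is a hard thresholding operator `ℋ_s`: a measurable map that retains `s` components of
largest magnitude and sets the others to zero, with an arbitrary rule for breaking ties. -/
structure IsHardThresholding {n : ℕ} (s : ℕ) (H : Signal n → Signal n) : Prop where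
  measurable : Measurable H
  spec : ∀ v, ∃ S : Finset (Fin n), S.card = s ∧ (∀ i ∈ S, ∀ j ∉ S, |v j| ≤ |v i|) ∧
    ∀ i, H v i = if i ∈ S then v i else 0

/-- `g k z u` is the starting point `z^{k,0}` of the Gauss–Newton step of iteration `k`, for
`z = z^k` and `u = u^k`. It has the support of `u` and is no farther from `± x` than `u`. The
choice `g k z u = u` is always admissible. -/
structure IsInitialGuess {n : ℕ} (x : Signal n) (g : ℕ → Signal n → Signal n → Signal n) :
    Prop where
  measurable : ∀ k, Measurable (fun p : Signal n × Signal n => g k p.1 p.2)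
  supp_eq : ∀ k z u, supp (g k z u) = supp u
  dist_le : ∀ k z u, signDist (g k z u) x ≤ signDist u x

/-- `z` and `u` are the iterates of `K` iterations of resampled GraHTP (one Gauss–Newton step
per iteration) with data `(a_j, y_j)`, batches `I 0, …, I (2K - 1)`, step sizes `μ k` and initial
point `z0`. Iteration `k` uses batch `2k` for the gradient step and batch `2k + 1` for the
Gauss–Newton step. -/
structure IsRun {n m : ℕ} (K : ℕ) (H : Signal n → Signal n)
    (g : ℕ → Signal n → Signal n → Signal n) (μ : ℕ → ℝ)
    (a : Fin m → Sensing n) (y : Fin m → ℝ) (I : ℕ → Finset (Fin m)) (z0 : Signal n)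
    (z u : ℕ → Signal n) : Prop where
  init : z 0 = z0
  gradient_step : ∀ k < K, u k = H (z k - μ k • gradient (loss a y (I (2 * k))) (z k))
  gaussNewton_step : ∀ k < K,
    IsGaussNewtonStep a y (I (2 * k + 1)) (supp (u k)) (g k (z k) (u k)) (z (k + 1))

end GraHTP

namespace GraHTP

-- The argument is a contraction estimate for one iteration, made on a good event, plus independence
-- between batches. Each batch is used once, so the vectors at which it is evaluated (`z^k`, `z^k ±
-- x`, the Gauss–Newton starting point `w`) may be treated as fixed. Only a sparse test direction
-- has to be handled uniformly. The entropy of `2s`-sparse directions is of order `s log (n/s)`, and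
-- this is the batch size required.
--
-- Probability. All loss terms reduce to the form `cross a u v = Re (conj ⟨a, u⟩ ⟨a, v⟩)`. Its
-- second mixed moments come from Wick's formula. The products `cross a u v * cross a w d` are
-- quartic in a Gaussian, so they have no exponential moments near zero. They are split into a
-- truncated part (Chernoff and a net) and a remainder controlled by moments of fixed vectors
-- (Chebyshev), which limits the failure probability to order `1/M`. This gives
-- `prob_cross_deviation` (gradient), `prob_cross_sq_small` (lower bound on the Gauss–Newton form)
-- and `prob_intensity_mul_large` (its right-hand side).
--
-- Deterministic part. With `e = z - x`, the mean gradient is `‖x‖² e` plus a multiple of `x` plus a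
-- term of second order in `e`. A step of size close to `1/‖x‖²` cancels `e` and leaves a multiple
-- of `x`, which hard thresholding tolerates. Hence the part of `x` missed by the new support is
-- only `O(η ‖e‖)` while `‖u - x‖ = O(‖e‖)` (`gradient_step_error`). The Gauss–Newton step on that
-- support has error at most a constant times the missed part plus a constant times `‖w - x‖² / ‖x‖`
-- (`gaussNewton_error`). The result is linear contraction by `1/2`; as soon as the error is at most
-- the smallest nonzero entry, nothing is missed and only the quadratic term survives
-- (`iteration_error`).
--
-- Independence. A run may select any minimizer, possibly in a nonmeasurable way. On the good event
-- the minimizer is unique and equals the solution of a linear system, so every run coincides with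
-- the measurable recursion `iterates`, which depends on earlier batches only. Freezing it by Fubini
-- (`prob_le_of_forall_const`) transfers the fixed-vector bounds to the iterates, and a union bound
-- over the `2K` uses of a batch finishes (`exists_good_event`). Halving needs about `log
-- (‖x‖/x_min)` iterations to resolve the smallest entry; squaring needs about `log log (1/ε)` more.

universe uΩ

/-! ### Linear forms of a complex Gaussian vector: laws, Wick's formula, exponential moments. -/

instance : IsProbabilityMeasure complexGaussian := by
  unfold complexGaussian
  refine Measure.isProbabilityMeasure_map (Measurable.aemeasurable ?_)
  exact Complex.measurableEquivRealProd.symm.measurable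

lemma measurable_toLp_two {n : ℕ} : Measurable (WithLp.toLp 2 : (Fin n → ℂ) → Sensing n) :=
  (PiLp.continuous_toLp 2 _).measurable

instance (n : ℕ) : IsProbabilityMeasure (stdComplexGaussian n) := by
  unfold stdComplexGaussian
  exact Measure.isProbabilityMeasure_map measurable_toLp_two.aemeasurable

/-- The real linear functional `⟨a_R, u⟩ + ⟨a_I, w⟩` of a sensing vector. -/
noncomputable def reImForm {n : ℕ} (u w : Signal n) (a : Sensing n) : ℝ :=
  inner ℝ (rePart a) u + inner ℝ (imPart a) w

lemma continuous_rePart {n : ℕ} : Continuous (rePart : Sensing n → Signal n) := by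
  unfold rePart
  refine (PiLp.continuous_toLp 2 _).comp (continuous_pi fun i => ?_)
  exact Complex.continuous_re.comp (by fun_prop)

lemma continuous_imPart {n : ℕ} : Continuous (imPart : Sensing n → Signal n) := by
  unfold imPart
  refine (PiLp.continuous_toLp 2 _).comp (continuous_pi fun i => ?_)
  exact Complex.continuous_im.comp (by fun_prop)

@[fun_prop]
lemma continuous_reImForm {n : ℕ} (u w : Signal n) : Continuous (reImForm u w) := by
  unfold reImForm
  exact (continuous_rePart.inner continuous_const).add (continuous_imPart.inner continuous_const)

lemma reImForm_eq_sum {n : ℕ} (u w : Signal n) (a : Sensing n) :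
    reImForm u w a = ∑ i, ((a i).re * u i + (a i).im * w i) := by
  simp only [reImForm, PiLp.inner_apply, rePart, imPart, Finset.sum_add_distrib]
  simp [mul_comm]

lemma integral_complexGaussian_exp (p q : ℝ) :
    ∫ c : ℂ, Complex.exp ((c.re * p + c.im * q : ℝ) * Complex.I) ∂complexGaussian
      = Complex.exp (-((p ^ 2 + q ^ 2 : ℝ) / 4)) := by
  unfold complexGaussian
  have hm : Measurable (fun p : ℝ × ℝ => (⟨p.1, p.2⟩ : ℂ)) :=
    Complex.measurableEquivRealProd.symm.measurable
  rw [integral_map hm.aemeasurable (by fun_prop)]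
  have h : ∀ t : ℝ, ∫ x : ℝ, Complex.exp ((x * t : ℝ) * Complex.I) ∂(gaussianReal 0 (1 / 2))
      = Complex.exp (-((t ^ 2 : ℝ) / 4)) := by
    intro t
    have := charFun_gaussianReal (μ := 0) (v := 1 / 2) t
    rw [charFun_apply_real] at this
    have e : ∀ x : ℝ, ((x * t : ℝ) : ℂ) * Complex.I = t * x * Complex.I := by
      intro x; push_cast; ring
    simp_rw [e]
    rw [this]
    congr 1
    push_cast
    ring
  have e : ∀ z : ℝ × ℝ, Complex.exp ((z.1 * p + z.2 * q : ℝ) * Complex.I)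
      = Complex.exp ((z.1 * p : ℝ) * Complex.I) * Complex.exp ((z.2 * q : ℝ) * Complex.I) := by
    intro z
    rw [← Complex.exp_add]
    congr 1
    push_cast
    ring
  simp_rw [e]
  rw [integral_prod_mul (fun x : ℝ => Complex.exp ((x * p : ℝ) * Complex.I))
    (fun x : ℝ => Complex.exp ((x * q : ℝ) * Complex.I)), h p, h q, ← Complex.exp_add]
  congr 1
  push_cast
  ring

/-- The characteristic function factors over the coordinates. Every later moment is extracted from
these one-dimensional laws by polarization or by AM–GM, so no joint Gaussian law is needed. -/
lemma map_reImForm {n : ℕ} (u w : Signal n) :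
    (stdComplexGaussian n).map (reImForm u w)
      = gaussianReal 0 (Real.toNNReal ((‖u‖ ^ 2 + ‖w‖ ^ 2) / 2)) := by
  have : IsProbabilityMeasure ((stdComplexGaussian n).map (reImForm u w)) :=
    Measure.isProbabilityMeasure_map (continuous_reImForm u w).measurable.aemeasurable
  apply Measure.ext_of_charFun
  ext t
  rw [charFun_gaussianReal, charFun_apply_real,
    integral_map (continuous_reImForm u w).measurable.aemeasurable (by fun_prop)]
  unfold stdComplexGaussian
  rw [integral_map measurable_toLp_two.aemeasurable
    (by have := continuous_reImForm u w; fun_prop)]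
  have e : ∀ a : Fin n → ℂ, Complex.exp (t * (reImForm u w (WithLp.toLp 2 a) : ℝ) * Complex.I)
      = ∏ i, Complex.exp (((a i).re * (t * u i) + (a i).im * (t * w i) : ℝ) * Complex.I) := by
    intro a
    rw [← Complex.exp_sum, reImForm_eq_sum]
    congr 1
    push_cast
    rw [Finset.mul_sum, Finset.sum_mul]
    refine Finset.sum_congr rfl fun i _ => ?_
    ring
  simp_rw [e]
  rw [integral_fintype_prod_eq_prod
    (f := fun i (c : ℂ) => Complex.exp ((c.re * (t * u i) + c.im * (t * w i) : ℝ) * Complex.I))]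
  simp_rw [integral_complexGaussian_exp]
  rw [← Complex.exp_sum]
  congr 1
  have h : (((‖u‖ ^ 2 + ‖w‖ ^ 2) / 2).toNNReal : ℝ) = (∑ i, (u i ^ 2 + w i ^ 2)) / 2 := by
    rw [Real.coe_toNNReal _ (by positivity), EuclideanSpace.norm_sq_eq, EuclideanSpace.norm_sq_eq,
      Finset.sum_add_distrib]
    simp
  have h' : ((((‖u‖ ^ 2 + ‖w‖ ^ 2) / 2).toNNReal : ℝ) : ℂ)
      = (((∑ i, (u i ^ 2 + w i ^ 2)) / 2 : ℝ) : ℂ) := by rw [h]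
  rw [h']
  push_cast
  simp only [mul_zero, zero_mul, zero_sub]
  rw [Finset.sum_div, Finset.sum_mul, Finset.sum_div, ← Finset.sum_neg_distrib]
  refine Finset.sum_congr rfl fun i _ => ?_
  ring

lemma integral_pow_four_gaussianReal (v : NNReal) :
    ∫ x, x ^ 4 ∂(gaussianReal 0 v) = 3 * (v : ℝ) ^ 2 := by
  have h0 : (0 : ℝ) ∈ interior (integrableExpSet id (gaussianReal 0 v)) := by simp
  have h := iteratedDeriv_mgf_zero h0 4
  rw [mgf_id_gaussianReal] at h
  have hfun : (fun t : ℝ => Real.exp (0 * t + v * t ^ 2 / 2))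
      = fun t => Real.exp (v * t ^ 2 / 2) := by ext t; simp
  rw [hfun] at h
  have hq : ∀ t : ℝ, HasDerivAt (fun t : ℝ => Real.exp (v * t ^ 2 / 2))
      (v * t * Real.exp (v * t ^ 2 / 2)) t := by
    intro t
    have h2 : HasDerivAt (fun t : ℝ => (v : ℝ) * t ^ 2 / 2) (v * t) t := by
      refine (((hasDerivAt_pow 2 t).const_mul (v : ℝ)).div_const 2).congr_deriv ?_
      push_cast; ring
    exact h2.exp.congr_deriv (by ring)
  -- Derivatives of the moment generating function stay of the form polynomial times `exp (v t² /
  -- 2)`, with `p ↦ p' + v t p`; four applications give the fourth moment at `0`.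
  have step : ∀ (p p' : ℝ → ℝ), (∀ t, HasDerivAt p (p' t) t) →
      deriv (fun t => p t * Real.exp (v * t ^ 2 / 2))
        = fun t => (p' t + v * t * p t) * Real.exp (v * t ^ 2 / 2) := by
    intro p p' hp
    ext t
    rw [((hp t).fun_mul (hq t)).deriv]
    ring
  have d1 : deriv (fun t : ℝ => Real.exp (v * t ^ 2 / 2))
      = fun t => (v * t) * Real.exp (v * t ^ 2 / 2) := by
    ext t; rw [(hq t).deriv]
  have d2 := step (fun t => v * t) (fun _ => v)
    (fun t => by simpa using (hasDerivAt_id t).const_mul (v : ℝ))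
  have d3 := step (fun t => v + v * t * (v * t)) (fun t => 2 * v ^ 2 * t) (fun t => by
    have h1 : HasDerivAt (fun t : ℝ => (v : ℝ) * t) v t := by
      simpa using (hasDerivAt_id t).const_mul (v : ℝ)
    exact ((h1.fun_mul h1).const_add (v : ℝ)).congr_deriv (by ring))
  have d4 := step (fun t => 2 * v ^ 2 * t + v * t * (v + v * t * (v * t)))
    (fun t => 3 * v ^ 2 + 3 * v ^ 3 * t ^ 2) (fun t => by
    have h1 : HasDerivAt (fun t : ℝ => (v : ℝ) * t) v t := by
      simpa using (hasDerivAt_id t).const_mul (v : ℝ)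
    exact (((hasDerivAt_id t).const_mul (2 * (v : ℝ) ^ 2)).fun_add
      (h1.fun_mul ((h1.fun_mul h1).const_add (v : ℝ)))).congr_deriv (by ring))
  rw [iteratedDeriv_eq_iterate] at h
  simp only [Function.iterate_succ, Function.comp_apply, Function.iterate_zero, id] at h
  rw [d1, d2, d3, d4] at h
  simp at h
  rw [← h]

lemma integrable_exp_sq_gaussianReal :
    Integrable (fun x : ℝ => Real.exp (x ^ 2 / 2)) (gaussianReal 0 (1 / 2)) ∧
      ∫ x, Real.exp (x ^ 2 / 2) ∂(gaussianReal 0 (1 / 2)) = √2 := by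
  have hv : (1 / 2 : NNReal) ≠ 0 := by norm_num
  have e : ∀ x : ℝ, gaussianPDFReal 0 (1 / 2) x * Real.exp (x ^ 2 / 2)
      = (√Real.pi)⁻¹ * Real.exp (-(1 / 2) * x ^ 2) := by
    intro x
    rw [gaussianPDFReal_def]
    have : (2 * Real.pi * ((1 / 2 : NNReal) : ℝ)) = Real.pi := by push_cast; ring
    simp only [this]
    rw [mul_assoc, ← Real.exp_add]
    congr 2
    push_cast
    ring
  have hint : Integrable (fun x : ℝ => Real.exp (-(1 / 2) * x ^ 2)) :=
    integrable_exp_neg_mul_sq (by norm_num)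
  constructor
  · rw [gaussianReal_of_var_ne_zero _ hv,
      integrable_withDensity_iff (measurable_gaussianPDF _ _)
        (ae_of_all _ fun _ => gaussianPDF_lt_top)]
    simp only [toReal_gaussianPDF]
    refine (hint.const_mul (√Real.pi)⁻¹).congr (ae_of_all _ fun x => ?_)
    simp only
    rw [← e x]; ring
  · rw [integral_gaussianReal_eq_integral_smul hv]
    simp only [smul_eq_mul, e]
    rw [integral_const_mul, integral_gaussian]
    have : Real.pi / (1 / 2) = 2 * Real.pi := by ring
    rw [this, Real.sqrt_mul (by norm_num)]
    field_simp

lemma integrable_reImForm_pow_four {n : ℕ} (u w : Signal n) :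
    Integrable (fun a => reImForm u w a ^ 4) (stdComplexGaussian n) := by
  have h := (memLp_id_gaussianReal (μ := 0) (v := Real.toNNReal ((‖u‖ ^ 2 + ‖w‖ ^ 2) / 2)) 4)
  rw [← map_reImForm u w] at h
  have h2 := (memLp_map_measure_iff (by fun_prop) (by fun_prop)).1 h
  have h3 := h2.integrable_norm_pow (by norm_num)
  refine h3.congr (ae_of_all _ fun a => ?_)
  simp only [Function.comp, id]
  norm_num
  exact Even.pow_abs (by decide) _

lemma integral_reImForm_pow_four {n : ℕ} (u w : Signal n) :
    ∫ a, reImForm u w a ^ 4 ∂(stdComplexGaussian n) = 3 / 4 * (‖u‖ ^ 2 + ‖w‖ ^ 2) ^ 2 := by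
  have h := integral_map (μ := stdComplexGaussian n) (φ := reImForm u w) (f := fun x : ℝ => x ^ 4)
    (by fun_prop) (by fun_prop)
  rw [← h, map_reImForm, integral_pow_four_gaussianReal, Real.coe_toNNReal _ (by positivity)]
  ring

lemma reImForm_add {n : ℕ} (u u' w w' : Signal n) (a : Sensing n) :
    reImForm (u + u') (w + w') a = reImForm u w a + reImForm u' w' a := by
  simp only [reImForm, inner_add_right]; ring

lemma reImForm_sub {n : ℕ} (u u' w w' : Signal n) (a : Sensing n) :
    reImForm (u - u') (w - w') a = reImForm u w a - reImForm u' w' a := by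
  simp only [reImForm, inner_sub_right]; ring

lemma integrable_integral_add {α : Type*} [MeasurableSpace α] {μ : Measure α} {f g : α → ℝ}
    {c d : ℝ} (hf : Integrable f μ ∧ ∫ a, f a ∂μ = c) (hg : Integrable g μ ∧ ∫ a, g a ∂μ = d) :
    Integrable (fun a => f a + g a) μ ∧ ∫ a, (f a + g a) ∂μ = c + d :=
  ⟨hf.1.add hg.1, by rw [integral_add hf.1 hg.1, hf.2, hg.2]⟩

lemma integrable_integral_sub {α : Type*} [MeasurableSpace α] {μ : Measure α} {f g : α → ℝ}
    {c d : ℝ} (hf : Integrable f μ ∧ ∫ a, f a ∂μ = c) (hg : Integrable g μ ∧ ∫ a, g a ∂μ = d) :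
    Integrable (fun a => f a - g a) μ ∧ ∫ a, (f a - g a) ∂μ = c - d :=
  ⟨hf.1.sub hg.1, by rw [integral_sub hf.1 hg.1, hf.2, hg.2]⟩

/-- Wick's formula for four real linear forms of a complex Gaussian vector. -/
lemma integral_reImForm_mul_four {n : ℕ} (u₁ w₁ u₂ w₂ u₃ w₃ u₄ w₄ : Signal n) :
    Integrable (fun a => reImForm u₁ w₁ a * reImForm u₂ w₂ a * reImForm u₃ w₃ a *
        reImForm u₄ w₄ a) (stdComplexGaussian n) ∧
    ∫ a, reImForm u₁ w₁ a * reImForm u₂ w₂ a * reImForm u₃ w₃ a * reImForm u₄ w₄ a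
        ∂(stdComplexGaussian n)
      = 1 / 4 * ((inner ℝ u₁ u₂ + inner ℝ w₁ w₂) * (inner ℝ u₃ u₄ + inner ℝ w₃ w₄)
        + (inner ℝ u₁ u₃ + inner ℝ w₁ w₃) * (inner ℝ u₂ u₄ + inner ℝ w₂ w₄)
        + (inner ℝ u₁ u₄ + inner ℝ w₁ w₄) * (inner ℝ u₂ u₃ + inner ℝ w₂ w₃)) := by
  -- Polarization of the fourth power over the eight sign patterns that fix the first sign; `192 =
  -- 4! * 8`.
  have e : ∀ a, reImForm u₁ w₁ a * reImForm u₂ w₂ a * reImForm u₃ w₃ a * reImForm u₄ w₄ a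
      = 1 / 192 * (((((((reImForm (u₁ + u₂ + u₃ + u₄) (w₁ + w₂ + w₃ + w₄) a ^ 4
        - reImForm (u₁ + u₂ + u₃ - u₄) (w₁ + w₂ + w₃ - w₄) a ^ 4)
        - reImForm (u₁ + u₂ - u₃ + u₄) (w₁ + w₂ - w₃ + w₄) a ^ 4)
        - reImForm (u₁ - u₂ + u₃ + u₄) (w₁ - w₂ + w₃ + w₄) a ^ 4)
        + reImForm (u₁ + u₂ - u₃ - u₄) (w₁ + w₂ - w₃ - w₄) a ^ 4)
        + reImForm (u₁ - u₂ + u₃ - u₄) (w₁ - w₂ + w₃ - w₄) a ^ 4)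
        + reImForm (u₁ - u₂ - u₃ + u₄) (w₁ - w₂ - w₃ + w₄) a ^ 4)
        - reImForm (u₁ - u₂ - u₃ - u₄) (w₁ - w₂ - w₃ - w₄) a ^ 4) := by
    intro a
    simp only [reImForm_add, reImForm_sub]
    ring
  have I := fun u w => And.intro (integrable_reImForm_pow_four (n := n) u w)
    (integral_reImForm_pow_four u w)
  simp_rw [e]
  have key := integrable_integral_sub (integrable_integral_add (integrable_integral_add
    (integrable_integral_add (integrable_integral_sub (integrable_integral_sub
    (integrable_integral_sub (I (u₁ + u₂ + u₃ + u₄) (w₁ + w₂ + w₃ + w₄))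
      (I (u₁ + u₂ + u₃ - u₄) (w₁ + w₂ + w₃ - w₄)))
      (I (u₁ + u₂ - u₃ + u₄) (w₁ + w₂ - w₃ + w₄)))
      (I (u₁ - u₂ + u₃ + u₄) (w₁ - w₂ + w₃ + w₄)))
      (I (u₁ + u₂ - u₃ - u₄) (w₁ + w₂ - w₃ - w₄)))
      (I (u₁ - u₂ + u₃ - u₄) (w₁ - w₂ + w₃ - w₄)))
      (I (u₁ - u₂ - u₃ + u₄) (w₁ - w₂ - w₃ + w₄)))
      (I (u₁ - u₂ - u₃ - u₄) (w₁ - w₂ - w₃ - w₄))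
  refine ⟨key.1.const_mul _, ?_⟩
  rw [integral_const_mul, key.2]
  simp only [← real_inner_self_eq_norm_sq, inner_add_left, inner_add_right, inner_sub_left,
    inner_sub_right]
  rw [real_inner_comm u₁ u₂, real_inner_comm u₁ u₃, real_inner_comm u₁ u₄, real_inner_comm u₂ u₃,
    real_inner_comm u₂ u₄, real_inner_comm u₃ u₄, real_inner_comm w₁ w₂, real_inner_comm w₁ w₃,
    real_inner_comm w₁ w₄, real_inner_comm w₂ w₃, real_inner_comm w₂ w₄, real_inner_comm w₃ w₄]
  ring

/-- The real bilinear form `Re (conj ⟨a, u⟩ ⟨a, v⟩)` attached to a sensing vector. -/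
noncomputable def cross {n : ℕ} (a : Sensing n) (u v : Signal n) : ℝ :=
  inner ℝ (rePart a) u * inner ℝ (rePart a) v + inner ℝ (imPart a) u * inner ℝ (imPart a) v

lemma intensity_eq_cross {n : ℕ} (a : Sensing n) (z : Signal n) : intensity a z = cross a z z := by
  have hre : (inner ℂ a (toComplex z)).re = inner ℝ (rePart a) z := by
    simp only [PiLp.inner_apply, rePart, toComplex, Complex.re_sum]
    simp
  have him : (inner ℂ a (toComplex z)).im = -inner ℝ (imPart a) z := by
    simp only [PiLp.inner_apply, imPart, toComplex, Complex.im_sum]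
    simp
  rw [intensity, Complex.sq_norm, Complex.normSq_apply, hre, him, cross]
  ring

lemma cross_comm {n : ℕ} (a : Sensing n) (u v : Signal n) : cross a u v = cross a v u := by
  simp only [cross]; ring

lemma cross_add_left {n : ℕ} (a : Sensing n) (u u' v : Signal n) :
    cross a (u + u') v = cross a u v + cross a u' v := by
  simp only [cross, inner_add_right]; ring

lemma cross_add_right {n : ℕ} (a : Sensing n) (u v v' : Signal n) :
    cross a u (v + v') = cross a u v + cross a u v' := by
  simp only [cross, inner_add_right]; ring

lemma cross_sub_left {n : ℕ} (a : Sensing n) (u u' v : Signal n) :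
    cross a (u - u') v = cross a u v - cross a u' v := by
  simp only [cross, inner_sub_right]; ring

lemma cross_sub_right {n : ℕ} (a : Sensing n) (u v v' : Signal n) :
    cross a u (v - v') = cross a u v - cross a u v' := by
  simp only [cross, inner_sub_right]; ring

lemma cross_smul_left {n : ℕ} (a : Sensing n) (c : ℝ) (u v : Signal n) :
    cross a (c • u) v = c * cross a u v := by
  simp only [cross, real_inner_smul_right]; ring

lemma cross_smul_right {n : ℕ} (a : Sensing n) (c : ℝ) (u v : Signal n) :
    cross a u (c • v) = c * cross a u v := by
  simp only [cross, real_inner_smul_right]; ring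

lemma intensity_nonneg {n : ℕ} (a : Sensing n) (u : Signal n) : 0 ≤ intensity a u := by
  unfold intensity; positivity

lemma intensity_smul {n : ℕ} (a : Sensing n) (c : ℝ) (u : Signal n) :
    intensity a (c • u) = c ^ 2 * intensity a u := by
  rw [intensity_eq_cross, intensity_eq_cross, cross_smul_left, cross_smul_right]; ring

lemma cross_sq_le {n : ℕ} (a : Sensing n) (u v : Signal n) :
    cross a u v ^ 2 ≤ intensity a u * intensity a v := by
  rw [intensity_eq_cross, intensity_eq_cross]
  simp only [cross]
  nlinarith [sq_nonneg (inner ℝ (rePart a) u * inner ℝ (imPart a) v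
    - inner ℝ (imPart a) u * inner ℝ (rePart a) v)]

@[fun_prop]
lemma continuous_cross_left {n : ℕ} (u v : Signal n) :
    Continuous (fun a : Sensing n => cross a u v) := by
  unfold cross
  have h1 := continuous_rePart (n := n)
  have h2 := continuous_imPart (n := n)
  fun_prop

@[fun_prop]
lemma continuous_intensity_left {n : ℕ} (u : Signal n) :
    Continuous (fun a : Sensing n => intensity a u) := by
  simp only [intensity_eq_cross]; fun_prop

/-- The expectation of `cross a u v * cross a w d`. -/
noncomputable def crossMean {n : ℕ} (u v w d : Signal n) : ℝ :=
  inner ℝ u v * inner ℝ w d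
    + 1 / 2 * (inner ℝ u w * inner ℝ v d + inner ℝ v w * inner ℝ u d)

/-- Splitting both factors into real and imaginary parts gives four Wick terms. Real and imaginary
forms are uncorrelated, so the pairing inside each factor occurs in all four terms (total weight
`1`) and each cross pairing in only two (total weight `1/2`). -/
lemma integral_cross_mul_cross {n : ℕ} (u v w d : Signal n) :
    Integrable (fun a => cross a u v * cross a w d) (stdComplexGaussian n) ∧
    ∫ a, cross a u v * cross a w d ∂(stdComplexGaussian n) = crossMean u v w d := by
  have e : ∀ a, cross a u v * cross a w d
      = ((reImForm u 0 a * reImForm v 0 a * reImForm w 0 a * reImForm d 0 a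
        + reImForm u 0 a * reImForm v 0 a * reImForm 0 w a * reImForm 0 d a)
        + reImForm 0 u a * reImForm 0 v a * reImForm w 0 a * reImForm d 0 a)
        + reImForm 0 u a * reImForm 0 v a * reImForm 0 w a * reImForm 0 d a := by
    intro a
    simp only [cross, reImForm, inner_zero_right, add_zero, zero_add]
    ring
  have I := fun a b c d a' b' c' d' => integral_reImForm_mul_four (n := n) a b c d a' b' c' d'
  simp_rw [e]
  have key := integrable_integral_add (integrable_integral_add (integrable_integral_add
    (I u 0 v 0 w 0 d 0) (I u 0 v 0 0 w 0 d)) (I 0 u 0 v w 0 d 0)) (I 0 u 0 v 0 w 0 d)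
  refine ⟨key.1, key.2.trans ?_⟩
  simp only [crossMean, inner_zero_right, inner_zero_left, add_zero, zero_add]
  ring

/-- AM–GM separates the contributions of the real and the imaginary part, so their independence is
not needed; the price is the value `√2` in place of the exact `4/3`. -/
lemma integral_exp_intensity {n : ℕ} {u : Signal n} (hu : ‖u‖ = 1) :
    Integrable (fun a => Real.exp (intensity a u / 4)) (stdComplexGaussian n) ∧
    ∫ a, Real.exp (intensity a u / 4) ∂(stdComplexGaussian n) ≤ 3 / 2 := by
  have key : ∀ p q : Signal n, ‖p‖ ^ 2 + ‖q‖ ^ 2 = 1 →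
      Integrable (fun a => Real.exp (reImForm p q a ^ 2 / 2)) (stdComplexGaussian n) ∧
      ∫ a, Real.exp (reImForm p q a ^ 2 / 2) ∂(stdComplexGaussian n) = √2 := by
    intro p q hpq
    have hmap := map_reImForm p q
    have hv : Real.toNNReal ((‖p‖ ^ 2 + ‖q‖ ^ 2) / 2) = 1 / 2 := by
      rw [hpq]; ext; simp
    rw [hv] at hmap
    have hI := integrable_exp_sq_gaussianReal
    rw [← hmap] at hI
    refine ⟨(integrable_map_measure (f := reImForm p q) (g := fun x : ℝ => Real.exp (x ^ 2 / 2))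
      (by fun_prop) (by fun_prop)).1 hI.1, ?_⟩
    rw [← hI.2, integral_map (by fun_prop) (by fun_prop)]
  obtain ⟨i1, j1⟩ := key u 0 (by simp [hu])
  obtain ⟨i2, j2⟩ := key 0 u (by simp [hu])
  have hle : ∀ a, Real.exp (intensity a u / 4)
      ≤ 1 / 2 * (Real.exp (reImForm u 0 a ^ 2 / 2) + Real.exp (reImForm 0 u a ^ 2 / 2)) := by
    intro a
    have h : intensity a u = reImForm u 0 a ^ 2 + reImForm 0 u a ^ 2 := by
      rw [intensity_eq_cross]
      simp only [cross, reImForm, inner_zero_right, add_zero, zero_add]; ring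
    rw [h]
    set A := Real.exp (reImForm u 0 a ^ 2 / 4)
    set B := Real.exp (reImForm 0 u a ^ 2 / 4)
    have h1 : Real.exp ((reImForm u 0 a ^ 2 + reImForm 0 u a ^ 2) / 4) = A * B := by
      rw [← Real.exp_add]; congr 1; ring
    have h2 : Real.exp (reImForm u 0 a ^ 2 / 2) = A * A := by
      rw [← Real.exp_add]; congr 1; ring
    have h3 : Real.exp (reImForm 0 u a ^ 2 / 2) = B * B := by
      rw [← Real.exp_add]; congr 1; ring
    rw [h1, h2, h3]
    nlinarith [sq_nonneg (A - B)]
  have hint := (i1.add i2).const_mul (1 / 2)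
  have hI : Integrable (fun a => Real.exp (intensity a u / 4)) (stdComplexGaussian n) := by
    refine hint.mono' (by fun_prop) (ae_of_all _ fun a => ?_)
    rw [Real.norm_of_nonneg (Real.exp_nonneg _)]
    exact hle a
  refine ⟨hI, (integral_mono hI hint hle).trans ?_⟩
  have : ∫ a, 1 / 2 * (Real.exp (reImForm u 0 a ^ 2 / 2) + Real.exp (reImForm 0 u a ^ 2 / 2))
      ∂(stdComplexGaussian n) = √2 := by
    rw [integral_const_mul, integral_add i1 i2, j1, j2]; ring
  refine this.le.trans ?_
  rw [Real.sqrt_le_left (by norm_num)]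
  norm_num

/-- A function dominated by the exponential of the intensity in a unit direction is integrable
with a controlled integral. -/
lemma integral_le_of_le_exp {n : ℕ} {u : Signal n} (hu : ‖u‖ = 1) {C : ℝ} {f : Sensing n → ℝ}
    (hf : Measurable f) (h : ∀ a, |f a| ≤ C * Real.exp (intensity a u / 4)) :
    Integrable f (stdComplexGaussian n) ∧ ∫ a, |f a| ∂(stdComplexGaussian n) ≤ C * (3 / 2) := by
  obtain ⟨i, j⟩ := integral_exp_intensity hu
  have hI : Integrable f (stdComplexGaussian n) :=
    (i.const_mul C).mono' hf.aestronglyMeasurable (ae_of_all _ h)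
  refine ⟨hI, (integral_mono hI.abs (i.const_mul C) h).trans ?_⟩
  rw [integral_const_mul]
  have hC : 0 ≤ C := by
    have := (abs_nonneg _).trans (h 0)
    exact nonneg_of_mul_nonneg_left this (Real.exp_pos _)
  gcongr

lemma pow_le_factorial_mul_exp (k : ℕ) {t : ℝ} (ht : 0 ≤ t) :
    t ^ k ≤ (4 ^ k * k.factorial) * Real.exp (t / 4) := by
  have h := Real.pow_div_factorial_le_exp (t / 4) (by positivity) k
  rw [div_le_iff₀ (by positivity), div_pow, div_le_iff₀ (by positivity)] at h
  linarith

/-- Mixed moments of the intensities in unit directions. -/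
lemma integral_prod_intensity_le {n : ℕ} {u v w : Signal n} (hu : ‖u‖ = 1) (hv : ‖v‖ = 1)
    (hw : ‖w‖ = 1) (i j k : ℕ) :
    Integrable (fun a => intensity a u ^ i * intensity a v ^ j * intensity a w ^ k)
      (stdComplexGaussian n) ∧
    ∫ a, intensity a u ^ i * intensity a v ^ j * intensity a w ^ k ∂(stdComplexGaussian n)
      ≤ 5 * (4 ^ (i + j + k) * (i + j + k).factorial) := by
  set N := i + j + k
  set C : ℝ := 4 ^ N * N.factorial
  have hI : ∀ u : Signal n, ‖u‖ = 1 →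
      Integrable (fun a => intensity a u ^ N) (stdComplexGaussian n) ∧
      ∫ a, intensity a u ^ N ∂(stdComplexGaussian n) ≤ C * (3 / 2) := by
    intro u hu
    have h := integral_le_of_le_exp hu (C := C) (f := fun a => intensity a u ^ N) (by fun_prop)
      (fun a => by
        rw [abs_of_nonneg (pow_nonneg (intensity_nonneg a u) _)]
        exact pow_le_factorial_mul_exp N (intensity_nonneg a u))
    refine ⟨h.1, le_trans (le_of_eq ?_) h.2⟩
    refine integral_congr_ae (ae_of_all _ fun a => ?_)
    simp only
    rw [abs_of_nonneg (pow_nonneg (intensity_nonneg a u) _)]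
  -- The maximum of the three variables replaces Hölder's inequality. The three resulting pure
  -- moments are each at most `3/2 * C`, and `9/2 ≤ 5`.
  have hle : ∀ x y z : ℝ, 0 ≤ x → 0 ≤ y → 0 ≤ z →
      x ^ i * y ^ j * z ^ k ≤ x ^ N + y ^ N + z ^ N := by
    intro x y z hx hy hz
    set m := max x (max y z)
    have hxm : x ≤ m := le_max_left _ _
    have hym : y ≤ m := (le_max_left _ _).trans (le_max_right _ _)
    have hzm : z ≤ m := (le_max_right _ _).trans (le_max_right _ _)
    have h1 : x ^ i * y ^ j * z ^ k ≤ m ^ N := by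
      have : m ^ N = m ^ i * m ^ j * m ^ k := by rw [← pow_add, ← pow_add]
      rw [this]
      gcongr
    refine h1.trans ?_
    have := pow_nonneg hx N
    have := pow_nonneg hy N
    have := pow_nonneg hz N
    have hm : m = x ∨ m = y ∨ m = z := by
      rcases max_choice x (max y z) with h | h
      · exact Or.inl h
      · rcases max_choice y z with h' | h'
        · exact Or.inr (Or.inl (h.trans h'))
        · exact Or.inr (Or.inr (h.trans h'))
    rcases hm with h | h | h <;> rw [h] <;> linarith
  obtain ⟨i1, j1⟩ := hI u hu
  obtain ⟨i2, j2⟩ := hI v hv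
  obtain ⟨i3, j3⟩ := hI w hw
  have hb : ∀ a, intensity a u ^ i * intensity a v ^ j * intensity a w ^ k
      ≤ intensity a u ^ N + intensity a v ^ N + intensity a w ^ N := fun a =>
    hle _ _ _ (intensity_nonneg a u) (intensity_nonneg a v) (intensity_nonneg a w)
  have hsum := (i1.add i2).add i3
  have hint : Integrable (fun a => intensity a u ^ i * intensity a v ^ j * intensity a w ^ k)
      (stdComplexGaussian n) := by
    refine hsum.mono' (by fun_prop) (ae_of_all _ fun a => ?_)
    have := intensity_nonneg a u
    have := intensity_nonneg a v
    have := intensity_nonneg a w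
    rw [Real.norm_of_nonneg (by positivity)]
    exact hb a
  refine ⟨hint, (integral_mono hint hsum hb).trans ?_⟩
  have : ∫ a, ((fun a => intensity a u ^ N) + (fun a => intensity a v ^ N)
      + fun a => intensity a w ^ N) a ∂(stdComplexGaussian n)
      = ∫ a, intensity a u ^ N ∂(stdComplexGaussian n)
        + ∫ a, intensity a v ^ N ∂(stdComplexGaussian n)
        + ∫ a, intensity a w ^ N ∂(stdComplexGaussian n) := by
    rw [integral_add' (i1.add i2) i3, integral_add' i1 i2]
  rw [this]
  have : 0 ≤ C := by positivity
  linarith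

/-! ### Volumetric nets of sparse unit vectors and their cardinality. -/

section Nets

/-- A `δ`-separated subset of the unit sphere has at most `(1 + 2 / δ) ^ dim` elements. -/
lemma card_le_of_separated_sphere {E : Type*} [NormedAddCommGroup E] [NormedSpace ℝ E]
    [FiniteDimensional ℝ E] {δ : ℝ} (hδ : 0 < δ) (s : Finset E) (hs : ∀ c ∈ s, ‖c‖ = 1)
    (h : ∀ c ∈ s, ∀ d ∈ s, c ≠ d → δ ≤ ‖c - d‖) :
    (s.card : ℝ) ≤ (1 + 2 / δ) ^ Module.finrank ℝ E := by
  borelize E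
  let μ : Measure E := Measure.addHaar
  set r := δ / 2 with hr
  set ρ := 1 + δ / 2 with hρ
  have hrpos : 0 < r := by positivity
  have hρpos : 0 < ρ := by positivity
  have D : Set.Pairwise (s : Set E) (Function.onFun Disjoint fun c => Metric.ball (c : E) r) := by
    rintro c hc d hd hcd
    apply Metric.ball_disjoint_ball
    rw [dist_eq_norm]
    have := h c hc d hd hcd
    linarith
  have hsub : (⋃ c ∈ s, Metric.ball (c : E) r) ⊆ Metric.ball (0 : E) ρ := by
    refine Set.iUnion₂_subset fun x hx => Metric.ball_subset_ball' ?_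
    rw [dist_zero_right, hs x hx]
    linarith
  have I : (s.card : ENNReal) * ENNReal.ofReal (r ^ Module.finrank ℝ E) * μ (Metric.ball 0 1) ≤
      ENNReal.ofReal (ρ ^ Module.finrank ℝ E) * μ (Metric.ball 0 1) :=
    calc
      _ = μ (⋃ c ∈ s, Metric.ball (c : E) r) := by
        rw [measure_biUnion_finset D fun c _ => measurableSet_ball]
        simp only [μ.addHaar_ball_of_pos _ hrpos]
        simp only [Finset.sum_const, nsmul_eq_mul, mul_assoc]
      _ ≤ μ (Metric.ball (0 : E) ρ) := measure_mono hsub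
      _ = _ := by simp only [μ.addHaar_ball_of_pos _ hρpos]
  have J : (s.card : ENNReal) * ENNReal.ofReal (r ^ Module.finrank ℝ E) ≤
      ENNReal.ofReal (ρ ^ Module.finrank ℝ E) :=
    (ENNReal.mul_le_mul_iff_left (Metric.measure_ball_pos _ _ zero_lt_one).ne'
      measure_ball_lt_top.ne).1 I
  have K := ENNReal.toReal_le_of_le_ofReal (pow_nonneg hρpos.le _) J
  rw [ENNReal.toReal_mul, ENNReal.toReal_natCast, ENNReal.toReal_ofReal (by positivity)] at K
  have e : ρ = (1 + 2 / δ) * r := by rw [hρ, hr]; field_simp; ring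
  rw [e, mul_pow] at K
  exact le_of_mul_le_mul_right K (by positivity)

/-- A separated set of maximal cardinality is a net, since an uncovered point could be added. The
packing bound makes the maximum exist and bounds the size. -/
lemma exists_sphere_net (E : Type*) [NormedAddCommGroup E] [NormedSpace ℝ E]
    [FiniteDimensional ℝ E] {δ : ℝ} (hδ : 0 < δ) :
    ∃ N : Finset E, (∀ c ∈ N, ‖c‖ = 1) ∧ (∀ x, ‖x‖ = 1 → ∃ c ∈ N, ‖x - c‖ ≤ δ) ∧
      (N.card : ℝ) ≤ (1 + 2 / δ) ^ Module.finrank ℝ E := by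
  classical
  set A : Set ℕ := {k | ∃ N : Finset E, ((∀ c ∈ N, ‖c‖ = 1) ∧
    ∀ c ∈ N, ∀ d ∈ N, c ≠ d → δ ≤ ‖c - d‖) ∧ N.card = k} with hA
  have hbdd : BddAbove A := by
    refine ⟨⌈(1 + 2 / δ) ^ Module.finrank ℝ E⌉₊, ?_⟩
    rintro k ⟨N, ⟨h1, h2⟩, rfl⟩
    exact_mod_cast (card_le_of_separated_sphere hδ N h1 h2).trans (Nat.le_ceil _)
  have hne : A.Nonempty := ⟨0, ∅, by simp⟩
  obtain ⟨N, ⟨h1, h2⟩, hcard⟩ := Nat.sSup_mem hne hbdd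
  refine ⟨N, h1, fun x hx => ?_, card_le_of_separated_sphere hδ N h1 h2⟩
  by_contra! hcon
  have hxN : x ∉ N := fun hxN => by
    have := hcon x hxN
    simp at this
    linarith
  have : (insert x N).card ∈ A := by
    refine ⟨insert x N, ⟨?_, ?_⟩, rfl⟩
    · intro c hc
      rcases Finset.mem_insert.1 hc with rfl | hc
      · exact hx
      · exact h1 c hc
    · intro c hc d hd hcd
      rcases Finset.mem_insert.1 hc with rfl | hc <;> rcases Finset.mem_insert.1 hd with rfl | hd
      · exact absurd rfl hcd
      · exact (hcon d hd).le
      · rw [norm_sub_rev]; exact (hcon c ‹_›).le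
      · exact h2 c hc d hd hcd
  have h3 := le_csSup hbdd this
  rw [Finset.card_insert_of_notMem hxN, hcard] at h3
  omega

/-- The subspace of the vectors supported on `S`. -/
def coordSubspace {n : ℕ} (S : Finset (Fin n)) : Submodule ℝ (Signal n) where
  carrier := {z | ∀ i ∉ S, z i = 0}
  add_mem' := by
    intro a b ha hb i hi
    simp [ha i hi, hb i hi]
  zero_mem' := by intro i _; simp
  smul_mem' := by
    intro c a ha i hi
    simp [ha i hi]

lemma mem_coordSubspace {n : ℕ} {S : Finset (Fin n)} {z : Signal n} :
    z ∈ coordSubspace S ↔ ∀ i ∉ S, z i = 0 := Iff.rfl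

lemma supp_subset_iff {n : ℕ} {S : Finset (Fin n)} {z : Signal n} :
    supp z ⊆ S ↔ z ∈ coordSubspace S := by
  rw [mem_coordSubspace]
  simp only [supp, Finset.subset_iff, Finset.mem_filter, Finset.mem_univ, true_and]
  exact forall_congr' fun i => not_imp_comm

lemma finrank_coordSubspace_le {n : ℕ} (S : Finset (Fin n)) :
    Module.finrank ℝ (coordSubspace S) ≤ S.card := by
  let L : coordSubspace S →ₗ[ℝ] (S → ℝ) :=
    { toFun := fun z i => (z : Signal n) i
      map_add' := by intros; rfl
      map_smul' := by intros; rfl }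
  have hL : Function.Injective L := by
    intro x y h
    ext i
    by_cases hi : i ∈ S
    · exact congrFun h ⟨i, hi⟩
    · rw [x.2 i hi, y.2 i hi]
  have := LinearMap.finrank_le_finrank_of_injective hL
  simpa using this

lemma exists_coord_net {n : ℕ} (S : Finset (Fin n)) {δ : ℝ} (hδ : 0 < δ) :
    ∃ N : Finset (Signal n), (∀ c ∈ N, ‖c‖ = 1 ∧ supp c ⊆ S) ∧
      (∀ x : Signal n, ‖x‖ = 1 → supp x ⊆ S → ∃ c ∈ N, ‖x - c‖ ≤ δ) ∧
      (N.card : ℝ) ≤ (1 + 2 / δ) ^ S.card := by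
  classical
  obtain ⟨N, h1, h2, h3⟩ := exists_sphere_net (coordSubspace S) hδ
  refine ⟨N.image Subtype.val, ?_, ?_, ?_⟩
  · intro c hc
    obtain ⟨c', hc', rfl⟩ := Finset.mem_image.1 hc
    exact ⟨h1 c' hc', supp_subset_iff.2 c'.2⟩
  · intro x hx hS
    obtain ⟨c, hc, hd⟩ := h2 ⟨x, supp_subset_iff.1 hS⟩ hx
    exact ⟨c, Finset.mem_image_of_mem _ hc, hd⟩
  · refine (Nat.cast_le.2 Finset.card_image_le).trans (h3.trans ?_)
    exact pow_le_pow_right₀ (by have : 0 < 2 / δ := by positivity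
                                linarith) (finrank_coordSubspace_le S)

/-- The net point is taken in a coordinate subspace of dimension `r` that contains `x`. The
difference is therefore again `r`-sparse, which allows the approximation to be iterated. -/
lemma exists_sparse_net {n r : ℕ} (hr : r ≤ n) {δ : ℝ} (hδ : 0 < δ) :
    ∃ N : Finset (Signal n), (∀ c ∈ N, ‖c‖ = 1) ∧
      (∀ x : Signal n, ‖x‖ = 1 → (supp x).card ≤ r →
        ∃ c ∈ N, ‖x - c‖ ≤ δ ∧ (supp (x - c)).card ≤ r) ∧
      (N.card : ℝ) ≤ n.choose r * (1 + 2 / δ) ^ r := by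
  classical
  choose N h1 h2 h3 using fun S : Finset (Fin n) => exists_coord_net S hδ
  refine ⟨(Finset.powersetCard r Finset.univ).biUnion N, ?_, ?_, ?_⟩
  · intro c hc
    obtain ⟨S, -, hc⟩ := Finset.mem_biUnion.1 hc
    exact (h1 S c hc).1
  · intro x hx hxr
    obtain ⟨S, hxS, -, hS⟩ := Finset.exists_subsuperset_card_eq (Finset.subset_univ (supp x)) hxr
      (by simpa using hr)
    obtain ⟨c, hc, hd⟩ := h2 S x hx hxS
    refine ⟨c, Finset.mem_biUnion.2 ⟨S, Finset.mem_powersetCard.2 ⟨Finset.subset_univ _, hS⟩, hc⟩,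
      hd, ?_⟩
    rw [← hS]
    refine Finset.card_le_card (supp_subset_iff.2 ?_)
    exact Submodule.sub_mem _ (supp_subset_iff.1 hxS) (supp_subset_iff.1 (h1 S c hc).2)
  · refine (Nat.cast_le.2 (Finset.card_biUnion_le (s := Finset.powersetCard r Finset.univ)
      (t := N))).trans ?_
    push_cast
    calc ∑ S ∈ Finset.powersetCard r (Finset.univ : Finset (Fin n)), ((N S).card : ℝ)
        ≤ ∑ S ∈ Finset.powersetCard r (Finset.univ : Finset (Fin n)), (1 + 2 / δ) ^ r := by
          refine Finset.sum_le_sum fun S hS => ?_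
          have := h3 S
          rwa [(Finset.mem_powersetCard.1 hS).2] at this
      _ = _ := by simp

lemma supp_smul_subset {n : ℕ} (c : ℝ) (x : Signal n) : supp (c • x) ⊆ supp x := by
  rw [supp_subset_iff]
  exact Submodule.smul_mem _ _ (supp_subset_iff.1 subset_rfl)

/-- A seminorm bounded by `t` on a `1/2`-net of the sparse unit vectors is bounded by `2 t` on all
of them. -/
lemma seminorm_le_of_net {n r : ℕ} {N : Finset (Signal n)}
    (hN : ∀ x : Signal n, ‖x‖ = 1 → (supp x).card ≤ r →
        ∃ c ∈ N, ‖x - c‖ ≤ 1 / 2 ∧ (supp (x - c)).card ≤ r)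
    {q : Signal n → ℝ} (hadd : ∀ x y, q (x + y) ≤ q x + q y)
    (hsmul : ∀ (c : ℝ) x, q (c • x) = |c| * q x) {B t : ℝ} (hB : ∀ x, q x ≤ B * ‖x‖)
    (hB0 : 0 ≤ B) (ht : 0 ≤ t) (hq : ∀ c ∈ N, q c ≤ t) {d : Signal n} (hd : (supp d).card ≤ r) :
    q d ≤ 2 * t * ‖d‖ := by
  -- One approximation step turns a bound `b` into `t + b / 2`, whose fixed point is `2 t`. The
  -- crude constant `B` is halved each time and disappears in the limit.
  have key : ∀ k : ℕ, ∀ d : Signal n, (supp d).card ≤ r → q d ≤ (2 * t + B / 2 ^ k) * ‖d‖ := by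
    intro k
    induction k with
    | zero =>
      intro d _
      refine (hB d).trans ?_
      gcongr
      simp; exact ht
    | succ k ih =>
      intro d hd
      rcases eq_or_ne d 0 with rfl | hd0
      · have := hB 0
        simpa using this
      have hnorm : ‖d‖ ≠ 0 := norm_ne_zero_iff.2 hd0
      set x := ‖d‖⁻¹ • d with hx
      have hx1 : ‖x‖ = 1 := by rw [hx, norm_smul, norm_inv, norm_norm, inv_mul_cancel₀ hnorm]
      have hdx : d = ‖d‖ • x := by rw [hx, smul_smul, mul_inv_cancel₀ hnorm, one_smul]
      obtain ⟨c, hc, hxc, hs⟩ := hN x hx1 ((Finset.card_le_card (supp_smul_subset _ _)).trans hd)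
      have h1 : q x ≤ q c + q (x - c) := by
        have := hadd c (x - c)
        rwa [add_sub_cancel] at this
      have h2 := ih _ hs
      have h3 : (2 * t + B / 2 ^ k) * ‖x - c‖ ≤ (2 * t + B / 2 ^ k) * (1 / 2) := by gcongr
      have h4 := hq c hc
      have h5 : q x ≤ 2 * t + B / 2 ^ (k + 1) := by
        rw [pow_succ]
        have : B / (2 ^ k * 2) = B / 2 ^ k * (1 / 2) := by field_simp
        linarith
      calc q d = ‖d‖ * q x := by
            conv_lhs => rw [hdx]
            rw [hsmul, abs_of_nonneg (norm_nonneg d)]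
        _ ≤ ‖d‖ * (2 * t + B / 2 ^ (k + 1)) := by gcongr
        _ = _ := mul_comm _ _
  have hlim : Filter.Tendsto (fun k : ℕ => (2 * t + B / 2 ^ k) * ‖d‖) Filter.atTop
      (nhds ((2 * t + 0) * ‖d‖)) := by
    refine Filter.Tendsto.mul_const _ (Filter.Tendsto.const_add _ ?_)
    have h := (tendsto_pow_atTop_nhds_zero_of_lt_one (r := (1 / 2 : ℝ)) (by norm_num)
      (by norm_num)).const_mul B
    simp only [mul_zero] at h
    refine h.congr fun k => ?_
    rw [one_div, inv_pow]; rfl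
  have := ge_of_tendsto' hlim fun k => key k d hd
  simpa using this

/-- The term of index `r` in the binomial expansion of `(1 + r/n)^n` is at most the whole sum, hence
at most `exp r`. -/
lemma choose_le_exp {n r : ℕ} (hr : 0 < r) (hrn : r ≤ n) :
    (n.choose r : ℝ) ≤ Real.exp r * ((n : ℝ) / r) ^ r := by
  have hr' : (0 : ℝ) < r := by exact_mod_cast hr
  have hn' : (0 : ℝ) < n := by exact_mod_cast hr.trans_le hrn
  have h1 : (n.choose r : ℝ) * ((r : ℝ) / n) ^ r ≤ ((r : ℝ) / n + 1) ^ n := by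
    rw [add_pow]
    have := Finset.single_le_sum (s := Finset.range (n + 1))
      (f := fun k => ((r : ℝ) / n) ^ k * 1 ^ (n - k) * (n.choose k : ℝ))
      (fun k _ => by positivity) (Finset.mem_range.2 (Nat.lt_succ_of_le hrn))
    simp only [one_pow, mul_one] at this ⊢
    linarith
  have h2 : ((r : ℝ) / n + 1) ^ n ≤ Real.exp r := by
    calc ((r : ℝ) / n + 1) ^ n ≤ Real.exp ((r : ℝ) / n) ^ n := by
          gcongr
          exact Real.add_one_le_exp _
      _ = Real.exp r := by rw [← Real.exp_nat_mul]; congr 1; field_simp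
  have h3 := h1.trans h2
  have h4 : ((n : ℝ) / r) ^ r * ((r : ℝ) / n) ^ r = 1 := by
    rw [← mul_pow]; field_simp; simp
  calc (n.choose r : ℝ) = (n.choose r : ℝ) * ((r : ℝ) / n) ^ r * ((n : ℝ) / r) ^ r := by
        rw [mul_assoc, mul_comm (((r : ℝ) / n) ^ r), h4, mul_one]
    _ ≤ _ := by gcongr

/-- This is the role of `2 s ≤ n`: terms linear in `s`, and constants, are absorbed into `s log (n /
s)`. -/
lemma half_le_log_div {n s : ℕ} (hs : 0 < s) (hn : 2 * s ≤ n) :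
    1 / 2 ≤ Real.log ((n : ℝ) / s) := by
  have hs' : (0 : ℝ) < s := by exact_mod_cast hs
  have h2 : (2 : ℝ) ≤ n / s := by
    rw [le_div_iff₀ hs']; exact_mod_cast hn
  have := Real.log_le_log (by norm_num) h2
  have := Real.log_two_gt_d9
  linarith

/-- The cardinality of a net of the `2 s`-sparse unit vectors in terms of `s log (n / s)`. -/
lemma choose_mul_pow_le_exp {n s : ℕ} (hs : 0 < s) (hn : 2 * s ≤ n) {A : ℝ} (hA : 1 ≤ A) :
    (n.choose (2 * s) : ℝ) * A ^ (2 * s)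
      ≤ Real.exp ((6 + 4 * Real.log A) * (s * Real.log ((n : ℝ) / s))) := by
  have hs' : (0 : ℝ) < s := by exact_mod_cast hs
  have hn' : (0 : ℝ) < n := by
    have : 0 < n := by omega
    exact_mod_cast this
  have hlog := half_le_log_div hs hn
  set l := Real.log ((n : ℝ) / s) with hl
  have h1 := choose_le_exp (r := 2 * s) (by omega) hn
  have h2 : ((n : ℝ) / ((2 * s : ℕ) : ℝ)) ^ (2 * s) ≤ Real.exp (2 * s * l) := by
    have : Real.exp (2 * s * l) = ((n : ℝ) / s) ^ (2 * s) := by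
      rw [hl, mul_comm, Real.exp_mul, Real.exp_log (by positivity)]
      exact_mod_cast rfl
    rw [this]
    gcongr
    linarith
  have h3 : A ^ (2 * s) = Real.exp (2 * s * Real.log A) := by
    rw [mul_comm (2 * (s : ℝ)), Real.exp_mul, Real.exp_log (by positivity)]
    exact_mod_cast rfl
  have hlA : 0 ≤ Real.log A := Real.log_nonneg hA
  calc (n.choose (2 * s) : ℝ) * A ^ (2 * s)
      ≤ (Real.exp ((2 * s : ℕ) : ℝ) * Real.exp (2 * s * l)) * Real.exp (2 * s * Real.log A) := by
        rw [h3]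
        gcongr
        exact h1.trans (by gcongr)
    _ = Real.exp (2 * s + 2 * s * l + 2 * s * Real.log A) := by
        rw [← Real.exp_add, ← Real.exp_add]; push_cast; rfl
    _ ≤ _ := by
        -- With `1 ≤ 2 l`, the terms `2 s` and `2 s log A` are at most `4 s l` and `4 s l log A`;
        -- together with `2 s l` this gives the factor `6 + 4 log A`.
        apply Real.exp_le_exp.2
        have hsA : 0 ≤ s * Real.log A := by positivity
        nlinarith

end Nets

/-! ### Chebyshev and Chernoff bounds over one batch, and the union bound over a net. -/

section Batch

variable {Ω : Type*} [MeasurableSpace Ω] {P : Measure Ω} [IsProbabilityMeasure P] {n m : ℕ}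
  {a : Fin m → Ω → Sensing n}

/-- Chebyshev's inequality for the empirical mean over a batch. -/
lemma prob_batch_mean_ge (hlaw : ∀ j, HasLaw (a j) (stdComplexGaussian n) P)
    (hind : iIndepFun a P) {I : Finset (Fin m)} (hI : 0 < I.card) {f : Sensing n → ℝ}
    (hf : Measurable f) (hint : Integrable (fun x => f x ^ 2) (stdComplexGaussian n)) {A B t : ℝ}
    (hA : ∫ x, f x ∂(stdComplexGaussian n) ≤ A) (hB : ∫ x, f x ^ 2 ∂(stdComplexGaussian n) ≤ B)
    (ht : 0 < t) :
    P.real {ω | A + t ≤ (∑ j ∈ I, f (a j ω)) / I.card} ≤ B / (I.card * t ^ 2) := by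
  have hM : (0 : ℝ) < I.card := by exact_mod_cast hI
  have hfL : MemLp f 2 (stdComplexGaussian n) :=
    (memLp_two_iff_integrable_sq hf.aestronglyMeasurable).2 hint
  have hL : ∀ j, MemLp (fun ω => f (a j ω)) 2 P := by
    intro j
    have h := hfL
    rw [← (hlaw j).map_eq] at h
    exact h.comp_of_map (hlaw j).aemeasurable
  have hmean : ∀ j, ∫ ω, f (a j ω) ∂P = ∫ x, f x ∂(stdComplexGaussian n) := by
    intro j
    rw [← (hlaw j).map_eq, integral_map (hlaw j).aemeasurable hf.aestronglyMeasurable]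
  have hvar : ∀ j, Var[fun ω => f (a j ω); P] ≤ B := by
    intro j
    refine (variance_le_expectation_sq (hL j).1).trans (le_trans (le_of_eq ?_) hB)
    rw [← (hlaw j).map_eq, integral_map (hlaw j).aemeasurable (by fun_prop)]
    rfl
  set Y : Ω → ℝ := ∑ j ∈ I, fun ω => f (a j ω) with hY
  have hYL : MemLp Y 2 P := by
    rw [hY]; exact memLp_finsetSum' _ fun j _ => hL j
  have hYmean : ∫ ω, Y ω ∂P ≤ I.card * A := by
    simp only [hY, Finset.sum_apply]
    rw [integral_finsetSum _ fun j _ => (hL j).integrable (by norm_num)]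
    simp only [hmean, Finset.sum_const, nsmul_eq_mul]
    gcongr
  have hYvar : Var[Y; P] ≤ I.card * B := by
    rw [hY, IndepFun.variance_sum (fun j _ => hL j)]
    · calc _ ≤ ∑ j ∈ I, B := Finset.sum_le_sum fun j _ => hvar j
        _ = _ := by simp
    · intro i _ j _ hij
      exact (hind.indepFun hij).comp hf hf
  have hc : 0 < I.card * t := by positivity
  have h := meas_ge_le_variance_div_sq hYL hc
  have hsub : {ω | A + t ≤ (∑ j ∈ I, f (a j ω)) / I.card}
      ⊆ {ω | I.card * t ≤ |Y ω - ∫ ω, Y ω ∂P|} := by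
    intro ω hω
    simp only [Set.mem_ofPred_eq] at hω ⊢
    rw [le_div_iff₀ hM] at hω
    have : Y ω = ∑ j ∈ I, f (a j ω) := by simp [hY]
    refine le_trans ?_ (le_abs_self _)
    rw [this]
    linarith
  have h2 : P.real {ω | A + t ≤ (∑ j ∈ I, f (a j ω)) / I.card}
      ≤ Var[Y; P] / (I.card * t) ^ 2 := by
    refine (measureReal_mono hsub).trans ?_
    exact ENNReal.toReal_le_of_le_ofReal (div_nonneg (variance_nonneg _ _) (by positivity)) h
  refine h2.trans ?_
  rw [div_le_div_iff₀ (by positivity) (by positivity)]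
  calc Var[Y; P] * (I.card * t ^ 2) ≤ (I.card * B) * (I.card * t ^ 2) := by gcongr
    _ = _ := by ring

/-- Chernoff's bound for a sum over a batch. -/
lemma prob_batch_sum_nonneg (hlaw : ∀ j, HasLaw (a j) (stdComplexGaussian n) P)
    (hind : iIndepFun a P) (I : Finset (Fin m)) {f : Sensing n → ℝ} (hf : Measurable f)
    (hint : Integrable (fun x => Real.exp (f x)) (stdComplexGaussian n)) :
    P.real {ω | 0 ≤ ∑ j ∈ I, f (a j ω)}
      ≤ (∫ x, Real.exp (f x) ∂(stdComplexGaussian n)) ^ I.card := by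
  set X : Fin m → Ω → ℝ := fun j ω => f (a j ω) with hX
  have hXm : ∀ j, AEMeasurable (X j) P := fun j => hf.comp_aemeasurable (hlaw j).aemeasurable
  have hXi : iIndepFun X P := hind.comp (fun _ => f) fun _ => hf
  have hmgf : ∀ j, mgf (X j) P 1 = ∫ x, Real.exp (f x) ∂(stdComplexGaussian n) := by
    intro j
    rw [mgf, ← (hlaw j).map_eq, integral_map (hlaw j).aemeasurable (by fun_prop)]
    simp [hX]
  have hXint : ∀ j, Integrable (fun ω => Real.exp (X j ω)) P := by
    intro j
    have h := hint
    rw [← (hlaw j).map_eq] at h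
    exact h.comp_aemeasurable (hlaw j).aemeasurable
  have hmul : mgf (∑ j ∈ I, X j) P 1 = (∫ x, Real.exp (f x) ∂(stdComplexGaussian n)) ^ I.card := by
    rw [hXi.mgf_sum₀ hXm]
    simp [hmgf]
  rw [← hmul]
  -- If the exponential of the sum were not integrable, its moment generating function would take
  -- the default value `0`. By independence it is a product of positive numbers.
  have hsum : Integrable (fun ω => Real.exp (1 * (∑ j ∈ I, X j) ω)) P := by
    by_contra hni
    have h0 : mgf (∑ j ∈ I, X j) P 1 = 0 := integral_undef hni
    rw [hXi.mgf_sum₀ hXm, Finset.prod_eq_zero_iff] at h0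
    obtain ⟨j, _, hj⟩ := h0
    have : 0 < mgf (X j) P 1 := mgf_pos (by simpa using hXint j)
    linarith
  have h := measure_ge_le_exp_mul_mgf (μ := P) (X := ∑ j ∈ I, X j) 0 zero_le_one hsum
  simpa [Measure.real, Finset.sum_apply] using h

end Batch

lemma measurable_intensity_left {n : ℕ} (u : Signal n) :
    Measurable (fun a : Sensing n => intensity a u) := (continuous_intensity_left u).measurable

lemma measurable_cross_left {n : ℕ} (u v : Signal n) :
    Measurable (fun a : Sensing n => cross a u v) := (continuous_cross_left u v).measurable

/-- A batch `I` of at least `C s log (n / s)` independent complex Gaussian sensing vectors. -/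
structure IsBatch {Ω : Type*} [MeasurableSpace Ω] (P : Measure Ω) {n m : ℕ} (s : ℕ)
    (a : Fin m → Ω → Sensing n) (I : Finset (Fin m)) (C : ℝ) : Prop where
  prob : IsProbabilityMeasure P
  law : ∀ j, HasLaw (a j) (stdComplexGaussian n) P
  indep : iIndepFun a P
  sparsity_pos : 0 < s
  two_mul_le : 2 * s ≤ n
  const_pos : 0 < C
  card_ge : C * (s * Real.log ((n : ℝ) / s)) ≤ I.card

section

variable {Ω : Type*} [MeasurableSpace Ω] {P : Measure Ω} {n m s : ℕ}
  {a : Fin m → Ω → Sensing n} {I : Finset (Fin m)} {C : ℝ}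

lemma IsBatch.scale_pos (h : IsBatch P s a I C) : 0 < s * Real.log ((n : ℝ) / s) := by
  have h1 := half_le_log_div h.sparsity_pos h.two_mul_le
  have h2 : (0 : ℝ) < s := by exact_mod_cast h.sparsity_pos
  have : 0 < Real.log ((n : ℝ) / s) := by linarith
  positivity

lemma IsBatch.card_pos (h : IsBatch P s a I C) : 0 < I.card := by
  have h1 := mul_pos h.const_pos h.scale_pos
  exact_mod_cast h1.trans_le h.card_ge

lemma IsBatch.mono (h : IsBatch P s a I C) {C' : ℝ} (hC' : 0 < C') (hle : C' ≤ C) :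
    IsBatch P s a I C' :=
  { h with
    const_pos := hC'
    card_ge := (mul_le_mul_of_nonneg_right hle h.scale_pos.le).trans h.card_ge }

/-- Chernoff's bound, uniformly over a net of the sparse unit vectors. -/
lemma prob_exists_mem_net {κ A : ℝ} (hκ : 0 < κ) (hA : 1 ≤ A)
    (h : IsBatch P s a I (2 * (6 + 4 * Real.log A) / κ + 2 / κ)) {N : Finset (Signal n)}
    (hN : (N.card : ℝ) ≤ n.choose (2 * s) * A ^ (2 * s)) {f : Signal n → Sensing n → ℝ}
    (hf : ∀ c, Measurable (f c))
    (hint : ∀ c ∈ N, Integrable (fun x => Real.exp (f c x)) (stdComplexGaussian n))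
    (hexp : ∀ c ∈ N, ∫ x, Real.exp (f c x) ∂(stdComplexGaussian n) ≤ Real.exp (-κ)) :
    P.real {ω | ∃ c ∈ N, 0 ≤ ∑ j ∈ I, f c (a j ω)} ≤ 2 / κ / I.card := by
  have := h.prob
  have hM : (0 : ℝ) < I.card := by exact_mod_cast h.card_pos
  set T := s * Real.log ((n : ℝ) / s) with hT
  have hTpos : 0 < T := h.scale_pos
  have hset : {ω | ∃ c ∈ N, 0 ≤ ∑ j ∈ I, f c (a j ω)}
      = ⋃ c ∈ N, {ω | 0 ≤ ∑ j ∈ I, f c (a j ω)} := by ext; simp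
  have hlA : 0 ≤ Real.log A := Real.log_nonneg hA
  calc P.real {ω | ∃ c ∈ N, 0 ≤ ∑ j ∈ I, f c (a j ω)}
      ≤ ∑ c ∈ N, P.real {ω | 0 ≤ ∑ j ∈ I, f c (a j ω)} := by
        rw [hset]; exact measureReal_biUnion_finset_le _ _
    _ ≤ ∑ c ∈ N, Real.exp (-κ) ^ I.card := by
        refine Finset.sum_le_sum fun c hc => ?_
        refine (prob_batch_sum_nonneg h.law h.indep I (hf c) (hint c hc)).trans ?_
        have : 0 ≤ ∫ x, Real.exp (f c x) ∂(stdComplexGaussian n) :=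
          integral_nonneg fun _ => (Real.exp_pos _).le
        gcongr
        exact hexp c hc
    _ = N.card * Real.exp (-κ * I.card) := by
        rw [Finset.sum_const, nsmul_eq_mul, ← Real.exp_nat_mul]
        congr 2; ring
    _ ≤ Real.exp ((6 + 4 * Real.log A) * T) * Real.exp (-κ * I.card) := by
        gcongr
        exact hN.trans (choose_mul_pow_le_exp h.sparsity_pos h.two_mul_le hA)
    -- The batch size makes the log-cardinality of the net at most `κ |I| / 2`, half of the Chernoff
    -- exponent. The other half is exponential decay, weakened below to `1 / |I|` through `t ≤ exp
    -- t`.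
    _ ≤ Real.exp (-(κ * I.card / 2)) := by
        rw [← Real.exp_add]
        apply Real.exp_le_exp.2
        have h1 := h.card_ge
        rw [← hT] at h1
        have h2 : (2 * (6 + 4 * Real.log A) / κ) * T ≤ I.card := by
          refine le_trans ?_ h1
          have : 0 ≤ 2 / κ * T := by positivity
          linarith
        have h3 : κ * ((2 * (6 + 4 * Real.log A) / κ) * T) ≤ κ * I.card := by gcongr
        have h4 : κ * ((2 * (6 + 4 * Real.log A) / κ) * T) = 2 * ((6 + 4 * Real.log A) * T) := by
          field_simp
        linarith
    _ ≤ 2 / κ / I.card := by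
        rw [Real.exp_neg]
        have h1 : κ * I.card / 2 ≤ Real.exp (κ * I.card / 2) := by
          have := Real.add_one_le_exp (κ * I.card / 2)
          linarith
        have h2 : 2 / κ / I.card = (κ * I.card / 2)⁻¹ := by field_simp
        rw [h2]
        gcongr

end

/-! ### Concentration of the empirical forms, uniform in one sparse direction. -/

lemma norm_toComplex {n : ℕ} (z : Signal n) : ‖toComplex z‖ = ‖z‖ := by
  simp [EuclideanSpace.norm_eq, toComplex]

lemma toComplex_add {n : ℕ} (y z : Signal n) :
    toComplex (y + z) = toComplex y + toComplex z := by
  ext i; simp [toComplex]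

lemma toComplex_smul {n : ℕ} (c : ℝ) (z : Signal n) :
    toComplex (c • z) = (c : ℂ) • toComplex z := by
  ext i; simp [toComplex]

lemma intensity_le {n : ℕ} (a : Sensing n) (z : Signal n) :
    intensity a z ≤ ‖a‖ ^ 2 * ‖z‖ ^ 2 := by
  rw [intensity, ← norm_toComplex z, ← mul_pow]
  gcongr
  exact norm_inner_le_norm _ _

/-- If the empirical intensities of a net are bounded by `4`, then those of all sparse unit
vectors are bounded by `16`. -/
lemma sum_intensity_le_of_net {n m r : ℕ} {N : Finset (Signal n)}
    (hN : ∀ x : Signal n, ‖x‖ = 1 → (supp x).card ≤ r →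
        ∃ c ∈ N, ‖x - c‖ ≤ 1 / 2 ∧ (supp (x - c)).card ≤ r)
    {a : Fin m → Sensing n} {I : Finset (Fin m)}
    (h : ∀ c ∈ N, ∑ j ∈ I, intensity (a j) c ≤ 4 * I.card) {d : Signal n}
    (hd : (supp d).card ≤ r) : ∑ j ∈ I, intensity (a j) d ≤ 16 * I.card * ‖d‖ ^ 2 := by
  -- The square root of the empirical sum is the norm of a linear image of `d`, hence a seminorm.
  -- Passing from the net to all directions doubles it, so its square is multiplied by four.
  set v : Signal n → EuclideanSpace ℂ I := fun d =>
    WithLp.toLp 2 (fun j : I => inner ℂ (a j) (toComplex d)) with hv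
  have hsq : ∀ d, ‖v d‖ ^ 2 = ∑ j ∈ I, intensity (a j) d := by
    intro d
    rw [EuclideanSpace.norm_sq_eq, ← Finset.sum_coe_sort I (fun j => intensity (a j) d)]
    rfl
  have hadd : ∀ x y, v (x + y) = v x + v y := by
    intro x y; ext j; simp [hv, toComplex_add]
  have hsmul : ∀ (c : ℝ) x, v (c • x) = (c : ℂ) • v x := by
    intro c x; ext j; simp [hv, toComplex_smul]
  have hB : ∀ x, ‖v x‖ ≤ √(∑ j ∈ I, ‖a j‖ ^ 2) * ‖x‖ := by
    intro x
    rw [← Real.sqrt_sq (norm_nonneg x), ← Real.sqrt_mul (by positivity)]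
    apply Real.le_sqrt_of_sq_le
    rw [hsq, Finset.sum_mul]
    exact Finset.sum_le_sum fun j _ => intensity_le _ _
  have hM : (0 : ℝ) ≤ I.card := by positivity
  have key := seminorm_le_of_net hN (q := fun d => ‖v d‖) (t := 2 * √I.card)
    (fun x y => by simp only [hadd]; exact norm_add_le _ _)
    (fun c x => by simp only [hsmul, norm_smul, Complex.norm_real, Real.norm_eq_abs])
    hB (by positivity) (by positivity)
    (fun c hc => by
      have h1 := h c hc
      rw [← hsq] at h1
      refine abs_le_of_sq_le_sq' ?_ (by positivity) |>.2
      rw [mul_pow, Real.sq_sqrt hM]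
      linarith) hd
  rw [← hsq]
  calc ‖v d‖ ^ 2 ≤ (2 * (2 * √I.card) * ‖d‖) ^ 2 := by gcongr
    _ = 16 * (√I.card) ^ 2 * ‖d‖ ^ 2 := by ring
    _ = _ := by rw [Real.sq_sqrt hM]

/-- Input to the Chernoff bound for an empirical intensity of at least `4`, with `κ = 1/4`: `3/2 ≤
exp (3/4)`. -/
lemma integral_exp_intensity_sub_one {n : ℕ} {c : Signal n} (hc : ‖c‖ = 1) :
    Integrable (fun x => Real.exp (intensity x c / 4 - 1)) (stdComplexGaussian n) ∧
    ∫ x, Real.exp (intensity x c / 4 - 1) ∂(stdComplexGaussian n) ≤ Real.exp (-(1 / 4)) := by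
  obtain ⟨i, j⟩ := integral_exp_intensity hc
  simp only [sub_eq_add_neg, Real.exp_add]
  refine ⟨i.mul_const _, ?_⟩
  rw [integral_mul_const]
  have h1 : (3 / 2 : ℝ) ≤ Real.exp (3 / 4) := by
    have := Real.add_one_le_exp (3 / 4 : ℝ)
    linarith
  calc _ ≤ Real.exp (3 / 4) * Real.exp (-1) := by gcongr; exact j.trans h1
    _ = _ := by rw [← Real.exp_add]; norm_num

lemma exp_le_one_add_add_sq (t : ℝ) : Real.exp t ≤ 1 + t + t ^ 2 * Real.exp |t| := by
  have h1 : Real.exp t * (1 - t) ≤ 1 := by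
    have := Real.add_one_le_exp (-t)
    calc Real.exp t * (1 - t) ≤ Real.exp t * Real.exp (-t) := by gcongr; linarith
      _ = 1 := by rw [← Real.exp_add]; simp
  have h2 : t * (Real.exp t - 1) ≤ t ^ 2 * Real.exp |t| := by
    rcases le_total 0 t with ht | ht
    · rw [abs_of_nonneg ht, sq, mul_assoc]
      gcongr
      linarith
    · have h3 := Real.add_one_le_exp t
      have h4 : (1 : ℝ) ≤ Real.exp |t| := Real.one_le_exp (abs_nonneg t)
      nlinarith [mul_nonneg (neg_nonneg.2 ht) (sub_nonneg.2 h3), sq_nonneg t,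
        mul_nonneg (sq_nonneg t) (sub_nonneg.2 h4)]
  linarith

lemma exp_neg_le {t : ℝ} (ht : 0 ≤ t) : Real.exp (-t) ≤ 1 - t + t ^ 2 := by
  have h1 : Real.exp (-t) * (1 + t) ≤ 1 := by
    have := Real.add_one_le_exp t
    calc Real.exp (-t) * (1 + t) ≤ Real.exp (-t) * Real.exp t := by gcongr; linarith
      _ = 1 := by rw [← Real.exp_add]; simp
  have h2 := Real.add_one_le_exp (-t)
  nlinarith

/-- An exponential moment bound for a centred variable dominated by `L √(intensity)`. -/
lemma integral_exp_centered_le {n : ℕ} {c : Signal n} (hc : ‖c‖ = 1) {L lam : ℝ} (hL : 0 ≤ L)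
    (hlam : |lam| * L ≤ 1) {f : Sensing n → ℝ} (hf : Measurable f)
    (hfle : ∀ a, |f a| ≤ L * √(intensity a c)) :
    Integrable (fun a => Real.exp (lam * (f a - ∫ b, f b ∂(stdComplexGaussian n))))
      (stdComplexGaussian n) ∧
    ∫ a, Real.exp (lam * (f a - ∫ b, f b ∂(stdComplexGaussian n))) ∂(stdComplexGaussian n)
      ≤ 1 + 3 * Real.exp 12 * (|lam| * L) ^ 2 := by
  set E := ∫ b, f b ∂(stdComplexGaussian n) with hE
  -- Integrating gives `E |f| ≤ 15/4 * L`, whence the bound `4 L` on the mean.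
  have hr : ∀ a, √(intensity a c) ≤ 5 / 2 * Real.exp (intensity a c / 4) := by
    intro a
    have h1 := intensity_nonneg a c
    have h2 := Real.add_one_le_exp (intensity a c / 4)
    have h3 := Real.sq_sqrt h1
    nlinarith [sq_nonneg (√(intensity a c) - 1), Real.sqrt_nonneg (intensity a c)]
  obtain ⟨hfi, hfb⟩ := integral_le_of_le_exp hc (C := L * (5 / 2)) hf (fun a => by
    refine (hfle a).trans ?_
    rw [mul_assoc]
    gcongr
    exact hr a)
  have hEle : |E| ≤ 4 * L := by
    have := abs_integral_le_integral_abs (f := f) (μ := stdComplexGaussian n)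
    rw [← hE] at this
    linarith
  set x := |lam| * L with hx
  have hx0 : 0 ≤ x := by positivity
  have hpt : ∀ a, Real.exp (lam * (f a - E)) ≤ 1 + lam * (f a - E)
      + 2 * Real.exp 12 * x ^ 2 * Real.exp (intensity a c / 4) := by
    intro a
    refine (exp_le_one_add_add_sq _).trans ?_
    set r := √(intensity a c) with hr'
    have hr0 : 0 ≤ r := Real.sqrt_nonneg _
    have hr2 : r ^ 2 = intensity a c := Real.sq_sqrt (intensity_nonneg a c)
    have ht : |lam * (f a - E)| ≤ x * (r + 4) := by
      rw [abs_mul, hx, mul_assoc]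
      gcongr
      calc |f a - E| ≤ |f a| + |E| := abs_sub _ _
        _ ≤ L * r + 4 * L := add_le_add (hfle a) hEle
        _ = _ := by ring
    have ht1 : |lam * (f a - E)| ≤ r + 4 := ht.trans (by nlinarith)
    have h1 : (lam * (f a - E)) ^ 2 ≤ x ^ 2 * (r + 4) ^ 2 := by
      rw [← sq_abs, ← mul_pow]; gcongr
    have h2 : (r + 4) ^ 2 ≤ 2 * Real.exp (r + 4) := by
      have := Real.quadratic_le_exp_of_nonneg (x := r + 4) (by positivity)
      nlinarith
    -- The inequality `2 (r + 4) ≤ 12 + r² / 4` is a completed square; it is the origin of `exp 12`.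
    have h3 : Real.exp (r + 4) * Real.exp (r + 4) ≤ Real.exp 12 * Real.exp (intensity a c / 4) := by
      rw [← Real.exp_add, ← Real.exp_add]
      apply Real.exp_le_exp.2
      rw [← hr2]
      nlinarith [sq_nonneg (r / 2 - 2)]
    have h4 : (lam * (f a - E)) ^ 2 * Real.exp |lam * (f a - E)|
        ≤ 2 * Real.exp 12 * x ^ 2 * Real.exp (intensity a c / 4) := by
      calc (lam * (f a - E)) ^ 2 * Real.exp |lam * (f a - E)|
          ≤ (x ^ 2 * (2 * Real.exp (r + 4))) * Real.exp (r + 4) := by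
            gcongr
            exact h1.trans (by gcongr)
        _ = 2 * x ^ 2 * (Real.exp (r + 4) * Real.exp (r + 4)) := by ring
        _ ≤ 2 * x ^ 2 * (Real.exp 12 * Real.exp (intensity a c / 4)) := by gcongr
        _ = _ := by ring
    linarith
  obtain ⟨i, j⟩ := integral_exp_intensity hc
  have hlin : Integrable (fun a => 1 + lam * (f a - E)) (stdComplexGaussian n) :=
    (integrable_const _).add ((hfi.sub (integrable_const _)).const_mul _)
  have hlin_eq : ∫ a, (1 + lam * (f a - E)) ∂(stdComplexGaussian n) = 1 := by
    have h1 := integrable_integral_sub (c := E) (d := E) ⟨hfi, rfl⟩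
      ⟨integrable_const (μ := stdComplexGaussian n) E, by simp⟩
    have h2 := integrable_integral_add (c := 1) (d := lam * (E - E))
      (f := fun _ : Sensing n => (1 : ℝ)) ⟨integrable_const (μ := stdComplexGaussian n) 1, by simp⟩
      ⟨h1.1.const_mul lam, by rw [integral_const_mul, h1.2]⟩
    rw [h2.2]; ring
  have hdom := hlin.add (i.const_mul (2 * Real.exp 12 * x ^ 2))
  have hint : Integrable (fun a => Real.exp (lam * (f a - E))) (stdComplexGaussian n) := by
    refine hdom.mono' (by fun_prop) (ae_of_all _ fun a => ?_)
    rw [Real.norm_of_nonneg (Real.exp_nonneg _)]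
    exact hpt a
  refine ⟨hint, (integral_mono hint hdom hpt).trans ?_⟩
  rw [integral_add' hlin (i.const_mul (2 * Real.exp 12 * x ^ 2)), integral_const_mul, hlin_eq]
  have : 0 ≤ 2 * Real.exp 12 * x ^ 2 := by positivity
  nlinarith

/-- Cauchy–Schwarz for both forms, arranged so that the varying direction `d` enters only through
`√(intensity a d)`. The other factor involves fixed vectors alone and can be truncated independently
of `d`. -/
lemma abs_cross_mul_cross_le {n : ℕ} (a : Sensing n) (u v w d : Signal n) :
    |cross a u v * cross a w d|
      ≤ √(intensity a u * intensity a v * intensity a w) * √(intensity a d) := by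
  have hu := intensity_nonneg a u
  have hv := intensity_nonneg a v
  have hw := intensity_nonneg a w
  rw [← Real.sqrt_mul (by positivity)]
  apply Real.abs_le_sqrt
  rw [mul_pow]
  calc cross a u v ^ 2 * cross a w d ^ 2
      ≤ (intensity a u * intensity a v) * (intensity a w * intensity a d) :=
        mul_le_mul (cross_sq_le a u v) (cross_sq_le a w d) (sq_nonneg _) (by positivity)
    _ = _ := by ring

/-- Constants bounding mixed moments of total degree `k` of intensities in unit directions. -/
noncomputable def momentConst (k : ℕ) : ℝ := 5 * (4 ^ k * k.factorial)

lemma momentConst_pos (k : ℕ) : 0 < momentConst k := by unfold momentConst; positivity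

lemma crossMean_add_right {n : ℕ} (u v w d d' : Signal n) :
    crossMean u v w (d + d') = crossMean u v w d + crossMean u v w d' := by
  simp only [crossMean, inner_add_right]; ring

lemma crossMean_smul_right {n : ℕ} (u v w d : Signal n) (c : ℝ) :
    crossMean u v w (c • d) = c * crossMean u v w d := by
  simp only [crossMean, real_inner_smul_right]; ring

lemma exists_bound_of_linear {n : ℕ} {F : Signal n → ℝ} (hadd : ∀ x y, F (x + y) = F x + F y)
    (hsmul : ∀ (c : ℝ) x, F (c • x) = c * F x) : ∃ B, 0 ≤ B ∧ ∀ x, |F x| ≤ B * ‖x‖ := by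
  let L : Signal n →ₗ[ℝ] ℝ := { toFun := F, map_add' := hadd, map_smul' := hsmul }
  exact ⟨‖L.toContinuousLinearMap‖, norm_nonneg _, fun x =>
    L.toContinuousLinearMap.le_opNorm x⟩

set_option maxHeartbeats 1000000 in
/-- Concentration of the cubic empirical process, uniformly over sparse directions, for unit
vectors. -/
lemma prob_cross_deviation_unit {η : ℝ} (hη : 0 < η) (hη1 : η ≤ 1) :
    ∃ C : ℝ, 0 < C ∧ ∀ {Ω : Type uΩ} [MeasurableSpace Ω] {P : Measure Ω} {n m s : ℕ}
      {a : Fin m → Ω → Sensing n} {I : Finset (Fin m)}, IsBatch P s a I C →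
      ∀ u v w : Signal n, ‖u‖ = 1 → ‖v‖ = 1 → ‖w‖ = 1 →
      P.real {ω | ∃ d : Signal n, (supp d).card ≤ 2 * s ∧ η * ‖d‖ <
        |(∑ j ∈ I, cross (a j ω) u v * cross (a j ω) w d) / I.card - crossMean u v w d|}
        ≤ C / I.card := by
  set c6 := momentConst 6 with hc6
  set c12 := momentConst 12 with hc12
  have hc6p : 0 < c6 := momentConst_pos 6
  have hc12p : 0 < c12 := momentConst_pos 12
  -- The truncation level: the discarded part has mean at most `(c6 + 20) / (2 L) = η / 8`, where
  -- `c6` bounds `E G²` and `20` bounds the mean intensity of a net point.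
  set L := 4 * (c6 + 20) / η with hL
  have hLp : 0 < L := by positivity
  have hLη : (c6 + 20) / (2 * L) = η / 8 := by rw [hL]; field_simp; ring
  have hL1 : 1 ≤ L := by rw [hL, le_div_iff₀ hη]; linarith
  set K := 3 * Real.exp 12 with hK
  have hK1 : 1 ≤ K := by
    have := Real.add_one_le_exp (12 : ℝ)
    linarith
  have hKp : 0 < K := by linarith
  -- Makes the second-order term `K (lam L)²` equal to `lam η / 8`. A deviation `η / 4` gains `lam η
  -- / 4`, so the net exponent is `κ = lam η / 8`.
  set lam := η / (8 * K * L ^ 2) with hlam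
  have hlamp : 0 < lam := by positivity
  have hlamL : lam * L ≤ 1 := by
    have e : lam * L = η / (8 * K * L) := by rw [hlam]; field_simp
    rw [e, div_le_one (by positivity)]
    nlinarith
  have hlamK : K * (lam * L) ^ 2 = lam * η / 8 := by rw [hlam]; field_simp
  set κ := lam * η / 8 with hκ
  have hκp : 0 < κ := by positivity
  have hlog5 : 0 ≤ Real.log 5 := Real.log_nonneg (by norm_num)
  set C₁ := 2 * (6 + 4 * Real.log 5) / κ + 2 / κ with hC₁
  set C₂ := 2 * (6 + 4 * Real.log 5) / (1 / 4) + 2 / (1 / 4) with hC₂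
  have hC₁p : 0 < C₁ := by positivity
  have hC₂p : 0 < C₂ := by positivity
  have hC₁κ : 2 / κ ≤ C₁ := by
    have : 0 ≤ 2 * (6 + 4 * Real.log 5) / κ := by positivity
    linarith
  have hC₂κ : 2 / (1 / 4) ≤ C₂ := by
    have : 0 ≤ 2 * (6 + 4 * Real.log 5) / (1 / 4) := by positivity
    linarith
  refine ⟨2 * C₁ + C₂ + c12, by positivity, ?_⟩
  intro Ω _ P n m s a I hb u v w hu hv hw
  have hprob := hb.prob
  have hM : (0 : ℝ) < I.card := by exact_mod_cast hb.card_pos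
  have hb₁ : IsBatch P s a I C₁ := hb.mono hC₁p (by linarith)
  have hb₂ : IsBatch P s a I C₂ := hb.mono hC₂p (by linarith)
  obtain ⟨N, hN1, hN2, hN3⟩ := exists_sparse_net hb.two_mul_le (δ := 1 / 2) (by norm_num)
  have hN3' : (N.card : ℝ) ≤ n.choose (2 * s) * 5 ^ (2 * s) := by
    refine hN3.trans (le_of_eq ?_); norm_num
  set G : Sensing n → ℝ := fun x => intensity x u * intensity x v * intensity x w with hG
  have hGm : Measurable G := by
    have := measurable_intensity_left u
    have := measurable_intensity_left v
    have := measurable_intensity_left w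
    fun_prop
  have hG0 : ∀ x, 0 ≤ G x := fun x => by
    have := intensity_nonneg x u
    have := intensity_nonneg x v
    have := intensity_nonneg x w
    positivity
  -- The truncation event does not depend on `c`. On it the product is at most `L √(intensity x c)`,
  -- which is sub-Gaussian in size, so Chernoff applies to every net point.
  set Y : Signal n → Sensing n → ℝ := fun c x =>
    if G x ≤ L ^ 2 then cross x u v * cross x w c else 0 with hY
  have hYm : ∀ c, Measurable (Y c) := fun c =>
    Measurable.ite (measurableSet_le hGm measurable_const)
      ((measurable_cross_left u v).mul (measurable_cross_left w c)) measurable_const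
  have hYle : ∀ c x, |Y c x| ≤ L * √(intensity x c) := by
    intro c x
    simp only [hY]
    split_ifs with h
    · refine (abs_cross_mul_cross_le x u v w c).trans ?_
      gcongr
      exact Real.sqrt_le_iff.2 ⟨hLp.le, h⟩
    · simp only [abs_zero]; positivity
  -- Where `G > L²`, `√G ≤ G / L`, and AM–GM then separates `G²`, which does not see `c`, from the
  -- intensity of `c`.
  have hZle : ∀ c x, |cross x u v * cross x w c - Y c x|
      ≤ 1 / (2 * L) * (G x ^ 2 + intensity x c) := by
    intro c x
    have hI0 := intensity_nonneg x c
    simp only [hY]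
    split_ifs with h
    · simp only [sub_self, abs_zero]; positivity
    · rw [sub_zero]
      refine (abs_cross_mul_cross_le x u v w c).trans ?_
      change √(G x) * √(intensity x c) ≤ _
      push Not at h
      have h1 : L ≤ √(G x) := Real.le_sqrt_of_sq_le h.le
      have h2 : √(G x) * L ≤ G x := by
        calc √(G x) * L ≤ √(G x) * √(G x) := by gcongr
          _ = G x := Real.mul_self_sqrt (hG0 x)
      have h3 : √(G x) ≤ G x / L := by rwa [le_div_iff₀ hLp]
      calc √(G x) * √(intensity x c) ≤ G x / L * √(intensity x c) := by gcongr
        _ = 1 / (2 * L) * (2 * G x * √(intensity x c)) := by field_simp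
        _ ≤ 1 / (2 * L) * (G x ^ 2 + intensity x c) := by
          gcongr
          have := two_mul_le_add_sq (G x) (√(intensity x c))
          rwa [Real.sq_sqrt hI0] at this
  have hm2 := integral_prod_intensity_le hu hv hw 2 2 2
  have hm4 := integral_prod_intensity_le hu hv hw 4 4 4
  have hG2 : ∀ x, G x ^ 2 = intensity x u ^ 2 * intensity x v ^ 2 * intensity x w ^ 2 := by
    intro x; simp only [hG]; ring
  have hG4 : ∀ x, (G x ^ 2) ^ 2
      = intensity x u ^ 4 * intensity x v ^ 4 * intensity x w ^ 4 := by
    intro x; simp only [hG]; ring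
  have hG2i : Integrable (fun x => G x ^ 2) (stdComplexGaussian n) := by
    simp_rw [hG2]; exact hm2.1
  have hG2b : ∫ x, G x ^ 2 ∂(stdComplexGaussian n) ≤ c6 := by
    simp_rw [hG2]; exact hm2.2
  have hG4i : Integrable (fun x => (G x ^ 2) ^ 2) (stdComplexGaussian n) := by
    simp_rw [hG4]; exact hm4.1
  have hG4b : ∫ x, (G x ^ 2) ^ 2 ∂(stdComplexGaussian n) ≤ c12 := by
    simp_rw [hG4]; exact hm4.2
  have hIc : ∀ c ∈ N, Integrable (fun x => intensity x c) (stdComplexGaussian n) ∧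
      ∫ x, intensity x c ∂(stdComplexGaussian n) ≤ 20 := by
    intro c hc
    have h := integral_prod_intensity_le (hN1 c hc) (hN1 c hc) (hN1 c hc) 1 0 0
    simp only [pow_one, pow_zero, mul_one] at h
    refine ⟨h.1, h.2.trans ?_⟩
    norm_num [Nat.factorial]
  set EY : Signal n → ℝ := fun c => ∫ x, Y c x ∂(stdComplexGaussian n) with hEY
  have hmean : ∀ c ∈ N, |crossMean u v w c - EY c| ≤ η / 8 := by
    intro c hc
    obtain ⟨i1, j1⟩ := integral_cross_mul_cross u v w c
    have hYi : Integrable (Y c) (stdComplexGaussian n) := by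
      refine i1.mono (hYm c).aestronglyMeasurable (ae_of_all _ fun x => ?_)
      simp only [hY, Real.norm_eq_abs]
      split_ifs
      · exact le_rfl
      · rw [abs_zero]; exact abs_nonneg _
    rw [← j1, ← integral_sub i1 hYi]
    refine (abs_integral_le_integral_abs).trans ?_
    have hdom := (hG2i.add (hIc c hc).1).const_mul (1 / (2 * L))
    refine (integral_mono (i1.sub hYi).abs hdom (hZle c)).trans ?_
    rw [integral_const_mul, integral_add' hG2i (hIc c hc).1]
    calc _ ≤ 1 / (2 * L) * (c6 + 20) := by
          gcongr
          exact (hIc c hc).2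
      _ = (c6 + 20) / (2 * L) := by ring
      _ = η / 8 := hLη
  -- the exceptional events
  have hexp : ∀ l : ℝ, |l| = lam → ∀ c ∈ N,
      Integrable (fun x => Real.exp (l * (Y c x - EY c) - lam * η / 4)) (stdComplexGaussian n) ∧
      ∫ x, Real.exp (l * (Y c x - EY c) - lam * η / 4) ∂(stdComplexGaussian n)
        ≤ Real.exp (-κ) := by
    intro l hl c hc
    obtain ⟨i1, j1⟩ := integral_exp_centered_le (hN1 c hc) (L := L) (lam := l) hLp.le
      (by rw [hl]; exact hlamL) (hYm c) (hYle c)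
    simp only [sub_eq_add_neg _ (lam * η / 4), Real.exp_add]
    refine ⟨i1.mul_const _, ?_⟩
    rw [integral_mul_const]
    rw [hl, hlamK] at j1
    calc _ ≤ (1 + κ) * Real.exp (-(lam * η / 4)) := by gcongr
      _ ≤ Real.exp κ * Real.exp (-(lam * η / 4)) := by
        gcongr
        have := Real.add_one_le_exp κ
        linarith
      _ = Real.exp (-κ) := by
        rw [← Real.exp_add]; congr 1; rw [hκ]; ring
  have hYm' : ∀ l : ℝ, ∀ c, Measurable (fun x => l * (Y c x - EY c) - lam * η / 4) :=
    fun l c => (((hYm c).sub_const _).const_mul _).sub_const _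
  have p1 := prob_exists_mem_net hκp (by norm_num) hb₁ hN3'
    (f := fun c x => lam * (Y c x - EY c) - lam * η / 4) (hYm' lam)
    (fun c hc => (hexp lam (abs_of_pos hlamp) c hc).1)
    (fun c hc => (hexp lam (abs_of_pos hlamp) c hc).2)
  have p2 := prob_exists_mem_net hκp (by norm_num) hb₁ hN3'
    (f := fun c x => -lam * (Y c x - EY c) - lam * η / 4) (hYm' (-lam))
    (fun c hc => (hexp (-lam) (by rw [abs_neg, abs_of_pos hlamp]) c hc).1)
    (fun c hc => (hexp (-lam) (by rw [abs_neg, abs_of_pos hlamp]) c hc).2)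
  have p3 := prob_exists_mem_net (by norm_num) (by norm_num) hb₂ hN3'
    (f := fun c x => intensity x c / 4 - 1)
    (fun c => ((measurable_intensity_left c).div_const _).sub_const _)
    (fun c hc => (integral_exp_intensity_sub_one (hN1 c hc)).1)
    (fun c hc => (integral_exp_intensity_sub_one (hN1 c hc)).2)
  have p4 := prob_batch_mean_ge hb.law hb.indep hb.card_pos (f := fun x => G x ^ 2)
    (hGm.pow_const 2) hG4i hG2b hG4b zero_lt_one
  -- `B1` and `B2` are deviations of the truncated means on the net, `B3` an empirical intensity of
  -- at least `4` on the net, and `B4` a large empirical mean of `G²`. Only `B4` is bounded by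
  -- Chebyshev, and it concerns fixed vectors, so no union bound over the net is taken there.
  set B1 := {ω | ∃ c ∈ N, 0 ≤ ∑ j ∈ I, (lam * (Y c (a j ω) - EY c) - lam * η / 4)}
  set B2 := {ω | ∃ c ∈ N, 0 ≤ ∑ j ∈ I, (-lam * (Y c (a j ω) - EY c) - lam * η / 4)}
  set B3 := {ω | ∃ c ∈ N, 0 ≤ ∑ j ∈ I, (intensity (a j ω) c / 4 - 1)}
  set B4 := {ω | c6 + 1 ≤ (∑ j ∈ I, G (a j ω) ^ 2) / I.card}
  have hsub : {ω | ∃ d : Signal n, (supp d).card ≤ 2 * s ∧ η * ‖d‖ <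
        |(∑ j ∈ I, cross (a j ω) u v * cross (a j ω) w d) / I.card - crossMean u v w d|}
      ⊆ ((B1 ∪ B2) ∪ B3) ∪ B4 := by
    intro ω hω
    by_contra hcon
    simp only [Set.mem_union, not_or] at hcon
    obtain ⟨⟨⟨n1, n2⟩, n3⟩, n4⟩ := hcon
    obtain ⟨d, hd, hlt⟩ := hω
    simp only [B1, B2, B3, B4, Set.mem_ofPred_eq, not_exists, not_and, not_le] at n1 n2 n3 n4
    set F : Signal n → ℝ := fun d =>
      (∑ j ∈ I, cross (a j ω) u v * cross (a j ω) w d) / I.card - crossMean u v w d with hF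
    have hFadd : ∀ x y, F (x + y) = F x + F y := by
      intro x y
      simp only [hF, cross_add_right, mul_add, Finset.sum_add_distrib, crossMean_add_right]
      ring
    have hFsmul : ∀ (c : ℝ) x, F (c • x) = c * F x := by
      intro c x
      have : ∀ j, cross (a j ω) u v * cross (a j ω) w (c • x)
          = c * (cross (a j ω) u v * cross (a j ω) w x) := fun j => by
        rw [cross_smul_right]; ring
      simp only [hF, this, ← Finset.mul_sum, crossMean_smul_right]
      ring
    obtain ⟨B, hB0, hB⟩ := exists_bound_of_linear hFadd hFsmul
    -- The budget is `η/4` for the truncated fluctuation, `η/8` for the empirical remainder and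
    -- `η/8` for the truncation bias; leaving the net doubles the sum to `η`.
    have hnet : ∀ c ∈ N, |F c| ≤ η / 2 := by
      intro c hc
      have m1 := n1 c hc
      have m2 := n2 c hc
      have m3 := n3 c hc
      rw [Finset.sum_sub_distrib, ← Finset.mul_sum, Finset.sum_sub_distrib] at m1 m2
      rw [Finset.sum_sub_distrib, ← Finset.sum_div] at m3
      simp only [Finset.sum_const, nsmul_eq_mul] at m1 m2 m3
      have hA : |(∑ j ∈ I, Y c (a j ω)) / I.card - EY c| ≤ η / 4 := by
        have e : (∑ j ∈ I, Y c (a j ω)) / I.card - EY c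
            = (∑ j ∈ I, Y c (a j ω) - I.card * EY c) / I.card := by field_simp
        rw [e, abs_div, abs_of_pos hM, div_le_iff₀ hM]
        apply abs_le.2
        constructor
        · have : lam * (-(η / 4 * I.card)) < lam * (∑ j ∈ I, Y c (a j ω) - I.card * EY c) := by
            linarith
          exact (lt_of_mul_lt_mul_left this hlamp.le).le
        · have : lam * (∑ j ∈ I, Y c (a j ω) - I.card * EY c) < lam * (η / 4 * I.card) := by
            linarith
          exact (lt_of_mul_lt_mul_left this hlamp.le).le
      have hBd : |(∑ j ∈ I, (cross (a j ω) u v * cross (a j ω) w c - Y c (a j ω))) / I.card|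
          ≤ η / 8 := by
        rw [abs_div, abs_of_pos hM]
        calc _ ≤ (∑ j ∈ I, 1 / (2 * L) * (G (a j ω) ^ 2 + intensity (a j ω) c))
                / (I.card : ℝ) := by
              gcongr
              exact (Finset.abs_sum_le_sum_abs _ _).trans
                (Finset.sum_le_sum fun j _ => hZle c (a j ω))
          _ = 1 / (2 * L) * ((∑ j ∈ I, G (a j ω) ^ 2) / I.card
              + (∑ j ∈ I, intensity (a j ω) c) / I.card) := by
              rw [← Finset.mul_sum, Finset.sum_add_distrib]; ring
          _ ≤ 1 / (2 * L) * ((c6 + 1) + 4) := by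
              gcongr
              rw [div_le_iff₀ hM]; linarith
          _ ≤ 1 / (2 * L) * (c6 + 20) :=
              mul_le_mul_of_nonneg_left (by linarith) (by positivity)
          _ = (c6 + 20) / (2 * L) := by ring
          _ = η / 8 := hLη
      have e : F c = ((∑ j ∈ I, Y c (a j ω)) / I.card - EY c)
          + (∑ j ∈ I, (cross (a j ω) u v * cross (a j ω) w c - Y c (a j ω))) / I.card
          - (crossMean u v w c - EY c) := by
        simp only [hF]
        rw [Finset.sum_sub_distrib]
        ring
      rw [e]
      have t1 := abs_sub ((∑ j ∈ I, Y c (a j ω)) / I.card - EY c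
        + (∑ j ∈ I, (cross (a j ω) u v * cross (a j ω) w c - Y c (a j ω))) / I.card)
        (crossMean u v w c - EY c)
      have t2 := abs_add_le ((∑ j ∈ I, Y c (a j ω)) / I.card - EY c)
        ((∑ j ∈ I, (cross (a j ω) u v * cross (a j ω) w c - Y c (a j ω))) / I.card)
      have := hmean c hc
      linarith
    have := seminorm_le_of_net hN2 (q := fun d => |F d|) (t := η / 2)
      (fun x y => by simp only [hFadd]; exact abs_add_le _ _)
      (fun c x => by simp only [hFsmul, abs_mul])
      hB hB0 (by positivity) hnet hd
    have h2 : 2 * (η / 2) * ‖d‖ = η * ‖d‖ := by ring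
    rw [h2] at this
    exact absurd hlt (not_lt.2 this)
  calc _ ≤ P.real (((B1 ∪ B2) ∪ B3) ∪ B4) := measureReal_mono hsub
    _ ≤ P.real B1 + P.real B2 + P.real B3 + P.real B4 := by
      have h1 := measureReal_union_le (μ := P) ((B1 ∪ B2) ∪ B3) B4
      have h2 := measureReal_union_le (μ := P) (B1 ∪ B2) B3
      have h3 := measureReal_union_le (μ := P) B1 B2
      linarith
    _ ≤ 2 / κ / I.card + 2 / κ / I.card + 2 / (1 / 4) / I.card + c12 / (I.card * 1 ^ 2) := by
      gcongr
    _ = (2 / κ + 2 / κ + 2 / (1 / 4) + c12) / I.card := by ring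
    _ ≤ (2 * C₁ + C₂ + c12) / I.card := by
      gcongr
      linarith

set_option maxHeartbeats 1000000 in
/-- A uniform lower bound for the empirical quadratic form on sparse vectors, in a unit
direction. -/
lemma prob_cross_sq_small_unit :
    ∃ C : ℝ, 0 < C ∧ ∀ {Ω : Type uΩ} [MeasurableSpace Ω] {P : Measure Ω} {n m s : ℕ}
      {a : Fin m → Ω → Sensing n} {I : Finset (Fin m)}, IsBatch P s a I C →
      ∀ w : Signal n, ‖w‖ = 1 →
      P.real {ω | ∃ h : Signal n, (supp h).card ≤ 2 * s ∧
        (∑ j ∈ I, cross (a j ω) w h ^ 2) / I.card < 1 / 64 * ‖h‖ ^ 2} ≤ C / I.card := by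
  set c3 := momentConst 3 with hc3
  set c4 := momentConst 4 with hc4
  have hc3p : 0 < c3 := momentConst_pos 3
  have hc3_one : 1 ≤ c3 := by simp only [hc3, momentConst]; norm_num [Nat.factorial]
  have hc4p : 0 < c4 := momentConst_pos 4
  -- Truncating where the intensity of `w` exceeds `D` costs at most `c3 / D = 1/4` of a mean that
  -- is at least `1/2`.
  set D := 4 * c3 with hD
  have hDp : 0 < D := by positivity
  have hD1 : 1 ≤ D := by linarith
  -- The net must be fine enough for the approximation error `16 D δ²` to be at most `1/64`.
  set δ := 1 / (32 * D) with hδ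
  have hδp : 0 < δ := by positivity
  set A := 1 + 2 / δ with hA
  have hA1 : 1 ≤ A := by
    have : 0 < 2 / δ := by positivity
    linarith
  have hlogA : 0 ≤ Real.log A := Real.log_nonneg hA1
  -- Makes the second-order term `lam² c4` equal to `lam / 16`. The exponent is then `lam (1/16 -
  -- 1/4 + 1/16) = -lam / 8`.
  set lam := 1 / (16 * c4) with hlam
  have hlamp : 0 < lam := by positivity
  have hlam2 : lam ^ 2 * c4 = lam / 16 := by rw [hlam]; field_simp
  set κ := lam / 8 with hκ
  have hκp : 0 < κ := by positivity
  have hlog5 : 0 ≤ Real.log 5 := Real.log_nonneg (by norm_num)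
  set C₁ := 2 * (6 + 4 * Real.log A) / κ + 2 / κ with hC₁
  set C₂ := 2 * (6 + 4 * Real.log 5) / (1 / 4) + 2 / (1 / 4) with hC₂
  have hC₁p : 0 < C₁ := by positivity
  have hC₂p : 0 < C₂ := by positivity
  have hC₁κ : 2 / κ ≤ C₁ := by
    have : 0 ≤ 2 * (6 + 4 * Real.log A) / κ := by positivity
    linarith
  have hC₂κ : 2 / (1 / 4) ≤ C₂ := by
    have : 0 ≤ 2 * (6 + 4 * Real.log 5) / (1 / 4) := by positivity
    linarith
  refine ⟨C₁ + C₂, by positivity, ?_⟩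
  intro Ω _ P n m s a I hb w hw
  have hprob := hb.prob
  have hM : (0 : ℝ) < I.card := by exact_mod_cast hb.card_pos
  have hb₁ : IsBatch P s a I C₁ := hb.mono hC₁p (by linarith)
  have hb₂ : IsBatch P s a I C₂ := hb.mono hC₂p (by linarith)
  obtain ⟨N, hN1, hN2, hN3⟩ := exists_sparse_net hb.two_mul_le (δ := 1 / 2) (by norm_num)
  have hN3' : (N.card : ℝ) ≤ n.choose (2 * s) * 5 ^ (2 * s) := by
    refine hN3.trans (le_of_eq ?_); norm_num
  obtain ⟨N', hN1', hN2', hN3''⟩ := exists_sparse_net hb.two_mul_le hδp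
  set X : Signal n → Sensing n → ℝ := fun c x =>
    if intensity x w ≤ D then cross x w c else 0 with hX
  have hXm : ∀ c, Measurable (X c) := fun c =>
    Measurable.ite (measurableSet_le (measurable_intensity_left w) measurable_const)
      (measurable_cross_left w c) measurable_const
  have hX_sq_le : ∀ c x, X c x ^ 2 ≤ cross x w c ^ 2 := by
    intro c x
    simp only [hX]
    split_ifs
    · exact le_rfl
    · rw [zero_pow two_ne_zero]; positivity
  have hXD : ∀ c x, X c x ^ 2 ≤ D * intensity x c := by
    intro c x
    have hI0 := intensity_nonneg x c
    simp only [hX]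
    split_ifs with h
    · exact (cross_sq_le x w c).trans (by gcongr)
    · rw [zero_pow two_ne_zero]; positivity
  -- The truncation depends on `w` only, so the truncated form is still linear in the direction.
  have hXsub : ∀ c h x, X c x ^ 2 ≤ 2 * X h x ^ 2 + 2 * X (h - c) x ^ 2 := by
    intro c h x
    have e : X (h - c) x = X h x - X c x := by
      simp only [hX]; split_ifs
      · exact cross_sub_right _ _ _ _
      · simp
    rw [e]
    nlinarith [sq_nonneg (2 * X h x - X c x)]
  have htail : ∀ c x, cross x w c ^ 2 - X c x ^ 2
      ≤ 1 / D * (intensity x w ^ 2 * intensity x c ^ 1 * intensity x w ^ 0) := by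
    intro c x
    have hI0 := intensity_nonneg x c
    have hI1 := intensity_nonneg x w
    simp only [hX]
    split_ifs with h
    · rw [sub_self]; positivity
    · push Not at h
      rw [zero_pow two_ne_zero, sub_zero, pow_zero, mul_one, pow_one]
      refine (cross_sq_le x w c).trans ?_
      rw [one_div, inv_mul_eq_div, le_div_iff₀ hDp]
      nlinarith [mul_nonneg hI1 hI0]
  have hmean : ∀ c ∈ N', Integrable (fun x => X c x ^ 2) (stdComplexGaussian n) ∧
      1 / 4 ≤ ∫ x, X c x ^ 2 ∂(stdComplexGaussian n) := by
    intro c hc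
    obtain ⟨i1, j1⟩ := integral_cross_mul_cross w c w c
    simp only [← sq] at i1 j1
    have hXi : Integrable (fun x => X c x ^ 2) (stdComplexGaussian n) := by
      refine i1.mono' ((hXm c).pow_const 2).aestronglyMeasurable (ae_of_all _ fun x => ?_)
      rw [Real.norm_of_nonneg (sq_nonneg _)]
      exact hX_sq_le c x
    obtain ⟨i2, j2⟩ := integral_prod_intensity_le hw (hN1' c hc) hw 2 1 0
    refine ⟨hXi, ?_⟩
    have h1 := integral_mono (i1.sub hXi) (i2.const_mul (1 / D)) (htail c)
    rw [integral_sub' i1 hXi, integral_const_mul, j1] at h1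
    have h2 : 1 / 2 ≤ crossMean w c w c := by
      simp only [crossMean, real_inner_self_eq_norm_sq, hw, hN1' c hc]
      rw [real_inner_comm w c]
      nlinarith [mul_self_nonneg (inner ℝ w c : ℝ)]
    have h3 : 1 / D * ∫ x, intensity x w ^ 2 * intensity x c ^ 1 * intensity x w ^ 0
        ∂(stdComplexGaussian n) ≤ 1 / D * c3 := by
      gcongr
      exact j2
    have h4 : 1 / D * c3 = 1 / 4 := by rw [hD]; field_simp
    linarith
  have hfm : ∀ c, Measurable (fun x => lam * (1 / 16 - X c x ^ 2)) := fun c =>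
    ((((hXm c).pow_const 2).const_sub _).const_mul _)
  have hexp : ∀ c ∈ N',
      Integrable (fun x => Real.exp (lam * (1 / 16 - X c x ^ 2))) (stdComplexGaussian n) ∧
      ∫ x, Real.exp (lam * (1 / 16 - X c x ^ 2)) ∂(stdComplexGaussian n) ≤ Real.exp (-κ) := by
    intro c hc
    obtain ⟨i1, j1⟩ := hmean c hc
    obtain ⟨i2, j2⟩ := integral_prod_intensity_le hw (hN1' c hc) hw 2 2 0
    have hint : Integrable (fun x => Real.exp (lam * (1 / 16 - X c x ^ 2)))
        (stdComplexGaussian n) := by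
      refine (integrable_const (Real.exp (lam * (1 / 16)))).mono'
        (hfm c).exp.aestronglyMeasurable (ae_of_all _ fun x => ?_)
      rw [Real.norm_of_nonneg (Real.exp_pos _).le]
      apply Real.exp_le_exp.2
      have := mul_nonneg hlamp.le (sq_nonneg (X c x))
      linarith
    refine ⟨hint, ?_⟩
    -- A lower tail of a nonnegative variable: `exp (-t) ≤ 1 - t + t²` requires only a second
    -- moment.
    have hpt : ∀ x, Real.exp (lam * (1 / 16 - X c x ^ 2)) ≤ Real.exp (lam / 16) *
        ((1 - lam * X c x ^ 2)
          + lam ^ 2 * (intensity x w ^ 2 * intensity x c ^ 2 * intensity x w ^ 0)) := by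
      intro x
      have e : lam * (1 / 16 - X c x ^ 2) = lam / 16 + -(lam * X c x ^ 2) := by ring
      rw [e, Real.exp_add]
      gcongr
      refine (exp_neg_le (by positivity)).trans ?_
      have h1 : (X c x ^ 2) ^ 2 ≤ (intensity x w * intensity x c) ^ 2 := by
        gcongr
        exact (hX_sq_le c x).trans (cross_sq_le _ _ _)
      rw [pow_zero, mul_one, ← mul_pow, mul_pow lam]
      have := mul_le_mul_of_nonneg_left h1 (sq_nonneg lam)
      linarith
    have hdom := ((integrable_integral_add
      (integrable_integral_sub ⟨integrable_const (μ := stdComplexGaussian n) (1 : ℝ), rfl⟩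
        ⟨i1.const_mul lam, rfl⟩) ⟨i2.const_mul (lam ^ 2), rfl⟩))
    refine (integral_mono hint (hdom.1.const_mul _) hpt).trans ?_
    rw [integral_const_mul, hdom.2, integral_const_mul, integral_const_mul]
    simp only [integral_const, probReal_univ, smul_eq_mul, mul_one]
    have h2 : 1 - lam * ∫ x, X c x ^ 2 ∂(stdComplexGaussian n)
        + lam ^ 2 * ∫ x, intensity x w ^ 2 * intensity x c ^ 2 * intensity x w ^ 0
          ∂(stdComplexGaussian n) ≤ 1 - lam * (1 / 4) + lam ^ 2 * c4 := by
      have h3 := mul_le_mul_of_nonneg_left j1 hlamp.le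
      have h4 := mul_le_mul_of_nonneg_left j2 (sq_nonneg lam)
      have h5 : lam ^ 2 * (5 * (4 ^ (2 + 2 + 0) * ((2 + 2 + 0).factorial : ℝ)))
        = lam ^ 2 * c4 := rfl
      linarith
    rw [hlam2] at h2
    calc _ ≤ Real.exp (lam / 16) * (1 - lam * (1 / 4) + lam / 16) := by gcongr
      _ ≤ Real.exp (lam / 16) * Real.exp (-(lam * (3 / 16))) := by
        gcongr
        have := Real.add_one_le_exp (-(lam * (3 / 16)))
        linarith
      _ = Real.exp (-κ) := by
        rw [← Real.exp_add]; congr 1; rw [hκ]; ring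
  have p1 := prob_exists_mem_net hκp hA1 hb₁ hN3''
    (f := fun c x => lam * (1 / 16 - X c x ^ 2)) hfm
    (fun c hc => (hexp c hc).1) (fun c hc => (hexp c hc).2)
  have p3 := prob_exists_mem_net (by norm_num) (by norm_num) hb₂ hN3'
    (f := fun c x => intensity x c / 4 - 1)
    (fun c => ((measurable_intensity_left c).div_const _).sub_const _)
    (fun c hc => (integral_exp_intensity_sub_one (hN1 c hc)).1)
    (fun c hc => (integral_exp_intensity_sub_one (hN1 c hc)).2)
  set B1 := {ω | ∃ c ∈ N', 0 ≤ ∑ j ∈ I, lam * (1 / 16 - X c (a j ω) ^ 2)}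
  set B3 := {ω | ∃ c ∈ N, 0 ≤ ∑ j ∈ I, (intensity (a j ω) c / 4 - 1)}
  have hsub : {ω | ∃ h : Signal n, (supp h).card ≤ 2 * s ∧
        (∑ j ∈ I, cross (a j ω) w h ^ 2) / I.card < 1 / 64 * ‖h‖ ^ 2} ⊆ B1 ∪ B3 := by
    intro ω hω
    by_contra hcon
    simp only [Set.mem_union, not_or] at hcon
    obtain ⟨n1, n3⟩ := hcon
    obtain ⟨h, hh, hlt⟩ := hω
    simp only [B1, B3, Set.mem_ofPred_eq, not_exists, not_and, not_le] at n1 n3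
    have hrip : ∀ d : Signal n, (supp d).card ≤ 2 * s →
        ∑ j ∈ I, intensity (a j ω) d ≤ 16 * I.card * ‖d‖ ^ 2 := by
      intro d hd
      refine sum_intensity_le_of_net hN2 (a := fun j => a j ω) (fun c hc => ?_) hd
      have m3 := n3 c hc
      rw [Finset.sum_sub_distrib, ← Finset.sum_div] at m3
      simp only [Finset.sum_const, nsmul_eq_mul] at m3
      linarith
    -- From `1/16 ≤ 2 S + 2 * (1/64)`, with `1/16` at the net point and `1/64` for the approximation
    -- error, follows `S ≥ 1/64`.
    have hunit : ∀ x : Signal n, ‖x‖ = 1 → (supp x).card ≤ 2 * s →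
        1 / 64 * (I.card : ℝ) ≤ ∑ j ∈ I, cross (a j ω) w x ^ 2 := by
      intro x hx hxs
      obtain ⟨c, hc, hxc, hs⟩ := hN2' x hx hxs
      have m1 := n1 c hc
      rw [← Finset.mul_sum, Finset.sum_sub_distrib] at m1
      simp only [Finset.sum_const, nsmul_eq_mul] at m1
      have m1' : (I.card : ℝ) * (1 / 16) ≤ ∑ j ∈ I, X c (a j ω) ^ 2 := by
        have : lam * (I.card * (1 / 16) - ∑ j ∈ I, X c (a j ω) ^ 2) < lam * 0 := by
          rwa [mul_zero]
        have := lt_of_mul_lt_mul_left this hlamp.le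
        linarith
      have h1 : ∑ j ∈ I, X c (a j ω) ^ 2
          ≤ 2 * ∑ j ∈ I, X x (a j ω) ^ 2 + 2 * ∑ j ∈ I, X (x - c) (a j ω) ^ 2 := by
        rw [Finset.mul_sum, Finset.mul_sum, ← Finset.sum_add_distrib]
        exact Finset.sum_le_sum fun j _ => hXsub c x (a j ω)
      have h2 : ∑ j ∈ I, X x (a j ω) ^ 2 ≤ ∑ j ∈ I, cross (a j ω) w x ^ 2 :=
        Finset.sum_le_sum fun j _ => hX_sq_le x (a j ω)
      have h3 : ∑ j ∈ I, X (x - c) (a j ω) ^ 2 ≤ 1 / 64 * (I.card : ℝ) := by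
        calc ∑ j ∈ I, X (x - c) (a j ω) ^ 2 ≤ ∑ j ∈ I, D * intensity (a j ω) (x - c) :=
              Finset.sum_le_sum fun j _ => hXD _ _
          _ = D * ∑ j ∈ I, intensity (a j ω) (x - c) := by rw [Finset.mul_sum]
          _ ≤ D * (16 * I.card * ‖x - c‖ ^ 2) := by
            gcongr
            exact hrip _ hs
          _ ≤ D * (16 * I.card * δ ^ 2) := by gcongr
          _ = 1 / 64 * I.card * (1 / D) := by rw [hδ]; field_simp; norm_num
          _ ≤ 1 / 64 * I.card * 1 := by
            have : 1 / D ≤ 1 := by rw [div_le_one hDp]; exact hD1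
            gcongr
          _ = _ := mul_one _
      linarith
    rcases eq_or_ne h 0 with rfl | hh0
    · have : 0 ≤ (∑ j ∈ I, cross (a j ω) w 0 ^ 2) / I.card := by positivity
      rw [norm_zero] at hlt
      linarith
    have hnorm : 0 < ‖h‖ := norm_pos_iff.2 hh0
    have hx1 : ‖‖h‖⁻¹ • h‖ = 1 := by
      rw [norm_smul, norm_inv, norm_norm, inv_mul_cancel₀ hnorm.ne']
    have hu := hunit _ hx1 ((Finset.card_le_card (supp_smul_subset _ _)).trans hh)
    simp only [cross_smul_right, mul_pow] at hu
    rw [← Finset.mul_sum, inv_pow, inv_mul_eq_div, le_div_iff₀ (by positivity)] at hu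
    rw [div_lt_iff₀ hM] at hlt
    linarith
  calc _ ≤ P.real (B1 ∪ B3) := measureReal_mono hsub
    _ ≤ P.real B1 + P.real B3 := measureReal_union_le _ _
    _ ≤ 2 / κ / I.card + 2 / (1 / 4) / I.card := add_le_add p1 p3
    _ = (2 / κ + 2 / (1 / 4)) / I.card := by ring
    _ ≤ _ := by gcongr

lemma exists_unit_smul {n : ℕ} {u : Signal n} (hu : u ≠ 0) :
    ∃ u' : Signal n, ‖u'‖ = 1 ∧ u = ‖u‖ • u' := by
  have h : ‖u‖ ≠ 0 := norm_ne_zero_iff.2 hu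
  refine ⟨‖u‖⁻¹ • u, ?_, ?_⟩
  · rw [norm_smul, norm_inv, norm_norm, inv_mul_cancel₀ h]
  · rw [smul_smul, mul_inv_cancel₀ h, one_smul]

/-- Homogeneity of degree two in `w`; for `w = 0` the strict inequality makes the event empty. -/
lemma prob_cross_sq_small :
    ∃ C : ℝ, 0 < C ∧ ∀ {Ω : Type uΩ} [MeasurableSpace Ω] {P : Measure Ω} {n m s : ℕ}
      {a : Fin m → Ω → Sensing n} {I : Finset (Fin m)}, IsBatch P s a I C →
      ∀ w : Signal n,
      P.real {ω | ∃ h : Signal n, (supp h).card ≤ 2 * s ∧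
        (∑ j ∈ I, cross (a j ω) w h ^ 2) / I.card < 1 / 64 * ‖w‖ ^ 2 * ‖h‖ ^ 2}
        ≤ C / I.card := by
  obtain ⟨C, hC, H⟩ := prob_cross_sq_small_unit.{uΩ}
  refine ⟨C, hC, ?_⟩
  intro Ω _ P n m s a I hb w
  have := hb.prob
  rcases eq_or_ne w 0 with rfl | hw
  · have : {ω | ∃ h : Signal n, (supp h).card ≤ 2 * s ∧
        (∑ j ∈ I, cross (a j ω) 0 h ^ 2) / I.card < 1 / 64 * ‖(0 : Signal n)‖ ^ 2 * ‖h‖ ^ 2}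
        = ∅ := by
      ext ω
      simp [cross]
    rw [this, measureReal_empty]
    positivity
  · obtain ⟨w', hw', e⟩ := exists_unit_smul hw
    refine le_trans (measureReal_mono ?_) (H hb w' hw')
    rintro ω ⟨h, hh, hlt⟩
    refine ⟨h, hh, ?_⟩
    have hn : 0 < ‖w‖ ^ 2 := by have := norm_pos_iff.2 hw; positivity
    have hc : ∀ j, cross (a j ω) w h ^ 2 = ‖w‖ ^ 2 * cross (a j ω) w' h ^ 2 := by
      intro j
      conv_lhs => rw [e, cross_smul_left, mul_pow]
    simp only [hc] at hlt
    rw [← Finset.mul_sum, mul_div_assoc] at hlt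
    refine lt_of_mul_lt_mul_left (a := ‖w‖ ^ 2) ?_ hn.le
    linarith

lemma prob_cross_deviation {η : ℝ} (hη : 0 < η) (hη1 : η ≤ 1) :
    ∃ C : ℝ, 0 < C ∧ ∀ {Ω : Type uΩ} [MeasurableSpace Ω] {P : Measure Ω} {n m s : ℕ}
      {a : Fin m → Ω → Sensing n} {I : Finset (Fin m)}, IsBatch P s a I C →
      ∀ u v w : Signal n,
      P.real {ω | ∃ d : Signal n, (supp d).card ≤ 2 * s ∧ η * (‖u‖ * ‖v‖ * ‖w‖) * ‖d‖ <
        |(∑ j ∈ I, cross (a j ω) u v * cross (a j ω) w d) / I.card - crossMean u v w d|}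
        ≤ C / I.card := by
  obtain ⟨C, hC, H⟩ := prob_cross_deviation_unit.{uΩ} hη hη1
  refine ⟨C, hC, ?_⟩
  intro Ω _ P n m s a I hb u v w
  have := hb.prob
  by_cases h0 : u = 0 ∨ v = 0 ∨ w = 0
  · have : {ω | ∃ d : Signal n, (supp d).card ≤ 2 * s ∧ η * (‖u‖ * ‖v‖ * ‖w‖) * ‖d‖ <
        |(∑ j ∈ I, cross (a j ω) u v * cross (a j ω) w d) / I.card - crossMean u v w d|} = ∅ := by
      ext ω
      rcases h0 with rfl | rfl | rfl <;> simp [cross, crossMean]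
    rw [this, measureReal_empty]
    positivity
  push Not at h0
  obtain ⟨hu, hv, hw⟩ := h0
  obtain ⟨u', hu', eu⟩ := exists_unit_smul hu
  obtain ⟨v', hv', ev⟩ := exists_unit_smul hv
  obtain ⟨w', hw', ew⟩ := exists_unit_smul hw
  refine le_trans (measureReal_mono ?_) (H hb u' v' w' hu' hv' hw')
  rintro ω ⟨d, hd, hlt⟩
  refine ⟨d, hd, ?_⟩
  have hR : 0 < ‖u‖ * ‖v‖ * ‖w‖ := by
    have := norm_pos_iff.2 hu
    have := norm_pos_iff.2 hv
    have := norm_pos_iff.2 hw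
    positivity
  set R := ‖u‖ * ‖v‖ * ‖w‖ with hRdef
  have hc : ∀ j, cross (a j ω) u v * cross (a j ω) w d
      = R * (cross (a j ω) u' v' * cross (a j ω) w' d) := by
    intro j
    conv_lhs => rw [eu, ev, ew, cross_smul_left, cross_smul_right, cross_smul_left]
    rw [hRdef]; ring
  have hm : crossMean u v w d = R * crossMean u' v' w' d := by
    conv_lhs => rw [eu, ev, ew]
    simp only [crossMean, real_inner_smul_left, real_inner_smul_right]
    rw [hRdef]; ring
  simp only [hc, hm] at hlt
  rw [← Finset.mul_sum, mul_div_assoc, ← mul_sub, abs_mul, abs_of_pos hR] at hlt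
  refine lt_of_mul_lt_mul_left (a := R) ?_ hR.le
  linarith

/-- Both vectors are fixed, so Chebyshev with the moment of total degree four suffices, without a
net. The Gauss–Newton right-hand side is needed only at such vectors. -/
lemma prob_intensity_mul_large :
    ∃ C : ℝ, 0 < C ∧ ∀ {Ω : Type uΩ} [MeasurableSpace Ω] {P : Measure Ω} {n m s : ℕ}
      {a : Fin m → Ω → Sensing n} {I : Finset (Fin m)}, IsBatch P s a I C →
      ∀ u v : Signal n,
      P.real {ω | C * (‖u‖ ^ 2 * ‖v‖ ^ 2)
        < (∑ j ∈ I, intensity (a j ω) u * intensity (a j ω) v) / I.card} ≤ C / I.card := by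
  have h4 := momentConst_pos 4
  have h2 := momentConst_pos 2
  refine ⟨momentConst 2 + 1 + momentConst 4, by positivity, ?_⟩
  intro Ω _ P n m s a I hb u v
  have := hb.prob
  have hM : (0 : ℝ) < I.card := by exact_mod_cast hb.card_pos
  set C := momentConst 2 + 1 + momentConst 4 with hC
  have hCp : 0 < C := by positivity
  by_cases h0 : u = 0 ∨ v = 0
  · have : {ω | C * (‖u‖ ^ 2 * ‖v‖ ^ 2)
        < (∑ j ∈ I, intensity (a j ω) u * intensity (a j ω) v) / I.card} = ∅ := by
      ext ω
      rcases h0 with rfl | rfl <;> simp [cross, intensity_eq_cross]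
    rw [this, measureReal_empty]
    positivity
  push Not at h0
  obtain ⟨u', hu', eu⟩ := exists_unit_smul h0.1
  obtain ⟨v', hv', ev⟩ := exists_unit_smul h0.2
  have m1 := integral_prod_intensity_le hu' hv' hv' 1 1 0
  have m2 := integral_prod_intensity_le hu' hv' hv' 2 2 0
  simp only [pow_one, pow_zero, mul_one] at m1
  simp only [pow_zero, mul_one, ← mul_pow] at m2
  have p := prob_batch_mean_ge hb.law hb.indep hb.card_pos
    (f := fun x => intensity x u' * intensity x v') (A := momentConst 2) (B := momentConst 4)
    ((measurable_intensity_left u').mul (measurable_intensity_left v')) m2.1 m1.2 m2.2 zero_lt_one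
  refine le_trans (measureReal_mono ?_) (p.trans ?_)
  · intro ω hω
    change momentConst 2 + 1 ≤ _
    replace hω : C * (‖u‖ ^ 2 * ‖v‖ ^ 2)
      < (∑ j ∈ I, intensity (a j ω) u * intensity (a j ω) v) / I.card := hω
    have hR : 0 < ‖u‖ ^ 2 * ‖v‖ ^ 2 := by
      have := norm_pos_iff.2 h0.1
      have := norm_pos_iff.2 h0.2
      positivity
    have hc : ∀ j, intensity (a j ω) u * intensity (a j ω) v
        = (‖u‖ ^ 2 * ‖v‖ ^ 2) * (intensity (a j ω) u' * intensity (a j ω) v') := by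
      intro j
      conv_lhs => rw [eu, ev, intensity_smul, intensity_smul]
      ring
    rw [Finset.sum_congr rfl fun j _ => hc j, ← Finset.mul_sum, mul_div_assoc, mul_comm C] at hω
    have := lt_of_mul_lt_mul_left hω hR.le
    linarith
  · rw [one_pow, mul_one]
    exact div_le_div_of_nonneg_right (by linarith) hM.le

/-! ### The thresholded gradient step on the event of concentration. -/

/-- The restriction of a vector to an index set. -/
noncomputable def restrictTo {n : ℕ} (S : Finset (Fin n)) (z : Signal n) : Signal n :=
  WithLp.toLp 2 (fun i => if i ∈ S then z i else 0)

lemma restrictTo_apply {n : ℕ} (S : Finset (Fin n)) (z : Signal n) (i : Fin n) :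
    restrictTo S z i = if i ∈ S then z i else 0 := rfl

lemma restrictTo_add_compl {n : ℕ} (S : Finset (Fin n)) (z : Signal n) :
    restrictTo S z + restrictTo Sᶜ z = z := by
  ext i
  by_cases h : i ∈ S <;> simp [restrictTo_apply, h]

lemma restrictTo_neg {n : ℕ} (S : Finset (Fin n)) (z : Signal n) :
    restrictTo S (-z) = -restrictTo S z := by
  ext i
  by_cases h : i ∈ S <;> simp [restrictTo_apply, h]

lemma supp_restrictTo_subset {n : ℕ} (S : Finset (Fin n)) (z : Signal n) :
    supp (restrictTo S z) ⊆ S :=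
  supp_subset_iff.2 fun i hi => by simp [restrictTo_apply, hi]

lemma norm_restrictTo_sq {n : ℕ} (S : Finset (Fin n)) (z : Signal n) :
    ‖restrictTo S z‖ ^ 2 = ∑ i ∈ S, z i ^ 2 := by
  rw [EuclideanSpace.norm_sq_eq]
  simp [restrictTo_apply, apply_ite, Finset.sum_ite_mem]

lemma norm_restrictTo_le {n : ℕ} (S : Finset (Fin n)) (z : Signal n) :
    ‖restrictTo S z‖ ≤ ‖z‖ := by
  refine abs_le_of_sq_le_sq' ?_ (norm_nonneg _) |>.2
  rw [norm_restrictTo_sq, EuclideanSpace.norm_sq_eq]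
  simp only [Real.norm_eq_abs, sq_abs]
  exact Finset.sum_le_univ_sum_of_nonneg fun i => sq_nonneg _

lemma inner_restrictTo_self {n : ℕ} (S : Finset (Fin n)) (z : Signal n) :
    inner ℝ z (restrictTo S z) = ‖restrictTo S z‖ ^ 2 := by
  rw [norm_restrictTo_sq, PiLp.inner_apply]
  simp [restrictTo_apply, Finset.sum_ite_mem, sq]

lemma supp_neg {n : ℕ} (x : Signal n) : supp (-x) = supp x := by
  simp [supp]

lemma mem_supp {n : ℕ} {x : Signal n} {i : Fin n} : i ∈ supp x ↔ x i ≠ 0 := by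
  simp [supp]

/-- The restriction of `b` is itself an admissible test direction. -/
lemma norm_restrictTo_le_of_inner {n : ℕ} {S : Finset (Fin n)} {b : Signal n} {t : ℝ}
    (h : ∀ d : Signal n, supp d ⊆ S → inner ℝ b d ≤ t * ‖d‖) (ht : 0 ≤ t) :
    ‖restrictTo S b‖ ≤ t := by
  have h1 := h _ (supp_restrictTo_subset S b)
  rw [inner_restrictTo_self] at h1
  rcases eq_or_lt_of_le (norm_nonneg (restrictTo S b)) with h0 | h0
  · rw [← h0]; exact ht
  · rw [sq] at h1
    exact le_of_mul_le_mul_right h1 h0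

/-- The sampled gradient in direction `d` is close to its mean, for all sparse `d`. -/
def GradientConcentrated {n m : ℕ} (s : ℕ) (η : ℝ) (A : Fin m → Sensing n) (I : Finset (Fin m))
    (x z : Signal n) : Prop :=
  ∀ d : Signal n, (supp d).card ≤ 2 * s →
    |(∑ j ∈ I, cross (A j) (z - x) (z + x) * cross (A j) z d) / I.card
      - crossMean (z - x) (z + x) z d| ≤ η * (‖z - x‖ * ‖z + x‖ * ‖z‖) * ‖d‖

lemma crossMean_swap {n : ℕ} (u v w d : Signal n) : crossMean u v w d = crossMean v u w d := by
  simp only [crossMean, real_inner_comm u v]; ring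

/-- Replacing `x` by `-x` exchanges the two symmetric slots `z - x` and `z + x`; one event therefore
serves both signs. -/
lemma GradientConcentrated.neg {n m s : ℕ} {η : ℝ} {A : Fin m → Sensing n}
    {I : Finset (Fin m)} {x z : Signal n} (h : GradientConcentrated s η A I x z) :
    GradientConcentrated s η A I (-x) z := by
  intro d hd
  have := h d hd
  rw [sub_neg_eq_add, ← sub_eq_add_neg, crossMean_swap, mul_comm ‖z + x‖]
  simp only [cross_comm _ (z + x) (z - x)]
  exact this

lemma intensity_neg {n : ℕ} (a : Sensing n) (u : Signal n) : intensity a (-u) = intensity a u := by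
  have := intensity_smul a (-1) u
  simpa using this

/-- A difference of squares. It turns the gradient tested against `d` into the product form for
which concentration is proved, with `z - x`, `z + x` and `z` fixed. -/
lemma intensity_sub_intensity {n : ℕ} (a : Sensing n) (z x : Signal n) :
    intensity a z - intensity a x = cross a (z - x) (z + x) := by
  simp only [intensity_eq_cross, cross_sub_left, cross_add_right, cross_comm a x z]; ring

/-- The gradient of the intensity loss. -/
noncomputable def lossGradient {n m : ℕ} (a : Fin m → Sensing n) (y : Fin m → ℝ)
    (I : Finset (Fin m)) (z : Signal n) : Signal n :=
  (1 / (I.card : ℝ)) • ∑ j ∈ I, (intensity (a j) z - y j) •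
    ((inner ℝ (rePart (a j)) z : ℝ) • rePart (a j) + (inner ℝ (imPart (a j)) z : ℝ) • imPart (a j))

lemma gradient_loss {n m : ℕ} (a : Fin m → Sensing n) (y : Fin m → ℝ) (I : Finset (Fin m))
    (z : Signal n) : gradient (loss a y I) z = lossGradient a y I z := by
  apply HasGradientAt.gradient
  rw [hasGradientAt_iff_hasFDerivAt]
  have h1 : ∀ r : Signal n, HasFDerivAt (fun z : Signal n => (inner ℝ r z : ℝ)) (innerSL ℝ r) z :=
    fun r => (innerSL ℝ r).hasFDerivAt
  have h2 : ∀ j, HasFDerivAt (fun z : Signal n => intensity (a j) z - y j)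
      ((2 * (inner ℝ (rePart (a j)) z : ℝ)) • innerSL ℝ (rePart (a j))
        + (2 * (inner ℝ (imPart (a j)) z : ℝ)) • innerSL ℝ (imPart (a j))) z := by
    intro j
    have e : (fun z : Signal n => intensity (a j) z - y j)
        = fun z => ((inner ℝ (rePart (a j)) z : ℝ) ^ 2 + (inner ℝ (imPart (a j)) z : ℝ) ^ 2)
          - y j := by
      ext z; rw [intensity_eq_cross, cross]; ring
    rw [e]
    refine ((((h1 _).pow 2).fun_add ((h1 _).pow 2)).sub_const _).congr_fderiv ?_
    ext d
    simp
  have h3 := (HasFDerivAt.fun_sum (u := I) fun j _ => (h2 j).pow 2).const_mul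
    (1 / (4 * (I.card : ℝ)))
  refine h3.congr_fderiv ?_
  ext d
  simp only [lossGradient, InnerProductSpace.toDual_apply_apply, inner_smul_left, sum_inner,
    inner_add_left, smul_apply, sum_apply, add_apply, innerSL_apply_apply, smul_eq_mul]
  simp only [Finset.mul_sum]
  refine Finset.sum_congr rfl fun j _ => ?_
  simp
  ring

lemma inner_lossGradient {n m : ℕ} (a : Fin m → Sensing n) (I : Finset (Fin m))
    (x z d : Signal n) :
    inner ℝ (lossGradient a (fun j => intensity (a j) x) I z) d
      = (∑ j ∈ I, cross (a j) (z - x) (z + x) * cross (a j) z d) / I.card := by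
  simp only [lossGradient, inner_smul_left, sum_inner, inner_add_left, intensity_sub_intensity]
  simp [cross, div_eq_inv_mul]

lemma sum_le_sum_of_card_le {ι : Type*} {f : ι → ℝ} (hf : ∀ i, 0 ≤ f i) {S T : Finset ι}
    (hcard : S.card ≤ T.card) (h : ∀ i ∈ S, ∀ j ∈ T, f i ≤ f j) :
    ∑ i ∈ S, f i ≤ ∑ j ∈ T, f j := by
  rcases S.eq_empty_or_nonempty with rfl | hS
  · rw [Finset.sum_empty]; exact Finset.sum_nonneg fun i _ => hf i
  obtain ⟨k, hk, hmax⟩ := S.exists_max_image f hS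
  calc ∑ i ∈ S, f i ≤ ∑ _i ∈ S, f k := Finset.sum_le_sum hmax
    _ = S.card * f k := by simp
    _ ≤ T.card * f k := by
      have := hf k
      gcongr
    _ = ∑ _j ∈ T, f k := by simp
    _ ≤ _ := Finset.sum_le_sum fun j hj => h k hk j hj

/-- Hard thresholding of a vector close to a multiple of a sparse vector. -/
lemma hardThresholding_error {n s : ℕ} {H : Signal n → Signal n} (hH : IsHardThresholding s H)
    {x v : Signal n} (hx : (supp x).card ≤ s) {c t : ℝ} (hc : 1 / 2 ≤ c) (ht : 0 ≤ t)
    (hv : ∀ d : Signal n, (supp d).card ≤ 2 * s → inner ℝ (v - c • x) d ≤ t * ‖d‖) :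
    ‖restrictTo (supp (H v))ᶜ x‖ ≤ 3 * t ∧ ‖H v - x‖ ≤ 4 * t + |1 - c| * ‖x‖ ∧
      (supp (H v)).card ≤ s := by
  classical
  obtain ⟨S₀, hS₀, hmax, hHv⟩ := hH.spec v
  set b := v - c • x with hb
  set T := supp x with hT
  set S := supp (H v) with hS
  have hbi : ∀ i, b i = v i - c * x i := fun i => by simp [hb]
  have hSS₀ : S ⊆ S₀ := by
    intro i hi
    by_contra hn
    rw [hS, mem_supp, hHv i, if_neg hn] at hi
    exact hi rfl
  have hU : (T ∪ S₀).card ≤ 2 * s := (Finset.card_union_le _ _).trans (by omega)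
  have hbU : ‖restrictTo (T ∪ S₀) b‖ ≤ t :=
    norm_restrictTo_le_of_inner (fun d hd => hv d ((Finset.card_le_card hd).trans hU)) ht
  have hbU2 : ∑ i ∈ T ∪ S₀, b i ^ 2 ≤ t ^ 2 := by
    rw [← norm_restrictTo_sq]; gcongr
  have hx0 : ∀ i, i ∉ T → x i = 0 := fun i hi => by
    by_contra hne
    exact hi (mem_supp.2 hne)
  -- Exchange argument: entries of `v` rejected on the support of `x` are dominated by entries kept
  -- off it, and there `v` coincides with the perturbation `b`. The factor `c ≥ 1/2` is removed at
  -- the cost of `4`.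
  have hmiss : ∑ i ∈ Sᶜ, x i ^ 2 ≤ 8 * t ^ 2 := by
    have h1 : ∑ i ∈ Sᶜ, x i ^ 2 = ∑ i ∈ T \ S, x i ^ 2 := by
      symm
      refine Finset.sum_subset (fun i hi => ?_) (fun i hi hni => ?_)
      · rw [Finset.mem_compl]; exact (Finset.mem_sdiff.1 hi).2
      · have : i ∉ T := fun hiT => hni (Finset.mem_sdiff.2 ⟨hiT, Finset.mem_compl.1 hi⟩)
        rw [hx0 i this]; simp
    -- The selected set `S₀` may be strictly larger than the support of `H v`, but only by indices
    -- at which `v` vanishes.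
    have h2 : ∑ i ∈ T \ S, v i ^ 2 ≤ ∑ i ∈ T \ S₀, v i ^ 2 := by
      rw [← Finset.sum_filter_add_sum_filter_not (T \ S) (· ∈ S₀)]
      have h0 : ∑ i ∈ (T \ S).filter (· ∈ S₀), v i ^ 2 = 0 := by
        refine Finset.sum_eq_zero fun i hi => ?_
        simp only [Finset.mem_filter, Finset.mem_sdiff] at hi
        have h3 : H v i = 0 := by
          by_contra hne
          exact hi.1.2 (mem_supp.2 hne)
        rw [hHv i, if_pos hi.2] at h3
        rw [h3]; simp
      rw [h0, zero_add]
      refine Finset.sum_le_sum_of_subset_of_nonneg ?_ (fun i _ _ => sq_nonneg _)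
      intro i hi
      simp only [Finset.mem_filter, Finset.mem_sdiff] at hi ⊢
      exact ⟨hi.1.1, hi.2⟩
    have h3 : ∑ i ∈ T \ S₀, v i ^ 2 ≤ ∑ i ∈ S₀ \ T, v i ^ 2 := by
      refine sum_le_sum_of_card_le (fun i => sq_nonneg _) ?_ ?_
      · exact Finset.card_sdiff_le_card_sdiff_iff.2 (by omega)
      · intro i hi j hj
        rw [← sq_abs (v i), ← sq_abs (v j)]
        have := hmax j (Finset.mem_sdiff.1 hj).1 i (Finset.mem_sdiff.1 hi).2
        gcongr
    have h4 : ∑ i ∈ S₀ \ T, v i ^ 2 = ∑ i ∈ S₀ \ T, b i ^ 2 := by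
      refine Finset.sum_congr rfl fun i hi => ?_
      rw [hbi, hx0 i (Finset.mem_sdiff.1 hi).2]; simp
    have h5 : ∑ i ∈ T \ S, b i ^ 2 ≤ ∑ i ∈ T, b i ^ 2 :=
      Finset.sum_le_sum_of_subset_of_nonneg Finset.sdiff_subset (fun i _ _ => sq_nonneg _)
    have h6 : ∑ i ∈ T, b i ^ 2 + ∑ i ∈ S₀ \ T, b i ^ 2 = ∑ i ∈ T ∪ S₀, b i ^ 2 := by
      rw [← Finset.sum_union Finset.disjoint_sdiff, Finset.union_sdiff_self_eq_union]
    have h7 : ∀ i, 1 / 4 * x i ^ 2 ≤ 2 * v i ^ 2 + 2 * b i ^ 2 := by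
      intro i
      have : 1 / 4 * x i ^ 2 ≤ (c * x i) ^ 2 := by
        rw [mul_pow]
        have : 1 / 4 ≤ c ^ 2 := by nlinarith
        gcongr
      rw [hbi]
      nlinarith [sq_nonneg (2 * v i - c * x i)]
    have h8 : 1 / 4 * ∑ i ∈ T \ S, x i ^ 2
        ≤ 2 * ∑ i ∈ T \ S, v i ^ 2 + 2 * ∑ i ∈ T \ S, b i ^ 2 := by
      rw [Finset.mul_sum, Finset.mul_sum, Finset.mul_sum, ← Finset.sum_add_distrib]
      exact Finset.sum_le_sum fun i _ => h7 i
    rw [h1]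
    linarith
  have hr : ‖restrictTo Sᶜ x‖ ≤ 3 * t := by
    refine abs_le_of_sq_le_sq' ?_ (by positivity) |>.2
    rw [norm_restrictTo_sq]
    nlinarith [sq_nonneg t]
  refine ⟨hr, ?_, (Finset.card_le_card hSS₀).trans hS₀.le⟩
  have e : H v - x = restrictTo S₀ b + (c - 1) • restrictTo S₀ x - restrictTo S₀ᶜ x := by
    ext i
    by_cases hi : i ∈ S₀
    · simp [restrictTo_apply, hi, hHv i, hbi]; ring
    · simp [restrictTo_apply, hi, hHv i]
  have n1 : ‖restrictTo S₀ b‖ ≤ t := by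
    refine abs_le_of_sq_le_sq' ?_ ht |>.2
    rw [norm_restrictTo_sq]
    exact (Finset.sum_le_sum_of_subset_of_nonneg Finset.subset_union_right
      (fun i _ _ => sq_nonneg _)).trans hbU2
  have n2 : ‖restrictTo S₀ᶜ x‖ ≤ ‖restrictTo Sᶜ x‖ := by
    refine abs_le_of_sq_le_sq' ?_ (norm_nonneg _) |>.2
    rw [norm_restrictTo_sq, norm_restrictTo_sq]
    exact Finset.sum_le_sum_of_subset_of_nonneg (Finset.compl_subset_compl.2 hSS₀)
      (fun i _ _ => sq_nonneg _)
  have n3 : ‖(c - 1) • restrictTo S₀ x‖ ≤ |1 - c| * ‖x‖ := by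
    rw [norm_smul, Real.norm_eq_abs, abs_sub_comm]
    gcongr
    exact norm_restrictTo_le _ _
  rw [e]
  have t1 := norm_sub_le (restrictTo S₀ b + (c - 1) • restrictTo S₀ x) (restrictTo S₀ᶜ x)
  have t2 := norm_add_le (restrictTo S₀ b) ((c - 1) • restrictTo S₀ x)
  linarith

/-- One gradient step followed by hard thresholding, on the event of concentration. -/
lemma gradient_step_error {n m s : ℕ} {H : Signal n → Signal n} (hH : IsHardThresholding s H)
    {A : Fin m → Sensing n} {I : Finset (Fin m)} {x z : Signal n} (hx0 : x ≠ 0)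
    (hx : (supp x).card ≤ s) {η μ : ℝ} (hη : 0 < η) (hη1 : η ≤ 1 / 100)
    (hμ1 : 1 - η ≤ μ * ‖x‖ ^ 2) (hμ2 : μ * ‖x‖ ^ 2 ≤ 1 + η) (hz : ‖z - x‖ ≤ η * ‖x‖)
    (hG : GradientConcentrated s η A I x z) :
    let u := H (z - μ • lossGradient A (fun j => intensity (A j) x) I z)
    ‖restrictTo (supp u)ᶜ x‖ ≤ 30 * η * ‖z - x‖ ∧ ‖u - x‖ ≤ 6 * ‖z - x‖ ∧
      (supp u).card ≤ s := by
  intro u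
  set e := z - x with he
  set R := ‖x‖ with hR
  have hRp : 0 < R := norm_pos_iff.2 hx0
  set E := ‖e‖ with hE
  have hE0 : 0 ≤ E := norm_nonneg _
  have hER : E ≤ R / 100 := by nlinarith
  have hze : z = x + e := by rw [he]; abel
  have hpe : z + x = (2 : ℝ) • x + e := by rw [he, two_smul]; abel
  have hμ0 : 0 < μ := by
    by_contra hcon
    have : μ * R ^ 2 ≤ 0 := mul_nonpos_of_nonpos_of_nonneg (not_lt.1 hcon) (by positivity)
    linarith
  have hzn : ‖z‖ ≤ 101 / 100 * R := by
    rw [hze]; refine (norm_add_le _ _).trans ?_; linarith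
  have hpn : ‖z + x‖ ≤ 201 / 100 * R := by
    rw [hpe]; refine (norm_add_le _ _).trans ?_
    rw [norm_smul, Real.norm_eq_abs, abs_of_pos (by norm_num : (0 : ℝ) < 2)]; linarith
  -- The component of the mean gradient along `x` is of first order in `e` and is not cancelled by
  -- the step. It only rescales `x` to `(1 - μ κ) x`, which leaves its support unchanged; so it
  -- enters `‖u - x‖` but not the missed part of `x`.
  set κ : ℝ := inner ℝ e (z + x) + inner ℝ e z with hκ
  have hκle : |κ| ≤ 302 / 100 * R * E := by
    have h1 := abs_real_inner_le_norm e (z + x)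
    have h2 := abs_real_inner_le_norm e z
    have h3 : ‖e‖ * ‖z + x‖ ≤ E * (201 / 100 * R) := by gcongr
    have h4 : ‖e‖ * ‖z‖ ≤ E * (101 / 100 * R) := by gcongr
    have h5 := abs_add_le (inner ℝ e (z + x)) (inner ℝ e z)
    rw [← hκ] at h5
    linarith
  have hμκ : |μ * κ| * R ≤ 31 / 10 * E := by
    rw [abs_mul, abs_of_pos hμ0]
    have h1 : μ * |κ| * R ≤ μ * (302 / 100 * R * E) * R := by gcongr
    have h2 : μ * (302 / 100 * R * E) * R = 302 / 100 * E * (μ * R ^ 2) := by ring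
    have h3 : 302 / 100 * E * (μ * R ^ 2) ≤ 302 / 100 * E * (101 / 100) := by
      gcongr
      linarith
    linarith
  have hc : 1 / 2 ≤ 1 - μ * κ := by
    have h1 : |μ * κ| * R ≤ 1 / 2 * R := by linarith
    have h2 := le_of_mul_le_mul_right h1 hRp
    have := le_abs_self (μ * κ)
    linarith
  have hv : ∀ d : Signal n, (supp d).card ≤ 2 * s →
      inner ℝ (z - μ • lossGradient A (fun j => intensity (A j) x) I z - (1 - μ * κ) • x) d
        ≤ 10 * η * E * ‖d‖ := by
    intro d hd
    have hgc := hG d hd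
    rw [← inner_lossGradient, ← he] at hgc
    set g := (inner ℝ (lossGradient A (fun j => intensity (A j) x) I z) d : ℝ) with hg
    set D := ‖d‖ with hD
    have hD0 : 0 ≤ D := norm_nonneg _
    have hed : |(inner ℝ e d : ℝ)| ≤ E * D := abs_real_inner_le_norm e d
    -- Besides the part `R² e` cancelled by the step and the multiple of `x`, the rest carries an
    -- extra factor `O(R E)` with `E ≤ η R`.
    have hmean : crossMean e (z + x) z d = R ^ 2 * inner ℝ e d + κ * inner ℝ x d
        + inner ℝ e d * (4 * inner ℝ x e + 2 * E ^ 2) := by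
      simp only [crossMean, hκ, hR, hE, ← real_inner_self_eq_norm_sq]
      rw [hpe, hze]
      simp only [inner_add_left, inner_add_right, real_inner_smul_left, real_inner_smul_right]
      rw [real_inner_comm x e]
      ring
    have hxe : |(4 * inner ℝ x e + 2 * E ^ 2 : ℝ)| ≤ 5 * R * E := by
      have h1 := abs_real_inner_le_norm x e
      have h2 := abs_add_le (4 * inner ℝ x e : ℝ) (2 * E ^ 2)
      rw [abs_mul, abs_of_pos (by norm_num : (0 : ℝ) < 4),
        abs_of_nonneg (by positivity : 0 ≤ 2 * E ^ 2)] at h2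
      nlinarith
    have e1 : inner ℝ (z - μ • lossGradient A (fun j => intensity (A j) x) I z
        - (1 - μ * κ) • x) d = (1 - μ * R ^ 2) * inner ℝ e d
          - μ * (inner ℝ e d * (4 * inner ℝ x e + 2 * E ^ 2))
          - μ * (g - crossMean e (z + x) z d) := by
      rw [inner_sub_left, inner_sub_left, real_inner_smul_left, real_inner_smul_left, ← hg, hmean,
        show (inner ℝ z d : ℝ) = inner ℝ x d + inner ℝ e d by rw [hze, inner_add_left]]
      ring
    rw [e1]
    have b1 : (1 - μ * R ^ 2) * inner ℝ e d ≤ η * (E * D) := by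
      refine (le_abs_self _).trans ?_
      rw [abs_mul]
      have : |1 - μ * R ^ 2| ≤ η := abs_le.2 ⟨by linarith, by linarith⟩
      gcongr
    have b2 : -(μ * (inner ℝ e d * (4 * inner ℝ x e + 2 * E ^ 2))) ≤ 51 / 10 * η * (E * D) := by
      refine (neg_le_abs _).trans ?_
      rw [abs_mul, abs_mul, abs_of_pos hμ0]
      calc μ * (|(inner ℝ e d : ℝ)| * |(4 * inner ℝ x e + 2 * E ^ 2 : ℝ)|)
          ≤ μ * ((E * D) * (5 * R * E)) := by gcongr
        _ ≤ μ * ((E * D) * (5 * R * (η * R))) := by gcongr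
        _ = (μ * R ^ 2) * (5 * η * (E * D)) := by ring
        _ ≤ (101 / 100) * (5 * η * (E * D)) := by
          gcongr
          linarith
        _ ≤ _ := by
          have : 0 ≤ η * (E * D) := by positivity
          linarith
    have b3 : -(μ * (g - crossMean e (z + x) z d)) ≤ 3 * η * (E * D) := by
      refine (neg_le_abs _).trans ?_
      rw [abs_mul, abs_of_pos hμ0]
      calc μ * |g - crossMean e (z + x) z d|
          ≤ μ * (η * (E * (201 / 100 * R) * (101 / 100 * R)) * D) := by
            gcongr
            exact hgc.trans (by gcongr)
        _ = (μ * R ^ 2) * (η * (201 / 100 * (101 / 100)) * (E * D)) := by ring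
        _ ≤ (101 / 100) * (η * (201 / 100 * (101 / 100)) * (E * D)) := by
          gcongr
          linarith
        _ ≤ _ := by
          have : 0 ≤ η * (E * D) := by positivity
          linarith
    have : 0 ≤ η * (E * D) := by positivity
    linarith
  obtain ⟨h1, h2, h3⟩ := hardThresholding_error hH hx hc (by positivity) hv
  refine ⟨?_, ?_, h3⟩
  · linarith
  · rw [sub_sub_cancel] at h2
    refine h2.trans ?_
    have : η * E ≤ 1 / 100 * E := by gcongr
    linarith

/-! ### Normal equations and error of a Gauss–Newton step. -/

lemma sum_mul_eq_zero_of_min {ι : Type*} {I : Finset ι} {α β : ι → ℝ}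
    (h : ∀ t : ℝ, ∑ j ∈ I, α j ^ 2 ≤ ∑ j ∈ I, (α j + t * β j) ^ 2) :
    ∑ j ∈ I, β j * α j = 0 := by
  set p := ∑ j ∈ I, β j * α j with hp
  set q := ∑ j ∈ I, β j ^ 2 with hq
  have hq0 : 0 ≤ q := Finset.sum_nonneg fun j _ => sq_nonneg _
  have key : ∀ t : ℝ, 0 ≤ 2 * t * p + t ^ 2 * q := by
    intro t
    have e : ∑ j ∈ I, (α j + t * β j) ^ 2 = ∑ j ∈ I, α j ^ 2 + (2 * t * p + t ^ 2 * q) := by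
      rw [hp, hq, Finset.mul_sum, Finset.mul_sum, ← Finset.sum_add_distrib,
        ← Finset.sum_add_distrib]
      exact Finset.sum_congr rfl fun j _ => by ring
    have := h t
    linarith
  -- The optimal step would be `-p / q`; the denominator `1 + q` also covers `q = 0`.
  have h1 := key (-p / (1 + q))
  have e : 2 * (-p / (1 + q)) * p + (-p / (1 + q)) ^ 2 * q
      = -(p ^ 2 * ((2 + q) / (1 + q) ^ 2)) := by field_simp; ring
  rw [e] at h1
  have h2 : 0 < (2 + q) / (1 + q) ^ 2 := by positivity
  have h3 : p ^ 2 ≤ 0 := by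
    by_contra hcon
    have := mul_pos (not_le.1 hcon) h2
    linarith
  exact pow_eq_zero_iff two_ne_zero |>.1 (le_antisymm h3 (sq_nonneg p))

lemma inner_jacobianRow {n m : ℕ} (a : Fin m → Sensing n) (I : Finset (Fin m))
    (w d : Signal n) (j : Fin m) :
    inner ℝ (jacobianRow a I w j) d = 1 / √(I.card : ℝ) * cross (a j) w d := by
  simp [jacobianRow, inner_smul_left, inner_add_left, cross, mul_add]

/-- The normal equations of a Gauss–Newton step. -/
lemma IsGaussNewtonStep.normal_eq {n m : ℕ} {a : Fin m → Sensing n} {I : Finset (Fin m)}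
    (hI : 0 < I.card) {S : Finset (Fin n)} {x w z : Signal n}
    (h : IsGaussNewtonStep a (fun j => intensity (a j) x) I S w z) {d : Signal n}
    (hd : supp d ⊆ S) :
    ∑ j ∈ I, cross (a j) w d *
      (cross (a j) w (z - w) + 1 / 2 * (intensity (a j) w - intensity (a j) x)) = 0 := by
  have hM : (0 : ℝ) < I.card := by exact_mod_cast hI
  set r := 1 / √(I.card : ℝ) with hr
  have hrp : 0 < r := by positivity
  set y := fun j => intensity (a j) x with hy
  have hmin : ∀ t : ℝ, ∑ j ∈ I, ((inner ℝ (jacobianRow a I w j) (z - w) : ℝ)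
      + residual a y I w j) ^ 2 ≤ ∑ j ∈ I, (((inner ℝ (jacobianRow a I w j) (z - w) : ℝ)
      + residual a y I w j) + t * inner ℝ (jacobianRow a I w j) d) ^ 2 := by
    intro t
    have hmem : z + t • d ∈ {z : Signal n | supp z ⊆ S} :=
      supp_subset_iff.2 (Submodule.add_mem _ (supp_subset_iff.1 h.1)
        (Submodule.smul_mem _ _ (supp_subset_iff.1 hd)))
    have h1 := h.2 hmem
    simp only [gaussNewtonObjective, Set.mem_ofPred_eq] at h1
    refine h1.trans (le_of_eq (Finset.sum_congr rfl fun j _ => ?_))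
    rw [show z + t • d - w = (z - w) + t • d by abel, inner_add_right, real_inner_smul_right]
    ring
  have h2 := sum_mul_eq_zero_of_min hmin
  have e : ∀ j, inner ℝ (jacobianRow a I w j) d * ((inner ℝ (jacobianRow a I w j) (z - w) : ℝ)
      + residual a y I w j) = r ^ 2 * (cross (a j) w d *
      (cross (a j) w (z - w) + 1 / 2 * (intensity (a j) w - intensity (a j) x))) := by
    intro j
    rw [inner_jacobianRow, inner_jacobianRow, residual, ← hr,
      show 1 / (2 * √(I.card : ℝ)) = 1 / 2 * r by rw [hr]; ring]
    ring
  rw [Finset.sum_congr rfl fun j _ => e j, ← Finset.mul_sum] at h2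
  exact (mul_eq_zero.1 h2).resolve_left (by positivity)

/-- The properties of a batch that control a Gauss–Newton step at `w`. -/
structure GaussNewtonRegular {n m : ℕ} (s : ℕ) (C : ℝ) (A : Fin m → Sensing n)
    (I : Finset (Fin m)) (x w : Signal n) : Prop where
  lower : ∀ h : Signal n, (supp h).card ≤ 2 * s →
    1 / 64 * ‖w‖ ^ 2 * ‖h‖ ^ 2 ≤ (∑ j ∈ I, cross (A j) w h ^ 2) / I.card
  missing : (∑ j ∈ I, intensity (A j) w * intensity (A j) (restrictTo (supp w)ᶜ x)) / I.card
    ≤ C * (‖w‖ ^ 2 * ‖restrictTo (supp w)ᶜ x‖ ^ 2)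
  remainder_sub : (∑ j ∈ I, intensity (A j) (x - w) * intensity (A j) (x - w)) / I.card
    ≤ C * (‖x - w‖ ^ 2 * ‖x - w‖ ^ 2)
  remainder_add : (∑ j ∈ I, intensity (A j) (x + w) * intensity (A j) (x + w)) / I.card
    ≤ C * (‖x + w‖ ^ 2 * ‖x + w‖ ^ 2)

lemma intensity_add {n : ℕ} (a : Sensing n) (u v : Signal n) :
    intensity a (u + v) = intensity a u + 2 * cross a u v + intensity a v := by
  simp only [intensity_eq_cross, cross_add_left, cross_add_right, cross_comm a v u]; ring

set_option maxHeartbeats 800000 in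
-- The measurements are exactly quadratic, so linearizing at `w` makes an error of exactly half of
-- `intensity a (x' - w)` at the truth. The minimizer is compared with the restriction of `x'` to
-- the support of `w`: their difference `q` is an admissible test direction, so the normal equations
-- bound `∑ cross(w, q)²` by the contributions of the missed part of `x'` and of the linearization
-- error. The data-dependent `q` appears only on the left, where the lower bound is uniform; the
-- right-hand side involves only vectors determined by `w` and `x`.
lemma gaussNewton_error {n m s : ℕ} {C : ℝ} (hC : 0 ≤ C) {A : Fin m → Sensing n}
    {I : Finset (Fin m)} (hI : 0 < I.card) {x x' w z : Signal n} (hx0 : x ≠ 0)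
    (hx' : x' = x ∨ x' = -x) (hw : (supp w).card ≤ s) (hG : GaussNewtonRegular s C A I x w)
    (hwx : ‖w - x'‖ ≤ ‖x‖ / 2)
    (h : IsGaussNewtonStep A (fun j => intensity (A j) x) I (supp w) w z) :
    ‖z - x'‖ ≤ (2 + 128 * C) * ‖restrictTo (supp w)ᶜ x‖
      + (1 + 128 * C) * (‖w - x'‖ ^ 2 / ‖x‖) := by
  have hM : (0 : ℝ) < I.card := by exact_mod_cast hI
  set S := supp w with hS
  set R := ‖x‖ with hR
  have hRp : 0 < R := norm_pos_iff.2 hx0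
  have hnx' : ‖x'‖ = R := by rcases hx' with rfl | rfl <;> simp [hR]
  have hIx' : ∀ a : Sensing n, intensity a x' = intensity a x := by
    intro a; rcases hx' with rfl | rfl <;> simp [intensity_neg]
  set r := restrictTo Sᶜ x' with hr
  have hrn : ‖r‖ = ‖restrictTo Sᶜ x‖ := by
    rcases hx' with rfl | rfl
    · rfl
    · rw [hr, restrictTo_neg, norm_neg]
  have hIr : ∀ a : Sensing n, intensity a r = intensity a (restrictTo Sᶜ x) := by
    intro a
    rcases hx' with rfl | rfl
    · rfl
    · rw [hr, restrictTo_neg, intensity_neg]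
  have hrem : (∑ j ∈ I, intensity (A j) (x' - w) * intensity (A j) (x' - w)) / I.card
      ≤ C * (‖w - x'‖ ^ 2 * ‖w - x'‖ ^ 2) := by
    rcases hx' with rfl | rfl
    · rw [norm_sub_rev]; exact hG.remainder_sub
    · have := hG.remainder_add
      rw [show w - -x = x + w by abel]
      simp_rw [show -x - w = -(x + w) by abel, intensity_neg]
      exact this
  set q := z - restrictTo S x' with hq
  have hqS : supp q ⊆ S := supp_subset_iff.2 (Submodule.sub_mem _ (supp_subset_iff.1 h.1)
    (supp_subset_iff.1 (supp_restrictTo_subset S x')))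
  have hzx : z - x' = q - r := by
    have := restrictTo_add_compl S x'
    rw [hq, hr, ← sub_eq_zero]
    nth_rewrite 1 [← this]
    abel
  set f := ‖w - x'‖ with hf
  have hnorm := h.normal_eq hI hqS
  have e : ∀ j, cross (A j) w (z - w) + 1 / 2 * (intensity (A j) w - intensity (A j) x)
      = cross (A j) w q - (cross (A j) w r + 1 / 2 * intensity (A j) (x' - w)) := by
    intro j
    have h1 : intensity (A j) x = intensity (A j) w + 2 * cross (A j) w (x' - w)
        + intensity (A j) (x' - w) := by
      rw [← intensity_add, add_sub_cancel, hIx']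
    have h2 : z - w = q - r + (x' - w) := by rw [← hzx]; abel
    rw [h1, h2, cross_add_right, cross_sub_right]
    ring
  have h3 : ∑ j ∈ I, cross (A j) w q ^ 2
      ≤ 2 * ∑ j ∈ I, intensity (A j) w * intensity (A j) (restrictTo Sᶜ x)
        + 1 / 2 * ∑ j ∈ I, intensity (A j) (x' - w) * intensity (A j) (x' - w) := by
    -- With `P = cross w q` and `Q` the error term, `P² ≤ 2 P (P - Q) + Q²`. The first term sums to
    -- zero by the normal equations, and `Q²` is split by `(α + β)² ≤ 2 α² + 2 β²`.
    have h4 : ∀ j, cross (A j) w q ^ 2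
        ≤ 2 * (cross (A j) w q *
          (cross (A j) w (z - w) + 1 / 2 * (intensity (A j) w - intensity (A j) x)))
          + (2 * (intensity (A j) w * intensity (A j) (restrictTo Sᶜ x))
            + 1 / 2 * (intensity (A j) (x' - w) * intensity (A j) (x' - w))) := by
      intro j
      rw [e j]
      have h5 := cross_sq_le (A j) w r
      rw [hIr] at h5
      nlinarith [sq_nonneg (cross (A j) w q - (cross (A j) w r + 1 / 2 * intensity (A j) (x' - w))),
        sq_nonneg (cross (A j) w r - 1 / 2 * intensity (A j) (x' - w))]
    have h6 := Finset.sum_le_sum fun j (_ : j ∈ I) => h4 j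
    rw [Finset.sum_add_distrib, Finset.sum_add_distrib, ← Finset.mul_sum, ← Finset.mul_sum,
      ← Finset.mul_sum, hnorm] at h6
    linarith
  have hlow := hG.lower q ((Finset.card_le_card hqS).trans (by omega))
  have hW : R / 2 ≤ ‖w‖ := by
    have := norm_sub_norm_le x' w
    rw [hnx', norm_sub_rev] at this
    linarith
  have hmiss := hG.missing
  set W := ‖w‖ with hWdef
  have hWp : 0 < W := by linarith
  set ρ := ‖restrictTo Sᶜ x‖ with hρ
  have h7 : 1 / 64 * W ^ 2 * ‖q‖ ^ 2 ≤ 2 * (C * (W ^ 2 * ρ ^ 2)) + 1 / 2 * (C * (f ^ 2 * f ^ 2)) := by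
    calc 1 / 64 * W ^ 2 * ‖q‖ ^ 2 ≤ (∑ j ∈ I, cross (A j) w q ^ 2) / I.card := hlow
      _ ≤ (2 * ∑ j ∈ I, intensity (A j) w * intensity (A j) (restrictTo Sᶜ x)
        + 1 / 2 * ∑ j ∈ I, intensity (A j) (x' - w) * intensity (A j) (x' - w)) / I.card := by
        gcongr
      _ = 2 * ((∑ j ∈ I, intensity (A j) w * intensity (A j) (restrictTo Sᶜ x)) / I.card)
        + 1 / 2 * ((∑ j ∈ I, intensity (A j) (x' - w) * intensity (A j) (x' - w)) / I.card) := by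
        ring
      _ ≤ _ := by gcongr
  have h8 : ‖q‖ ^ 2 ≤ 128 * C * (ρ ^ 2 + (f ^ 2 / R) ^ 2) := by
    have h9 : C * (f ^ 2 * f ^ 2) ≤ 4 * W ^ 2 * (C * (f ^ 2 / R) ^ 2) := by
      have : (f ^ 2 * f ^ 2) = R ^ 2 * (f ^ 2 / R) ^ 2 := by field_simp
      rw [this]
      have : R ^ 2 ≤ 4 * W ^ 2 := by
        have := pow_le_pow_left₀ (by positivity) hW 2
        rw [div_pow] at this
        linarith
      calc C * (R ^ 2 * (f ^ 2 / R) ^ 2) ≤ C * (4 * W ^ 2 * (f ^ 2 / R) ^ 2) := by gcongr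
        _ = _ := by ring
    have h10 : W ^ 2 * ‖q‖ ^ 2 ≤ W ^ 2 * (128 * C * (ρ ^ 2 + (f ^ 2 / R) ^ 2)) := by
      have e1 : W ^ 2 * (128 * C * (ρ ^ 2 + (f ^ 2 / R) ^ 2)) = 128 * (C * (W ^ 2 * ρ ^ 2))
        + 32 * (4 * W ^ 2 * (C * (f ^ 2 / R) ^ 2)) := by ring
      linarith
    exact le_of_mul_le_mul_left h10 (by positivity)
  have hρ0 : 0 ≤ ρ := norm_nonneg _
  have hf0 : 0 ≤ f ^ 2 / R := by positivity
  have h11 : ‖q‖ ≤ (1 + 128 * C) * (ρ + f ^ 2 / R) := by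
    refine abs_le_of_sq_le_sq' ?_ (by positivity) |>.2
    refine h8.trans ?_
    rw [mul_pow]
    have h12 : 128 * C ≤ (1 + 128 * C) ^ 2 := by nlinarith [sq_nonneg (128 * C)]
    have h13 : ρ ^ 2 + (f ^ 2 / R) ^ 2 ≤ (ρ + f ^ 2 / R) ^ 2 := by nlinarith [mul_nonneg hρ0 hf0]
    gcongr
  rw [hzx]
  have := norm_sub_le q r
  rw [hrn] at this
  linarith

/-! ### One full iteration: linear contraction, then quadratic once the support is found. -/

lemma signDist_eq {n : ℕ} (z x : Signal n) :
    ∃ x' : Signal n, (x' = x ∨ x' = -x) ∧ signDist z x = ‖z - x'‖ := by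
  rcases min_choice ‖z - x‖ ‖z + x‖ with h | h
  · exact ⟨x, Or.inl rfl, h⟩
  · exact ⟨-x, Or.inr rfl, by rw [sub_neg_eq_add]; exact h⟩

lemma signDist_le {n : ℕ} {z x x' : Signal n} (hx' : x' = x ∨ x' = -x) :
    signDist z x ≤ ‖z - x'‖ := by
  rcases hx' with rfl | rfl
  · exact min_le_left _ _
  · rw [sub_neg_eq_add]; exact min_le_right _ _

lemma minEntry_pos_and_le {n : ℕ} {x : Signal n} (hx : x ≠ 0) :
    0 < minEntry x ∧ ∀ i, x i ≠ 0 → minEntry x ≤ |x i| := by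
  set E := {r : ℝ | ∃ i, x i ≠ 0 ∧ r = |x i|} with hE
  have hfin : E.Finite := by
    refine (Set.finite_range fun i => |x i|).subset ?_
    rintro r ⟨i, -, rfl⟩
    exact ⟨i, rfl⟩
  have hne : E.Nonempty := by
    by_contra hcon
    apply hx
    ext i
    by_contra hi
    exact hcon ⟨|x i|, i, hi, rfl⟩
  have hmem : minEntry x ∈ E := hne.csInf_mem hfin
  constructor
  · obtain ⟨i, hi, e⟩ := hmem
    rw [e]; exact abs_pos.2 hi
  · intro i hi
    exact csInf_le hfin.bddBelow ⟨i, hi, rfl⟩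

lemma minEntry_le_norm {n : ℕ} {x : Signal n} (hx : x ≠ 0) : minEntry x ≤ ‖x‖ := by
  obtain ⟨i, hi⟩ : ∃ i, x i ≠ 0 := by
    by_contra! hcon
    exact hx (by ext i; simp [hcon i])
  exact ((minEntry_pos_and_le hx).2 i hi).trans (PiLp.norm_apply_le x i)

/-- One missed nonzero entry would already contribute at least the minimal entry to the norm. This
discreteness is what switches the linear regime to the quadratic one. -/
lemma restrictTo_compl_eq_zero {n : ℕ} {x : Signal n} (hx : x ≠ 0) {S : Finset (Fin n)}
    (h : ‖restrictTo Sᶜ x‖ < minEntry x) : restrictTo Sᶜ x = 0 := by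
  by_contra hne
  have : ∃ i, restrictTo Sᶜ x i ≠ 0 := by
    by_contra! hcon
    exact hne (by ext i; simp [hcon i])
  obtain ⟨i, hi⟩ := this
  have hxi : restrictTo Sᶜ x i = x i := by
    rw [restrictTo_apply] at hi ⊢
    by_cases hmem : i ∈ Sᶜ
    · rw [if_pos hmem]
    · rw [if_neg hmem] at hi; exact absurd rfl hi
  have h1 := PiLp.norm_apply_le (restrictTo Sᶜ x) i
  rw [hxi, Real.norm_eq_abs] at h1
  rw [hxi] at hi
  have := (minEntry_pos_and_le hx).2 i hi
  linarith

/-- The radius of the basin of attraction for the moment constant `C`. -/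
noncomputable def basinRadius (C : ℝ) : ℝ := 1 / (200 * (2 + 128 * C))

/-- The error of one full iteration on the good events. -/
lemma iteration_error {n m s : ℕ} {C : ℝ} (hC : 0 ≤ C) {H : Signal n → Signal n}
    (hH : IsHardThresholding s H) {A : Fin m → Sensing n} {I I' : Finset (Fin m)}
    (hI' : 0 < I'.card) {x z w z' : Signal n} (hx0 : x ≠ 0) (hx : (supp x).card ≤ s) {μ : ℝ}
    (hμ1 : 1 - basinRadius C ≤ μ * ‖x‖ ^ 2) (hμ2 : μ * ‖x‖ ^ 2 ≤ 1 + basinRadius C)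
    (hz : signDist z x ≤ basinRadius C * ‖x‖)
    (hG : GradientConcentrated s (basinRadius C) A I x z) {u : Signal n}
    (hu : u = H (z - μ • lossGradient A (fun j => intensity (A j) x) I z))
    (hwu : supp w = supp u) (hwd : signDist w x ≤ signDist u x)
    (hN : GaussNewtonRegular s C A I' x w) :
    w ≠ 0 ∧ (supp w).card ≤ s ∧
    (IsGaussNewtonStep A (fun j => intensity (A j) x) I' (supp w) w z' →
      signDist z' x ≤ 1 / 2 * signDist z x ∧
      (signDist z x ≤ minEntry x →
        signDist z' x ≤ 36 * (1 + 128 * C) / ‖x‖ * signDist z x ^ 2)) := by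
  set η := basinRadius C with hη
  have hηp : 0 < η := by rw [hη, basinRadius]; positivity
  have hηB : η * (2 + 128 * C) = 1 / 200 := by rw [hη, basinRadius]; field_simp
  have hη1 : η ≤ 1 / 400 := by nlinarith
  set R := ‖x‖ with hR
  have hRp : 0 < R := norm_pos_iff.2 hx0
  -- The sign nearest to `z` and the one nearest to `w` may differ. Supports and intensities do not
  -- see the sign, so each half of the iteration uses its own.
  obtain ⟨x₁, hx₁, e₁⟩ := signDist_eq z x
  obtain ⟨x₂, hx₂, e₂⟩ := signDist_eq w x
  have hn₁ : ‖x₁‖ = R := by rcases hx₁ with rfl | rfl <;> simp [hR]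
  have hs₁ : supp x₁ = supp x := by rcases hx₁ with rfl | rfl <;> simp [supp_neg]
  have hx₁0 : x₁ ≠ 0 := by rw [← norm_pos_iff, hn₁]; exact hRp
  have hIx₁ : (fun j => intensity (A j) x₁) = fun j => intensity (A j) x := by
    ext j; rcases hx₁ with rfl | rfl <;> simp [intensity_neg]
  have hG₁ : GradientConcentrated s η A I x₁ z := by
    rcases hx₁ with rfl | rfl
    · exact hG
    · exact hG.neg
  have hstep := gradient_step_error hH hx₁0 (hs₁ ▸ hx) hηp (by linarith) (by rwa [hn₁])
    (by rwa [hn₁]) (by rw [hn₁, ← e₁]; exact hz) hG₁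
  rw [hIx₁, ← hu] at hstep
  simp only at hstep
  obtain ⟨h1, h2, h3⟩ := hstep
  rw [← e₁] at h1 h2
  set E := signDist z x with hE
  have hE0 : 0 ≤ E := by rw [e₁]; exact norm_nonneg _
  have h1' : ‖restrictTo (supp w)ᶜ x‖ ≤ 30 * η * E := by
    rw [hwu]
    rcases hx₁ with rfl | rfl
    · exact h1
    · rwa [restrictTo_neg, norm_neg] at h1
  have hw6 : ‖w - x₂‖ ≤ 6 * E := by
    rw [← e₂]
    exact hwd.trans ((signDist_le hx₁).trans h2)
  have hwR : ‖w - x₂‖ ≤ R / 2 := by nlinarith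
  have hws : (supp w).card ≤ s := by rw [hwu]; exact h3
  have hn₂ : ‖x₂‖ = R := by rcases hx₂ with rfl | rfl <;> simp [hR]
  refine ⟨?_, hws, ?_⟩
  · rintro rfl
    rw [zero_sub, norm_neg, hn₂] at hwR
    linarith
  intro hGN
  have herr := gaussNewton_error hC hI' hx0 hx₂ hws hN hwR hGN
  rw [← hR] at herr
  have hd := signDist_le (z := z') hx₂
  have hsq : ‖w - x₂‖ ^ 2 / R ≤ 36 * E ^ 2 / R := by
    gcongr
    calc ‖w - x₂‖ ^ 2 ≤ (6 * E) ^ 2 := by gcongr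
      _ = 36 * E ^ 2 := by ring
  have h5 : (1 + 128 * C) * (‖w - x₂‖ ^ 2 / R) ≤ 36 * (1 + 128 * C) / R * E ^ 2 := by
    calc (1 + 128 * C) * (‖w - x₂‖ ^ 2 / R) ≤ (1 + 128 * C) * (36 * E ^ 2 / R) := by gcongr
      _ = _ := by ring
  constructor
  -- The radius was chosen so that `η (2 + 128 C) = 1/200`; the missed part and the quadratic part
  -- contribute `30/200` and `36/200`, less than `1/2` together.
  · have h4 : (2 + 128 * C) * ‖restrictTo (supp w)ᶜ x‖ ≤ 30 / 200 * E := by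
      calc (2 + 128 * C) * ‖restrictTo (supp w)ᶜ x‖ ≤ (2 + 128 * C) * (30 * η * E) := by gcongr
        _ = 30 * (η * (2 + 128 * C)) * E := by ring
        _ = _ := by rw [hηB]; ring
    have h6 : 36 * (1 + 128 * C) / R * E ^ 2 ≤ 36 / 200 * E := by
      calc 36 * (1 + 128 * C) / R * E ^ 2 = 36 * (1 + 128 * C) / R * E * E := by ring
        _ ≤ 36 * (1 + 128 * C) / R * (η * R) * E := by gcongr
        _ = 36 * (η * (1 + 128 * C)) * E := by field_simp
        _ ≤ 36 * (η * (2 + 128 * C)) * E := by gcongr; linarith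
        _ = _ := by rw [hηB]; ring
    linarith
  · intro hmin
    have hzero : restrictTo (supp w)ᶜ x = 0 := by
      apply restrictTo_compl_eq_zero hx0
      have := (minEntry_pos_and_le hx0).1
      have h30 : 30 * η * E ≤ 1 / 2 * E := by gcongr; linarith
      linarith
    rw [hzero, norm_zero, mul_zero, zero_add] at herr
    linarith

/-! ### Unique solvability of the Gauss–Newton system and measurability of its solution. -/

lemma Continuous.cross {X : Type*} [TopologicalSpace X] {n : ℕ} {f : X → Sensing n}
    {g h : X → Signal n} (hf : Continuous f) (hg : Continuous g) (hh : Continuous h) :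
    Continuous fun t => cross (f t) (g t) (h t) := by
  unfold GraHTP.cross
  have h1 := continuous_rePart.comp hf
  have h2 := continuous_imPart.comp hf
  exact ((h1.inner hg).mul (h1.inner hh)).add ((h2.inner hg).mul (h2.inner hh))

lemma Continuous.intensity {X : Type*} [TopologicalSpace X] {n : ℕ} {f : X → Sensing n}
    {g : X → Signal n} (hf : Continuous f) (hg : Continuous g) :
    Continuous fun t => intensity (f t) (g t) := by
  simp only [intensity_eq_cross]
  exact Continuous.cross hf hg hg

section GaussNewtonSolution

variable {n m : ℕ}

/-- The coefficient matrix of the normal equations of the Gauss–Newton step at `w`, completed by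
the identity off the support of `w`. -/
noncomputable def normalMatrix (A : Fin m → Sensing n) (I : Finset (Fin m)) (w : Signal n) :
    Matrix (Fin n) (Fin n) ℝ :=
  Matrix.of fun i k => if w i ≠ 0 then ∑ j ∈ I, cross (A j) w (EuclideanSpace.single i 1) *
    cross (A j) w (EuclideanSpace.single k 1) else if i = k then 1 else 0

/-- The right-hand side of the normal equations of the Gauss–Newton step at `w`. -/
noncomputable def normalVector (A : Fin m → Sensing n) (x : Signal n) (I : Finset (Fin m))
    (w : Signal n) : Fin n → ℝ := fun i =>
  if w i ≠ 0 then ∑ j ∈ I, cross (A j) w (EuclideanSpace.single i 1) *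
    (cross (A j) w w - 1 / 2 * (intensity (A j) w - intensity (A j) x)) else 0

/-- The solution of the normal equations of the Gauss–Newton step at `w`. -/
noncomputable def normalSolution (A : Fin m → Sensing n) (x : Signal n) (I : Finset (Fin m))
    (w : Signal n) : Signal n :=
  WithLp.toLp 2 ((normalMatrix A I w)⁻¹.mulVec (normalVector A x I w))

lemma sum_mul_cross_single (a : Sensing n) (w v : Signal n) :
    ∑ k, cross a w (EuclideanSpace.single k 1) * v k = cross a w v := by
  have h : ∀ r : Signal n, ∑ k, (inner ℝ r (EuclideanSpace.single k (1 : ℝ)) : ℝ) * v k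
      = inner ℝ r v := by
    intro r
    rw [PiLp.inner_apply]
    refine Finset.sum_congr rfl fun k _ => ?_
    rw [EuclideanSpace.inner_single_right]
    simp [mul_comm]
  simp only [cross]
  rw [← h (rePart a), ← h (imPart a), Finset.mul_sum, Finset.mul_sum, ← Finset.sum_add_distrib]
  refine Finset.sum_congr rfl fun k _ => ?_
  ring

lemma normalMatrix_mulVec (A : Fin m → Sensing n) (I : Finset (Fin m)) (w v : Signal n)
    (i : Fin n) : (normalMatrix A I w).mulVec v i
      = if w i ≠ 0 then ∑ j ∈ I, cross (A j) w (EuclideanSpace.single i 1) * cross (A j) w v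
        else v i := by
  simp only [Matrix.mulVec, dotProduct, normalMatrix, Matrix.of_apply]
  split_ifs with h
  · simp only [Finset.sum_mul]
    rw [Finset.sum_comm]
    refine Finset.sum_congr rfl fun j _ => ?_
    rw [← sum_mul_cross_single (A j) w v, Finset.mul_sum]
    exact Finset.sum_congr rfl fun k _ => mul_assoc _ _ _
  · simp

/-- The identity rows force a kernel vector to be supported on the support of `w`. Pairing the
remaining rows with that vector gives a vanishing quadratic form, contradicting the lower bound. -/
lemma isUnit_normalMatrix_det {s : ℕ} {A : Fin m → Sensing n} {I : Finset (Fin m)}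
    {w : Signal n} (hw : w ≠ 0) (hs : (supp w).card ≤ s)
    (hlow : ∀ h : Signal n, (supp h).card ≤ 2 * s →
      1 / 64 * ‖w‖ ^ 2 * ‖h‖ ^ 2 ≤ (∑ j ∈ I, cross (A j) w h ^ 2) / I.card) :
    IsUnit (normalMatrix A I w).det := by
  rw [isUnit_iff_ne_zero]
  intro hdet
  obtain ⟨v, hv0, hv⟩ := Matrix.exists_mulVec_eq_zero_iff.2 hdet
  set h : Signal n := WithLp.toLp 2 v with hh
  have hvi : ∀ i, (if w i ≠ 0 then ∑ j ∈ I, cross (A j) w (EuclideanSpace.single i 1) *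
      cross (A j) w h else h i) = 0 := by
    intro i
    rw [← normalMatrix_mulVec]
    exact congrFun hv i
  have hsupp : supp h ⊆ supp w := by
    refine supp_subset_iff.2 fun i hi => ?_
    have := hvi i
    rwa [if_neg (by rwa [mem_supp] at hi)] at this
  have hsum : ∑ j ∈ I, cross (A j) w h ^ 2 = 0 := by
    have e : ∀ j, cross (A j) w h ^ 2
        = ∑ i, (cross (A j) w (EuclideanSpace.single i 1) * cross (A j) w h) * h i := by
      intro j
      rw [sq]
      nth_rewrite 1 [← sum_mul_cross_single (A j) w h]
      rw [Finset.sum_mul]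
      exact Finset.sum_congr rfl fun i _ => by ring
    rw [Finset.sum_congr rfl fun j _ => e j, Finset.sum_comm]
    refine Finset.sum_eq_zero fun i _ => ?_
    rw [← Finset.sum_mul]
    by_cases hi : w i ≠ 0
    · have := hvi i
      rw [if_pos hi] at this
      rw [this, zero_mul]
    · have := hvi i
      rw [if_neg hi] at this
      rw [this, mul_zero]
  have h1 := hlow h ((Finset.card_le_card hsupp).trans (by omega))
  rw [hsum, zero_div] at h1
  have h2 : 0 < ‖w‖ := norm_pos_iff.2 hw
  have h3 : h ≠ 0 := by
    intro h0
    apply hv0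
    ext i
    have := congrArg (fun z : Signal n => z i) h0
    simpa [hh] using this
  have h4 : 0 < ‖h‖ := norm_pos_iff.2 h3
  have : 0 < 1 / 64 * ‖w‖ ^ 2 * ‖h‖ ^ 2 := by positivity
  linarith

/-- The Gauss–Newton step is unique on the good event. -/
lemma IsGaussNewtonStep.eq_normalSolution {s : ℕ} {A : Fin m → Sensing n}
    {I : Finset (Fin m)} (hI : 0 < I.card) {x w z : Signal n} (hw : w ≠ 0)
    (hs : (supp w).card ≤ s)
    (hlow : ∀ h : Signal n, (supp h).card ≤ 2 * s →
      1 / 64 * ‖w‖ ^ 2 * ‖h‖ ^ 2 ≤ (∑ j ∈ I, cross (A j) w h ^ 2) / I.card)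
    (h : IsGaussNewtonStep A (fun j => intensity (A j) x) I (supp w) w z) :
    z = normalSolution A x I w := by
  have hdet := isUnit_normalMatrix_det hw hs hlow
  have hz : (normalMatrix A I w).mulVec z = normalVector A x I w := by
    ext i
    rw [normalMatrix_mulVec, normalVector]
    split_ifs with hi
    · have h1 := h.normal_eq hI (d := EuclideanSpace.single i 1) (by
        refine supp_subset_iff.2 fun k hk => ?_
        have : k ≠ i := by
          rintro rfl
          exact hk (mem_supp.2 hi)
        simp [this])
      rw [← sub_eq_zero, ← Finset.sum_sub_distrib, ← h1]
      refine Finset.sum_congr rfl fun j _ => ?_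
      rw [cross_sub_right]
      ring
    · by_contra hne
      exact hi (mem_supp.1 (h.1 (mem_supp.2 hne)))
  have : (normalMatrix A I w)⁻¹.mulVec (normalVector A x I w) = z := by
    rw [← hz, Matrix.mulVec_mulVec, Matrix.nonsing_inv_mul _ hdet, Matrix.one_mulVec]
  rw [normalSolution, this]

/-- The inverse is written as determinant inverse times adjugate, with the default value when the
determinant vanishes, so no invertibility is required. Dependence on the support of `w` destroys
continuity but not measurability. -/
lemma measurable_normalSolution (x : Signal n) (I : Finset (Fin m)) :
    Measurable fun p : Signal n × (Fin m → Sensing n) => normalSolution p.2 x I p.1 := by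
  have hA : ∀ j, Continuous fun p : Signal n × (Fin m → Sensing n) => p.2 j := fun j =>
    (continuous_apply j).comp continuous_snd
  have hset : ∀ i, MeasurableSet {p : Signal n × (Fin m → Sensing n) | p.1 i ≠ 0} := by
    intro i
    have hc : Measurable fun p : Signal n × (Fin m → Sensing n) => p.1 i := by fun_prop
    exact hc (measurableSet_singleton 0).compl
  have hM : Measurable fun p : Signal n × (Fin m → Sensing n) =>
      (fun i k => normalMatrix p.2 I p.1 i k : Fin n → Fin n → ℝ) := by
    refine measurable_pi_lambda _ fun i => measurable_pi_lambda _ fun k => ?_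
    refine Measurable.ite (hset i) (Continuous.measurable ?_) measurable_const
    exact continuous_finsetSum _ fun j _ => (Continuous.cross (hA j) continuous_fst
      continuous_const).mul (Continuous.cross (hA j) continuous_fst continuous_const)
  have hb : ∀ i, Measurable fun p : Signal n × (Fin m → Sensing n) =>
      normalVector p.2 x I p.1 i := by
    intro i
    refine Measurable.ite (hset i) (Continuous.measurable ?_) measurable_const
    exact continuous_finsetSum _ fun j _ => (Continuous.cross (hA j) continuous_fst
      continuous_const).mul ((Continuous.cross (hA j) continuous_fst continuous_fst).sub
      (continuous_const.mul ((Continuous.intensity (hA j) continuous_fst).sub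
        (Continuous.intensity (hA j) continuous_const))))
  have hdet : Measurable fun p : Signal n × (Fin m → Sensing n) => (normalMatrix p.2 I p.1).det := by
    have hc : Continuous fun M : Fin n → Fin n → ℝ => (Matrix.of M).det :=
      Continuous.matrix_det continuous_id
    exact hc.measurable.comp hM
  have hadj : ∀ i k, Measurable fun p : Signal n × (Fin m → Sensing n) =>
      (normalMatrix p.2 I p.1).adjugate i k := by
    intro i k
    have hc : Continuous fun M : Fin n → Fin n → ℝ => (Matrix.of M).adjugate i k :=
      (Continuous.matrix_adjugate continuous_id).matrix_elem i k
    exact hc.measurable.comp hM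
  unfold normalSolution
  refine (PiLp.continuous_toLp 2 _).measurable.comp (measurable_pi_lambda _ fun i => ?_)
  simp only [Matrix.mulVec, dotProduct, Matrix.inv_def, Matrix.smul_apply, Ring.inverse_eq_inv',
    smul_eq_mul]
  exact Finset.measurable_fun_sum _ fun k _ => ((hdet.inv.mul (hadj i k)).mul (hb k))

lemma normalSolution_congr {A A' : Fin m → Sensing n} {I : Finset (Fin m)}
    (h : ∀ j ∈ I, A j = A' j) (x w : Signal n) :
    normalSolution A x I w = normalSolution A' x I w := by
  have h1 : normalMatrix A I w = normalMatrix A' I w := by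
    ext i k
    simp only [normalMatrix, Matrix.of_apply]
    rw [Finset.sum_congr rfl fun j hj => by rw [h j hj]]
  have h2 : normalVector A x I w = normalVector A' x I w := by
    ext i
    simp only [normalVector]
    rw [Finset.sum_congr rfl fun j hj => by rw [h j hj]]
  rw [normalSolution, normalSolution, h1, h2]

lemma lossGradient_congr {A A' : Fin m → Sensing n} {I : Finset (Fin m)}
    (h : ∀ j ∈ I, A j = A' j) (x z : Signal n) :
    lossGradient A (fun j => intensity (A j) x) I z
      = lossGradient A' (fun j => intensity (A' j) x) I z := by
  simp only [lossGradient]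
  rw [Finset.sum_congr rfl fun j hj => by rw [h j hj]]

lemma continuous_lossGradient (x : Signal n) (I : Finset (Fin m)) :
    Continuous fun p : Signal n × (Fin m → Sensing n) =>
      lossGradient p.2 (fun j => intensity (p.2 j) x) I p.1 := by
  have hA : ∀ j, Continuous fun p : Signal n × (Fin m → Sensing n) => p.2 j := fun j =>
    (continuous_apply j).comp continuous_snd
  unfold lossGradient
  have hsum : Continuous fun p : Signal n × (Fin m → Sensing n) =>
      ∑ j ∈ I, (intensity (p.2 j) p.1 - intensity (p.2 j) x) •
        ((inner ℝ (rePart (p.2 j)) p.1 : ℝ) • rePart (p.2 j)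
          + (inner ℝ (imPart (p.2 j)) p.1 : ℝ) • imPart (p.2 j)) := by
    refine continuous_finsetSum _ fun j _ => ?_
    have h1 := continuous_rePart.comp (hA j)
    have h2 := continuous_imPart.comp (hA j)
    exact ((Continuous.intensity (hA j) continuous_fst).sub
      (Continuous.intensity (hA j) continuous_const)).smul
      (((h1.inner (𝕜 := ℝ) continuous_fst).smul h1).add
        ((h2.inner (𝕜 := ℝ) continuous_fst).smul h2))
  exact hsum.const_smul (1 / (I.card : ℝ))

end GaussNewtonSolution

/-! ### The iterates as measurable functions of the batches already used. -/

section Iterates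

variable {n m : ℕ}

/-- The starting point of the Gauss–Newton step of iteration `k` as a function of the current
iterate and of the data. -/
noncomputable def startPoint (x : Signal n) (H : Signal n → Signal n)
    (g : ℕ → Signal n → Signal n → Signal n) (μ : ℕ → ℝ) (I : ℕ → Finset (Fin m)) (k : ℕ)
    (z : Signal n) (A : Fin m → Sensing n) : Signal n :=
  g k z (H (z - μ k • lossGradient A (fun j => intensity (A j) x) (I (2 * k)) z))

/-- The iterates of resampled GraHTP as a measurable function of the data. -/
noncomputable def iterates (x : Signal n) (H : Signal n → Signal n)
    (g : ℕ → Signal n → Signal n → Signal n) (μ : ℕ → ℝ) (I : ℕ → Finset (Fin m))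
    (z0 : Signal n) (A : Fin m → Sensing n) : ℕ → Signal n
  | 0 => z0
  | k + 1 => normalSolution A x (I (2 * k + 1))
      (startPoint x H g μ I k (iterates x H g μ I z0 A k) A)

variable {x : Signal n} {H : Signal n → Signal n} {g : ℕ → Signal n → Signal n → Signal n}
  {μ : ℕ → ℝ} {I : ℕ → Finset (Fin m)} {z0 : Signal n}

lemma measurable_startPoint (hH : Measurable H)
    (hg : ∀ k, Measurable fun p : Signal n × Signal n => g k p.1 p.2) (k : ℕ) :
    Measurable fun p : Signal n × (Fin m → Sensing n) => startPoint x H g μ I k p.1 p.2 := by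
  have h1 : Measurable fun p : Signal n × (Fin m → Sensing n) =>
      H (p.1 - μ k • lossGradient p.2 (fun j => intensity (p.2 j) x) (I (2 * k)) p.1) :=
    hH.comp (measurable_fst.sub ((continuous_lossGradient x (I (2 * k))).measurable.const_smul (μ k)))
  have h2 : Measurable fun p : Signal n × (Fin m → Sensing n) =>
      (p.1, H (p.1 - μ k • lossGradient p.2 (fun j => intensity (p.2 j) x) (I (2 * k)) p.1)) :=
    measurable_fst.prodMk h1
  simpa only [startPoint, Function.comp_def] using (hg k).comp h2

lemma measurable_iterates (hH : Measurable H)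
    (hg : ∀ k, Measurable fun p : Signal n × Signal n => g k p.1 p.2) (k : ℕ) :
    Measurable fun A : Fin m → Sensing n => iterates x H g μ I z0 A k := by
  induction k with
  | zero => exact measurable_const
  | succ k ih =>
    have h1 : Measurable fun A : Fin m → Sensing n => (iterates x H g μ I z0 A k, A) :=
      ih.prodMk measurable_id
    have h2 : Measurable fun A : Fin m → Sensing n =>
        (startPoint x H g μ I k (iterates x H g μ I z0 A k) A, A) :=
      ((measurable_startPoint hH hg k).comp h1).prodMk measurable_id
    simpa only [iterates, Function.comp_def] using
      (measurable_normalSolution x (I (2 * k + 1))).comp h2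

lemma startPoint_congr {A A' : Fin m → Sensing n} (k : ℕ) (h : ∀ j ∈ I (2 * k), A j = A' j)
    (z : Signal n) : startPoint x H g μ I k z A = startPoint x H g μ I k z A' := by
  rw [startPoint, startPoint, lossGradient_congr h]

/-- Adaptedness: iterate `k` has consumed batches `0, …, 2k - 1` only, so it is independent of batch
`2k`, at which it is tested next. -/
lemma iterates_congr {A A' : Fin m → Sensing n} (k : ℕ)
    (h : ∀ b < 2 * k, ∀ j ∈ I b, A j = A' j) :
    iterates x H g μ I z0 A k = iterates x H g μ I z0 A' k := by
  induction k with
  | zero => rfl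
  | succ k ih =>
    rw [iterates, iterates, ih fun b hb => h b (by omega),
      startPoint_congr k (h (2 * k) (by omega)),
      normalSolution_congr (h (2 * k + 1) (by omega))]

end Iterates

/-! ### Measurability and locality of the good events; freezing the past by independence. -/

section Events

variable {n m : ℕ}

/-- The condition is an uncountable intersection over `d`; it is measurable because each condition
is closed. -/
lemma measurableSet_gradientConcentrated (s : ℕ) (η : ℝ) (I : Finset (Fin m)) (x : Signal n) :
    MeasurableSet {p : Signal n × (Fin m → Sensing n) |
      GradientConcentrated s η p.2 I x p.1} := by
  have hA : ∀ j, Continuous fun p : Signal n × (Fin m → Sensing n) => p.2 j := fun j =>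
    (continuous_apply j).comp continuous_snd
  have h1 : Continuous fun p : Signal n × (Fin m → Sensing n) => p.1 - x :=
    continuous_fst.sub continuous_const
  have h2 : Continuous fun p : Signal n × (Fin m → Sensing n) => p.1 + x :=
    continuous_fst.add continuous_const
  have h3 := continuous_fst (X := Signal n) (Y := Fin m → Sensing n)
  refine IsClosed.measurableSet ?_
  simp only [GradientConcentrated, Set.ofPred_forall]
  refine isClosed_iInter fun d => isClosed_iInter fun _ => isClosed_le ?_ ?_
  · refine Continuous.abs (Continuous.sub (Continuous.div_const ?_ _) ?_)
    · exact continuous_finsetSum _ fun j _ => (Continuous.cross (hA j) h1 h2).mul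
        (Continuous.cross (hA j) h3 continuous_const)
    · unfold crossMean
      exact ((h1.inner h2).mul (h3.inner continuous_const)).add (continuous_const.mul
        (((h1.inner h3).mul (h2.inner continuous_const)).add
          ((h2.inner h3).mul (h1.inner continuous_const))))
  · exact (continuous_const.mul ((h1.norm.mul h2.norm).mul h3.norm)).mul continuous_const

lemma measurableSet_supp_eq (S : Finset (Fin n)) :
    MeasurableSet {w : Signal n | supp w = S} := by
  have : {w : Signal n | supp w = S} = ⋂ i, {w : Signal n | w i ≠ 0 ↔ i ∈ S} := by
    ext w
    simp [Finset.ext_iff, mem_supp]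
  rw [this]
  refine MeasurableSet.iInter fun i => ?_
  have hc : Measurable fun w : Signal n => w i := by fun_prop
  have h0 : MeasurableSet {w : Signal n | w i ≠ 0} := hc (measurableSet_singleton 0).compl
  by_cases hi : i ∈ S
  · simpa [hi] using h0
  · have h1 : MeasurableSet {w : Signal n | w i = 0} := hc (measurableSet_singleton 0)
    convert h1 using 1
    ext w
    simp [hi]

/-- All conditions are closed except `missing`, which depends on the support of `w`; that one is
split over the finitely many possible supports. -/
lemma measurableSet_gaussNewtonRegular (s : ℕ) (C : ℝ) (I : Finset (Fin m)) (x : Signal n) :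
    MeasurableSet {p : Signal n × (Fin m → Sensing n) |
      GaussNewtonRegular s C p.2 I x p.1} := by
  have hA : ∀ j, Continuous fun p : Signal n × (Fin m → Sensing n) => p.2 j := fun j =>
    (continuous_apply j).comp continuous_snd
  have h3 := continuous_fst (X := Signal n) (Y := Fin m → Sensing n)
  have c1 : IsClosed {p : Signal n × (Fin m → Sensing n) | ∀ h : Signal n,
      (supp h).card ≤ 2 * s → 1 / 64 * ‖p.1‖ ^ 2 * ‖h‖ ^ 2
        ≤ (∑ j ∈ I, cross (p.2 j) p.1 h ^ 2) / I.card} := by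
    simp only [Set.ofPred_forall]
    refine isClosed_iInter fun h => isClosed_iInter fun _ => isClosed_le
      ((continuous_const.mul (h3.norm.pow 2)).mul continuous_const) (Continuous.div_const ?_ _)
    exact continuous_finsetSum _ fun j _ => (Continuous.cross (hA j) h3 continuous_const).pow 2
  have c2 : ∀ (C : ℝ) (f g : Signal n × (Fin m → Sensing n) → Signal n), Continuous f →
      Continuous g → IsClosed {p : Signal n × (Fin m → Sensing n) |
        (∑ j ∈ I, intensity (p.2 j) (f p) * intensity (p.2 j) (g p)) / I.card
          ≤ C * (‖f p‖ ^ 2 * ‖g p‖ ^ 2)} := by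
    intro C f g hf hg
    refine isClosed_le (Continuous.div_const ?_ _)
      (continuous_const.mul ((hf.norm.pow 2).mul (hg.norm.pow 2)))
    exact continuous_finsetSum _ fun j _ =>
      (Continuous.intensity (hA j) hf).mul (Continuous.intensity (hA j) hg)
  have c3 : MeasurableSet {p : Signal n × (Fin m → Sensing n) |
      (∑ j ∈ I, intensity (p.2 j) p.1 * intensity (p.2 j) (restrictTo (supp p.1)ᶜ x)) / I.card
        ≤ C * (‖p.1‖ ^ 2 * ‖restrictTo (supp p.1)ᶜ x‖ ^ 2)} := by
    have e : {p : Signal n × (Fin m → Sensing n) |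
      (∑ j ∈ I, intensity (p.2 j) p.1 * intensity (p.2 j) (restrictTo (supp p.1)ᶜ x)) / I.card
        ≤ C * (‖p.1‖ ^ 2 * ‖restrictTo (supp p.1)ᶜ x‖ ^ 2)}
        = ⋃ S : Finset (Fin n), {p | supp p.1 = S} ∩ {p |
      (∑ j ∈ I, intensity (p.2 j) p.1 * intensity (p.2 j) (restrictTo Sᶜ x)) / I.card
        ≤ C * (‖p.1‖ ^ 2 * ‖restrictTo Sᶜ x‖ ^ 2)} := by
      ext p
      simp
    rw [e]
    exact MeasurableSet.iUnion fun S => (measurable_fst (measurableSet_supp_eq S)).inter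
      (c2 C _ _ h3 continuous_const).measurableSet
  have hm := ((c1.measurableSet.inter c3).inter
    (c2 C (fun p => x - p.1) (fun p => x - p.1) (continuous_const.sub h3)
      (continuous_const.sub h3)).measurableSet).inter
    (c2 C (fun p => x + p.1) (fun p => x + p.1) (continuous_const.add h3)
      (continuous_const.add h3)).measurableSet
  convert hm using 1
  ext p
  exact ⟨fun h : GaussNewtonRegular s C p.2 I x p.1 =>
    ⟨⟨⟨h.lower, h.missing⟩, h.remainder_sub⟩, h.remainder_add⟩,
    fun h => ⟨h.1.1.1, h.1.1.2, h.1.2, h.2⟩⟩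

lemma gradientConcentrated_congr {s : ℕ} {η : ℝ} {A A' : Fin m → Sensing n}
    {I : Finset (Fin m)} (h : ∀ j ∈ I, A j = A' j) (x z : Signal n) :
    GradientConcentrated s η A I x z ↔ GradientConcentrated s η A' I x z := by
  unfold GradientConcentrated
  refine forall_congr' fun d => forall_congr' fun _ => ?_
  rw [Finset.sum_congr rfl fun j hj => by rw [h j hj]]

lemma GaussNewtonRegular.congr {s : ℕ} {C : ℝ} {A A' : Fin m → Sensing n}
    {I : Finset (Fin m)} (h : ∀ j ∈ I, A j = A' j) {x w : Signal n}
    (hG : GaussNewtonRegular s C A I x w) : GaussNewtonRegular s C A' I x w := by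
  have e : ∀ f : Sensing n → ℝ, ∑ j ∈ I, f (A' j) = ∑ j ∈ I, f (A j) := fun f =>
    Finset.sum_congr rfl fun j hj => by rw [h j hj]
  exact
    { lower := fun d hd => (hG.lower d hd).trans_eq (by rw [e fun b => cross b w d ^ 2])
      missing := by
        rw [e fun b => intensity b w * intensity b (restrictTo (supp w)ᶜ x)]
        exact hG.missing
      remainder_sub := by
        rw [e fun b => intensity b (x - w) * intensity b (x - w)]
        exact hG.remainder_sub
      remainder_add := by
        rw [e fun b => intensity b (x + w) * intensity b (x + w)]
        exact hG.remainder_add }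

/-- Data outside `S` are irrelevant for a function of the data in `S`; independence of the data
in the disjoint set `T` permits to freeze the value of that function. -/
lemma prob_le_of_forall_const {Ω : Type*} [MeasurableSpace Ω] {P : Measure Ω}
    [IsProbabilityMeasure P] {a : Fin m → Ω → Sensing n} (ha : ∀ j, AEMeasurable (a j) P)
    (hind : iIndepFun a P) {S T : Finset (Fin m)} (hST : Disjoint S T)
    {F : (Fin m → Sensing n) → Signal n} (hF : Measurable F)
    (hFS : ∀ A A' : Fin m → Sensing n, (∀ j ∈ S, A j = A' j) → F A = F A')
    {B : Set (Signal n × (Fin m → Sensing n))} (hB : MeasurableSet B)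
    (hBT : ∀ (z : Signal n) (A A' : Fin m → Sensing n), (∀ j ∈ T, A j = A' j) →
      (z, A) ∈ B → (z, A') ∈ B) {p : ℝ} (hp : 0 ≤ p)
    (h : ∀ z : Signal n, P.real {ω | (z, fun j => a j ω) ∈ B} ≤ p) :
    P.real {ω | (F (fun j => a j ω), fun j => a j ω) ∈ B} ≤ p := by
  classical
  have hext : ∀ U : Finset (Fin m), Measurable fun (y : U → Sensing n) (j : Fin m) =>
      if hj : j ∈ U then y ⟨j, hj⟩ else 0 := by
    intro U
    refine measurable_pi_lambda _ fun j => ?_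
    by_cases hj : j ∈ U
    · simp only [hj, dite_true]; exact measurable_pi_apply _
    · simp only [hj, dite_false]; exact measurable_const
  -- Extension by zero turns data on `U` into full data; by `hFS` and `hBT` the padding is invisible
  -- to `F` and to the sections of `B`. The event then becomes one about the independent pair `(X,
  -- Y)`, and Fubini bounds each section by the fixed-vector estimate.
  set ext := fun (U : Finset (Fin m)) (y : U → Sensing n) (j : Fin m) =>
    if hj : j ∈ U then y ⟨j, hj⟩ else 0 with hext_def
  have hextU : ∀ (U : Finset (Fin m)) (ω : Ω), ∀ j ∈ U,
      ext U (fun i : U => a i ω) j = a j ω := by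
    intro U ω j hj
    simp [hext_def, hj]
  set X : Ω → S → Sensing n := fun ω i => a i ω with hX
  set Y : Ω → T → Sensing n := fun ω i => a i ω with hY
  have hXm : AEMeasurable X P := aemeasurable_pi_lambda _ fun i => ha i
  have hYm : AEMeasurable Y P := aemeasurable_pi_lambda _ fun i => ha i
  have hXY : IndepFun X Y P := hind.indepFun_finset₀ S T hST ha
  have hmap := (indepFun_iff_map_prod_eq_prod_map_map hXm hYm).1 hXY
  set B' : Set ((S → Sensing n) × (T → Sensing n)) :=
    {q | (F (ext S q.1), ext T q.2) ∈ B} with hB'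
  have hB'm : MeasurableSet B' := by
    have hm : Measurable fun q : (S → Sensing n) × (T → Sensing n) =>
        (F (ext S q.1), ext T q.2) :=
      (hF.comp ((hext S).comp measurable_fst)).prodMk ((hext T).comp measurable_snd)
    exact hm hB
  have hBiff : ∀ (z : Signal n) (ω : Ω), (z, ext T (Y ω)) ∈ B ↔ (z, fun j => a j ω) ∈ B :=
    fun z ω => ⟨hBT z _ _ fun j hj => hextU T ω j hj,
      hBT z _ _ fun j hj => (hextU T ω j hj).symm⟩
  have hset : {ω | (F (fun j => a j ω), fun j => a j ω) ∈ B} = (fun ω => (X ω, Y ω)) ⁻¹' B' := by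
    ext ω
    simp only [Set.mem_preimage, hB', Set.mem_ofPred_eq]
    rw [hBiff, hFS (ext S (X ω)) (fun j => a j ω) (hextU S ω)]
  have : IsProbabilityMeasure (P.map X) := Measure.isProbabilityMeasure_map hXm
  have : IsProbabilityMeasure (P.map Y) := Measure.isProbabilityMeasure_map hYm
  have key : P {ω | (F (fun j => a j ω), fun j => a j ω) ∈ B} ≤ ENNReal.ofReal p := by
    rw [hset, ← Measure.map_apply_of_aemeasurable (hXm.prodMk hYm) hB'm, hmap,
      Measure.prod_apply hB'm]
    calc ∫⁻ q, P.map Y (Prod.mk q ⁻¹' B') ∂(P.map X) ≤ ∫⁻ _q, ENNReal.ofReal p ∂(P.map X) := by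
          refine lintegral_mono fun q => ?_
          rw [Measure.map_apply_of_aemeasurable hYm (measurable_prodMk_left hB'm)]
          have e : Y ⁻¹' (Prod.mk q ⁻¹' B') = {ω | (F (ext S q), fun j => a j ω) ∈ B} := by
            ext ω
            simp only [Set.mem_preimage, hB', Set.mem_ofPred_eq]
            exact hBiff _ ω
          rw [e]
          exact (ENNReal.le_ofReal_iff_toReal_le (measure_ne_top _ _) hp).2 (h _)
      _ = ENNReal.ofReal p := by simp
  exact ENNReal.toReal_le_of_le_ofReal hp key

end Events

/-! ### Failure probability of one batch, and convergence of every run on the good event. -/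

lemma prob_not_gradientConcentrated {η : ℝ} (hη : 0 < η) (hη1 : η ≤ 1) :
    ∃ C : ℝ, 0 < C ∧ ∀ {Ω : Type uΩ} [MeasurableSpace Ω] {P : Measure Ω} {n m s : ℕ}
      {a : Fin m → Ω → Sensing n} {I : Finset (Fin m)}, IsBatch P s a I C →
      ∀ x z : Signal n, P.real {ω | ¬GradientConcentrated s η (fun j => a j ω) I x z}
        ≤ C / I.card := by
  obtain ⟨C, hC, h⟩ := prob_cross_deviation.{uΩ} hη hη1
  refine ⟨C, hC, ?_⟩
  intro Ω _ P n m s a I hb x z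
  have := h hb (z - x) (z + x) z
  simpa only [GradientConcentrated, not_forall, not_le, exists_prop] using this

/-- The constant inside the regularity condition is kept apart from the one for batch size and
failure probability: the former determines the basin radius, which in turn fixes the accuracy
demanded of the gradient. -/
lemma prob_not_gaussNewtonRegular :
    ∃ C C' : ℝ, 0 < C ∧ 0 < C' ∧ ∀ {Ω : Type uΩ} [MeasurableSpace Ω] {P : Measure Ω} {n m s : ℕ}
      {a : Fin m → Ω → Sensing n} {I : Finset (Fin m)}, IsBatch P s a I C' →
      ∀ x w : Signal n, P.real {ω | ¬GaussNewtonRegular s C (fun j => a j ω) I x w}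
        ≤ C' / I.card := by
  obtain ⟨C₁, hC₁, h₁⟩ := prob_cross_sq_small.{uΩ}
  obtain ⟨C, hC, h₂⟩ := prob_intensity_mul_large.{uΩ}
  refine ⟨C, C₁ + (C + C + C), hC, by positivity, ?_⟩
  intro Ω _ P n m s a I hb x w
  have := hb.prob
  have hb₁ := hb.mono hC₁ (by linarith)
  have hb₂ := hb.mono hC (by linarith)
  set E₁ := {ω | ∃ h : Signal n, (supp h).card ≤ 2 * s ∧
    (∑ j ∈ I, cross (a j ω) w h ^ 2) / I.card < 1 / 64 * ‖w‖ ^ 2 * ‖h‖ ^ 2} with hE₁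
  set E₂ : Signal n → Signal n → Set Ω := fun u v => {ω | C * (‖u‖ ^ 2 * ‖v‖ ^ 2)
    < (∑ j ∈ I, intensity (a j ω) u * intensity (a j ω) v) / I.card} with hE₂
  have hsub : {ω | ¬GaussNewtonRegular s C (fun j => a j ω) I x w}
      ⊆ E₁ ∪ (E₂ w (restrictTo (supp w)ᶜ x) ∪ E₂ (x - w) (x - w) ∪ E₂ (x + w) (x + w)) := by
    intro ω hω
    by_contra hn
    simp only [Set.mem_union, not_or] at hn
    obtain ⟨n₁, ⟨n₂, n₃⟩, n₄⟩ := hn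
    refine hω ⟨fun h hh => ?_, not_lt.1 n₂, not_lt.1 n₃, not_lt.1 n₄⟩
    by_contra hlt
    exact n₁ ⟨h, hh, not_le.1 hlt⟩
  calc P.real {ω | ¬GaussNewtonRegular s C (fun j => a j ω) I x w}
      ≤ P.real (E₁ ∪ (E₂ w (restrictTo (supp w)ᶜ x) ∪ E₂ (x - w) (x - w)
          ∪ E₂ (x + w) (x + w))) := measureReal_mono hsub
    _ ≤ P.real E₁ + (P.real (E₂ w (restrictTo (supp w)ᶜ x)) + P.real (E₂ (x - w) (x - w))
          + P.real (E₂ (x + w) (x + w))) :=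
        (measureReal_union_le _ _).trans (add_le_add le_rfl ((measureReal_union_le _ _).trans
          (add_le_add (measureReal_union_le _ _) le_rfl)))
    _ ≤ C₁ / I.card + (C / I.card + C / I.card + C / I.card) :=
        add_le_add (h₁ hb₁ w) (add_le_add (add_le_add (h₂ hb₂ _ _) (h₂ hb₂ _ _)) (h₂ hb₂ _ _))
    _ = (C₁ + (C + C + C)) / I.card := by ring

/-- On the good event every run consists of the measurable iterates, it converges linearly, and
quadratically once the smallest component of `x` is resolved. -/
lemma IsRun.converges {n m s K : ℕ} {C : ℝ} (hC : 0 ≤ C) {H : Signal n → Signal n}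
    (hH : IsHardThresholding s H) {x : Signal n} (hx0 : x ≠ 0) (hx : (supp x).card ≤ s)
    {g : ℕ → Signal n → Signal n → Signal n} (hg : IsInitialGuess x g) {μ : ℕ → ℝ}
    (hμ : ∀ k < K, μ k ∈ Set.Ioo ((1 - basinRadius C) / ‖x‖ ^ 2) ((1 + basinRadius C) / ‖x‖ ^ 2))
    {A : Fin m → Sensing n} {I : ℕ → Finset (Fin m)} (hI : ∀ b < 2 * K, 0 < (I b).card)
    {z0 : Signal n} (hz0 : signDist z0 x ≤ basinRadius C * ‖x‖)
    (hG : ∀ k < K, GradientConcentrated s (basinRadius C) A (I (2 * k)) x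
      (iterates x H g μ I z0 A k))
    (hN : ∀ k < K, GaussNewtonRegular s C A (I (2 * k + 1)) x
      (startPoint x H g μ I k (iterates x H g μ I z0 A k) A))
    {z u : ℕ → Signal n} (hrun : IsRun K H g μ A (fun j => intensity (A j) x) I z0 z u) :
    (∀ k ≤ K, signDist (z k) x ≤ (1 / 2) ^ k * (basinRadius C * ‖x‖)) ∧
    ∀ k < K, signDist (z k) x ≤ minEntry x →
      signDist (z (k + 1)) x ≤ 36 * (1 + 128 * C) / ‖x‖ * signDist (z k) x ^ 2 := by
  have hR : 0 < ‖x‖ := norm_pos_iff.2 hx0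
  have hη : 0 < basinRadius C := by rw [basinRadius]; positivity
  -- The good event speaks about `iterates`, so the induction must carry equality with the run along
  -- with the error bound: the bound makes the next minimizer unique, and uniqueness gives the next
  -- equality.
  have step : ∀ k < K, z k = iterates x H g μ I z0 A k →
      signDist (z k) x ≤ basinRadius C * ‖x‖ →
      z (k + 1) = iterates x H g μ I z0 A (k + 1) ∧
      signDist (z (k + 1)) x ≤ 1 / 2 * signDist (z k) x ∧
      (signDist (z k) x ≤ minEntry x →
        signDist (z (k + 1)) x ≤ 36 * (1 + 128 * C) / ‖x‖ * signDist (z k) x ^ 2) := by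
    intro k hk hzk hd
    have hI' := hI (2 * k + 1) (by omega)
    have hu := hrun.gradient_step k hk
    rw [gradient_loss] at hu
    have hw : startPoint x H g μ I k (iterates x H g μ I z0 A k) A = g k (z k) (u k) := by
      rw [startPoint, ← hzk, hu]
    have hGk := hG k hk
    have hNk := hN k hk
    rw [hw] at hNk
    rw [← hzk] at hGk
    have hstep := hrun.gaussNewton_step k hk
    rw [← hg.supp_eq k (z k) (u k)] at hstep
    obtain ⟨h1, h2, h3⟩ := iteration_error (z' := z (k + 1)) hC hH hI' hx0 hx
      ((div_le_iff₀ (by positivity)).1 (hμ k hk).1.le)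
      ((le_div_iff₀ (by positivity)).1 (hμ k hk).2.le) hd hGk hu (hg.supp_eq k (z k) (u k))
      (hg.dist_le k (z k) (u k)) hNk
    refine ⟨?_, h3 hstep⟩
    rw [iterates, hw]
    exact hstep.eq_normalSolution hI' h1 h2 hNk.lower
  have hpow : ∀ k : ℕ, (1 / 2 : ℝ) ^ k * (basinRadius C * ‖x‖) ≤ basinRadius C * ‖x‖ := fun k =>
    mul_le_of_le_one_left (by positivity) (pow_le_one₀ (by norm_num) (by norm_num))
  have main : ∀ k ≤ K, z k = iterates x H g μ I z0 A k ∧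
      signDist (z k) x ≤ (1 / 2) ^ k * (basinRadius C * ‖x‖) := by
    intro k
    induction k with
    | zero =>
      intro _
      rw [hrun.init]
      exact ⟨rfl, by simpa using hz0⟩
    | succ k ih =>
      intro hk
      obtain ⟨h1, h2⟩ := ih (by omega)
      obtain ⟨h3, h4, -⟩ := step k (by omega) h1 (h2.trans (hpow k))
      refine ⟨h3, h4.trans ?_⟩
      rw [pow_succ]
      linarith
  refine ⟨fun k hk => (main k hk).2, fun k hk => ?_⟩
  obtain ⟨h1, h2⟩ := main k hk.le
  exact (step k hk h1 (h2.trans (hpow k))).2.2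

/-! ### Iteration counts for the linear and the quadratic phase. -/

lemma le_half_pow_two_pow {t : ℕ → ℝ} {N : ℕ} (h0 : ∀ j, 0 ≤ t j) (h1 : t 0 ≤ 1 / 2)
    (h : ∀ j < N, t (j + 1) ≤ t j ^ 2) : ∀ j ≤ N, t j ≤ (1 / 2) ^ 2 ^ j := by
  intro j
  induction j with
  | zero => intro _; simpa using h1
  | succ j ih =>
    intro hj
    refine (h j (by omega)).trans ?_
    rw [pow_succ 2 j, pow_mul]
    exact pow_le_pow_left₀ (h0 j) (ih (by omega)) 2

/-- The number of iterations that resolve the smallest component of `x`. -/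
lemma exists_resolution_time {n : ℕ} {x : Signal n} (hx : x ≠ 0) :
    ∃ K₀ : ℕ, (K₀ : ℝ) ≤ 2 * (1 + Real.log (‖x‖ / minEntry x)) ∧
      ∀ k, K₀ ≤ k → (1 / 2 : ℝ) ^ k * ‖x‖ ≤ minEntry x := by
  have hm := (minEntry_pos_and_le hx).1
  have hle := minEntry_le_norm hx
  have hR : 0 < ‖x‖ := norm_pos_iff.2 hx
  have hρ : 1 ≤ ‖x‖ / minEntry x := (one_le_div hm).2 hle
  have hl : 0 ≤ Real.log (‖x‖ / minEntry x) := Real.log_nonneg hρ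
  have hl2 : 1 / 2 ≤ Real.log 2 := by linarith [Real.log_two_gt_d9]
  refine ⟨⌈Real.log (‖x‖ / minEntry x) / Real.log 2⌉₊, ?_, ?_⟩
  · have h1 := Nat.ceil_lt_add_one (a := Real.log (‖x‖ / minEntry x) / Real.log 2) (by positivity)
    have h2 : Real.log (‖x‖ / minEntry x) / Real.log 2 ≤ 2 * Real.log (‖x‖ / minEntry x) := by
      rw [div_le_iff₀ (by linarith)]
      nlinarith
    linarith
  · intro k hk
    have h1 : Real.log (‖x‖ / minEntry x) ≤ k * Real.log 2 :=
      (div_le_iff₀ (by linarith)).1 (Nat.ceil_le.1 hk)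
    have h2 : ‖x‖ / minEntry x ≤ 2 ^ k := by
      rw [← Real.log_le_log_iff (by positivity) (by positivity), Real.log_pow]
      exact h1
    rw [div_le_iff₀ hm] at h2
    rw [one_div, inv_pow, inv_mul_le_iff₀ (by positivity)]
    exact h2

/-- The number of quadratically convergent iterations that reach the accuracy `ε`. -/
lemma exists_accuracy_time {ε : ℝ} (h0 : 0 < ε) :
    ∃ N : ℕ, 1 ≤ N ∧ (N : ℝ) ≤ 2 * (1 + Real.posLog (Real.log (1 / ε))) ∧
      (1 / 2 : ℝ) ^ 2 ^ N ≤ ε := by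
  set L := Real.log (1 / ε) with hL
  set q := Real.posLog L with hq
  have hq0 : 0 ≤ q := Real.posLog_nonneg
  have hl2 : 1 / 2 ≤ Real.log 2 := by linarith [Real.log_two_gt_d9]
  -- The additional iteration compensates `log 2 ≥ 1/2` instead of `1` in the exponent, and it makes
  -- the count positive.
  refine ⟨⌈q / Real.log 2⌉₊ + 1, by omega, ?_, ?_⟩
  · have h1 := Nat.ceil_lt_add_one (a := q / Real.log 2) (by positivity)
    have h2 : q / Real.log 2 ≤ 2 * q := by
      rw [div_le_iff₀ (by linarith)]
      nlinarith
    push_cast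
    linarith
  · set N := ⌈q / Real.log 2⌉₊ with hN
    have h1 : q ≤ N * Real.log 2 := (div_le_iff₀ (by linarith)).1 (Nat.le_ceil _)
    have h2 : L ≤ 2 ^ N := by
      rcases le_or_gt L 0 with h | h
      · exact h.trans (by positivity)
      · rw [← Real.log_le_log_iff h (by positivity), Real.log_pow]
        exact (le_max_right 0 (Real.log L)).trans h1
    have h3 : Real.log ((1 / 2) ^ 2 ^ (N + 1)) ≤ Real.log ε := by
      have h4 : Real.log ε = -L := by rw [hL, one_div, Real.log_inv, neg_neg]
      rw [Real.log_pow, h4, one_div, Real.log_inv]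
      push_cast
      rw [pow_succ]
      nlinarith [pow_pos (two_pos : (0 : ℝ) < 2) N]
    exact (Real.log_le_log_iff (by positivity) h0).1 h3

/-! ### Union bound over the iterations and size of a batch. -/

/-- Up to the accumulated failure probability of its batches, a batchwise sampled run stays on the
good event. -/
lemma exists_good_event {Ω : Type*} [MeasurableSpace Ω] {P : Measure Ω} [IsProbabilityMeasure P]
    {n m s K : ℕ} {C η p q : ℝ} {a : Fin m → Ω → Sensing n} (ha : ∀ j, AEMeasurable (a j) P)
    (hind : iIndepFun a P) {I : ℕ → Finset (Fin m)} (hp : 0 ≤ p) (hq : 0 ≤ q)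
    (hdisj : ∀ b < 2 * K, ∀ c < 2 * K, b ≠ c → Disjoint (I b) (I c))
    {H : Signal n → Signal n} (hH : Measurable H) {x : Signal n}
    {g : ℕ → Signal n → Signal n → Signal n}
    (hg : ∀ k, Measurable fun p : Signal n × Signal n => g k p.1 p.2) (μ : ℕ → ℝ) (z0 : Signal n)
    (hG : ∀ b < 2 * K, ∀ z : Signal n,
      P.real {ω | ¬GradientConcentrated s η (fun j => a j ω) (I b) x z} ≤ p)
    (hN : ∀ b < 2 * K, ∀ w : Signal n,
      P.real {ω | ¬GaussNewtonRegular s C (fun j => a j ω) (I b) x w} ≤ q) :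
    ∃ G : Set Ω, MeasurableSet G ∧ 1 - K * (p + q) ≤ P.real G ∧ ∀ ω ∈ G, ∀ k < K,
      GradientConcentrated s η (fun j => a j ω) (I (2 * k)) x
        (iterates x H g μ I z0 (fun j => a j ω) k) ∧
      GaussNewtonRegular s C (fun j => a j ω) (I (2 * k + 1)) x
        (startPoint x H g μ I k (iterates x H g μ I z0 (fun j => a j ω) k) fun j => a j ω) := by
  set E : ℕ → Set Ω := fun k => {ω | ¬GradientConcentrated s η (fun j => a j ω) (I (2 * k)) x
    (iterates x H g μ I z0 (fun j => a j ω) k)} with hE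
  set E' : ℕ → Set Ω := fun k => {ω | ¬GaussNewtonRegular s C (fun j => a j ω) (I (2 * k + 1)) x
    (startPoint x H g μ I k (iterates x H g μ I z0 (fun j => a j ω) k) fun j => a j ω)} with hE'
  have hdis : ∀ b < 2 * K, Disjoint ((Finset.range b).biUnion I) (I b) := by
    intro b hb
    rw [Finset.disjoint_biUnion_left]
    intro c hc
    have := Finset.mem_range.1 hc
    exact hdisj c (by omega) b hb (by omega)
  have hE_le : ∀ k < K, P.real (E k) ≤ p := by
    intro k hk
    refine prob_le_of_forall_const ha hind (hdis (2 * k) (by omega))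
      (F := fun A => iterates x H g μ I z0 A k) (measurable_iterates hH hg k)
      (fun A A' h => iterates_congr k fun b hb j hj =>
        h j (Finset.mem_biUnion.2 ⟨b, Finset.mem_range.2 hb, hj⟩))
      (measurableSet_gradientConcentrated s η (I (2 * k)) x).compl
      (fun z A A' h hz => fun hc => hz ((gradientConcentrated_congr h x z).2 hc)) hp
      (hG (2 * k) (by omega))
  have hE'_le : ∀ k < K, P.real (E' k) ≤ q := by
    intro k hk
    refine prob_le_of_forall_const ha hind (hdis (2 * k + 1) (by omega))
      (F := fun A => startPoint x H g μ I k (iterates x H g μ I z0 A k) A)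
      ((measurable_startPoint hH hg k).comp ((measurable_iterates hH hg k).prodMk measurable_id))
      (fun A A' h => ?_)
      (measurableSet_gaussNewtonRegular s C (I (2 * k + 1)) x).compl
      (fun z A A' h hz => fun hc => hz (GaussNewtonRegular.congr (fun j hj => (h j hj).symm) hc)) hq
      (hN (2 * k + 1) (by omega))
    have h' : ∀ b < 2 * k + 1, ∀ j ∈ I b, A j = A' j := fun b hb j hj =>
      h j (Finset.mem_biUnion.2 ⟨b, Finset.mem_range.2 hb, hj⟩)
    rw [iterates_congr k fun b hb => h' b (by omega), startPoint_congr k (h' (2 * k) (by omega))]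
  have hbad : P.real (⋃ k ∈ Finset.range K, (E k ∪ E' k)) ≤ K * (p + q) := by
    calc P.real (⋃ k ∈ Finset.range K, (E k ∪ E' k))
        ≤ ∑ k ∈ Finset.range K, P.real (E k ∪ E' k) := measureReal_biUnion_finset_le _ _
      _ ≤ ∑ _k ∈ Finset.range K, (p + q) := Finset.sum_le_sum fun k hk =>
          (measureReal_union_le _ _).trans (add_le_add (hE_le k (Finset.mem_range.1 hk))
            (hE'_le k (Finset.mem_range.1 hk)))
      _ = K * (p + q) := by rw [Finset.sum_const, Finset.card_range, nsmul_eq_mul]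
  -- The sensing vectors are only almost everywhere measurable, so the bad event is replaced by a
  -- measurable hull of the same probability.
  refine ⟨(toMeasurable P (⋃ k ∈ Finset.range K, (E k ∪ E' k)))ᶜ,
    (measurableSet_toMeasurable _ _).compl, ?_, ?_⟩
  · rw [probReal_compl_eq_one_sub (measurableSet_toMeasurable _ _), measureReal_def,
      measure_toMeasurable, ← measureReal_def]
    linarith
  · intro ω hω k hk
    have h1 : ω ∉ E k ∪ E' k := fun h => hω (subset_toMeasurable _ _
      (Set.mem_biUnion (Finset.mem_coe.2 (Finset.mem_range.2 hk)) h))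
    simp only [Set.mem_union, not_or] at h1
    exact ⟨not_not.1 h1.1, not_not.1 h1.2⟩

/-- Rounding down loses less than one vector per batch. The surplus `4` leaves `2 T ≥ 1` after
division by two, which pays for it. -/
lemma batch_size_ge {C T : ℝ} (hT : 1 / 2 ≤ T) {K m : ℕ} (hK : 1 ≤ K)
    (hm : (2 * C + 4) * K * T ≤ m) : C * T ≤ ((m / (2 * K) : ℕ) : ℝ) := by
  have h1 : m < 2 * K * (m / (2 * K) + 1) := Nat.lt_mul_div_succ m (by omega)
  have h2 : (m : ℝ) < 2 * K * (((m / (2 * K) : ℕ) : ℝ) + 1) := by exact_mod_cast h1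
  have hK' : (0 : ℝ) < K := by exact_mod_cast hK
  have h3 : K * ((2 * C + 4) * T) < K * (2 * (((m / (2 * K) : ℕ) : ℝ) + 1)) := by linarith
  have h4 := lt_of_mul_lt_mul_left h3 hK'.le
  linarith

end GraHTP

/-! ### Choice of constants and assembly. -/

theorem corollary2p1 :
    ∃ μ₁ μ₂ δ β C₀ C₅ C₆ C₇ C₈ : ℝ,
      0 < μ₁ ∧ μ₁ < μ₂ ∧ 0 < δ ∧ 0 < β ∧ β * δ < 1 ∧
      0 < C₀ ∧ 0 < C₅ ∧ 0 < C₆ ∧ 0 < C₇ ∧ 0 < C₈ ∧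
      ∀ (n s : ℕ) (x : GraHTP.Signal n), 2 * s ≤ n → x ≠ 0 → (GraHTP.supp x).card ≤ s →
      ∃ K₀ : ℕ, (K₀ : ℝ) ≤ C₀ * (1 + Real.log (‖x‖ / GraHTP.minEntry x)) ∧
      ∀ ε : ℝ, 0 < ε → ε < 1 →
      ∃ K : ℕ, 1 ≤ K ∧ K₀ ≤ K ∧
        (K : ℝ) ≤ C₀ * (1 + Real.posLog (Real.log (1 / ε))
          + Real.log (‖x‖ / GraHTP.minEntry x)) ∧
        ∀ (Ω : Type*) [MeasurableSpace Ω] (P : Measure Ω) [IsProbabilityMeasure P]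
          (m : ℕ) (a : Fin m → Ω → GraHTP.Sensing n) (I : ℕ → Finset (Fin m))
          (H : GraHTP.Signal n → GraHTP.Signal n)
          (g : ℕ → GraHTP.Signal n → GraHTP.Signal n → GraHTP.Signal n)
          (μ : ℕ → ℝ) (z0 : GraHTP.Signal n),
          (∀ j, HasLaw (a j) (GraHTP.stdComplexGaussian n) P) → iIndepFun a P →
          C₅ * K * s * Real.log (n / s) ≤ m →
          (∀ b < 2 * K, (I b).card = m / (2 * K)) →
          (∀ b < 2 * K, ∀ c < 2 * K, b ≠ c → Disjoint (I b) (I c)) →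
          GraHTP.IsHardThresholding s H →
          GraHTP.IsInitialGuess x g →
          (∀ k < K, μ k ∈ Set.Ioo (μ₁ / ‖x‖ ^ 2) (μ₂ / ‖x‖ ^ 2)) →
          z0 ∈ GraHTP.basin s x δ →
          ∃ G : Set Ω, MeasurableSet G ∧
            1 - K * (C₆ / ((m / (2 * K) : ℕ) : ℝ)
              + C₇ * Real.exp (-C₈ * ((m / (2 * K) : ℕ) : ℝ)
                  / Real.log ((m / (2 * K) : ℕ) : ℝ))) ≤ P.real G ∧
            ∀ ω ∈ G, ∀ z u : ℕ → GraHTP.Signal n,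
              GraHTP.IsRun K H g μ (fun j => a j ω) (fun j => GraHTP.intensity (a j ω) x)
                I z0 z u →
              GraHTP.signDist (z K) x ≤ ε * ‖x‖ ∧
              ∀ k, K₀ ≤ k → k < K →
                GraHTP.signDist (z k) x ≤ δ * ‖x‖ ∧
                GraHTP.signDist (z (k + 1)) x ≤ β / ‖x‖ * GraHTP.signDist (z k) x ^ 2 := by
  obtain ⟨C, C', hC, hC', hGN⟩ := GraHTP.prob_not_gaussNewtonRegular
  set η := GraHTP.basinRadius C with hη
  have hη0 : 0 < η := by rw [hη, GraHTP.basinRadius]; positivity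
  have hηC : η * (2 + 128 * C) = 1 / 200 := by rw [hη, GraHTP.basinRadius]; field_simp
  have hη1 : η ≤ 1 / 400 := by nlinarith
  obtain ⟨D, hD, hGC⟩ := GraHTP.prob_not_gradientConcentrated hη0 (by linarith)
  set β := 36 * (1 + 128 * C) with hβ
  have hβη : β * η ≤ 1 / 2 := by nlinarith
  have hβ1 : 1 ≤ β := by linarith
  -- The step-size window is the one in which the gradient step cancels the error up to `η`; `C₅` is
  -- dictated by `batch_size_ge`. The proof yields failure probability `(D + C') / M` per iteration,
  -- so the exponential term is slack and its constants are arbitrary.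
  refine ⟨1 - η, 1 + η, η, β, 4, 2 * (D + C') + 4, D + C', 1, 1, by linarith, by linarith, hη0,
    by positivity, by linarith, by norm_num, by positivity, by positivity, one_pos, one_pos, ?_⟩
  intro n s x hsn hx0 hx
  have hR : 0 < ‖x‖ := norm_pos_iff.2 hx0
  have hl : 0 ≤ Real.log (‖x‖ / GraHTP.minEntry x) := Real.log_nonneg
    ((one_le_div (GraHTP.minEntry_pos_and_le hx0).1).2 (GraHTP.minEntry_le_norm hx0))
  -- Sparsity zero would force `x = 0`; positivity is needed for the scale `s log (n / s)`.
  have hs : 0 < s := by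
    rcases Nat.eq_zero_or_pos s with rfl | h
    · exfalso
      apply hx0
      have h1 : GraHTP.supp x = ∅ := Finset.card_eq_zero.1 (by omega)
      ext i
      by_contra hi
      have := GraHTP.mem_supp.2 hi
      simp [h1] at this
    · exact h
  obtain ⟨K₀, hK₀, hres⟩ := GraHTP.exists_resolution_time hx0
  refine ⟨K₀, by linarith, ?_⟩
  intro ε hε _
  obtain ⟨N, hN1, hN, hNε⟩ := GraHTP.exists_accuracy_time hε
  have hpl := Real.posLog_nonneg (x := Real.log (1 / ε))
  -- `K₀` halvings bring the error below the smallest entry, then `N` squarings reach `ε`; `N ≥ 1`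
  -- gives `K ≥ 1`.
  refine ⟨K₀ + N, by omega, by omega, by push_cast; linarith, ?_⟩
  intro Ω _ P _ m a I H g μ z0 hlaw hind hm hcard hdisj hH hg hμ hz0
  set K := K₀ + N with hK
  set M := m / (2 * K) with hM
  have hT := GraHTP.half_le_log_div hs hsn
  have hs1 : (1 : ℝ) ≤ s := by exact_mod_cast hs
  have hT' : 1 / 2 ≤ s * Real.log ((n : ℝ) / s) := by nlinarith
  have hMge : (D + C') * (s * Real.log ((n : ℝ) / s)) ≤ M :=
    GraHTP.batch_size_ge hT' (by omega) (by rw [← mul_assoc]; exact hm)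
  have hbatch : ∀ b < 2 * K, GraHTP.IsBatch P s a (I b) (D + C') := fun b hb =>
    ⟨inferInstance, hlaw, hind, hs, hsn, by positivity, by rw [hcard b hb]; exact hMge⟩
  obtain ⟨G, hGm, hGp, hGood⟩ := GraHTP.exists_good_event (K := K) (p := D / M) (q := C' / M)
    (s := s) (η := η) (C := C) (x := x)
    (fun j => (hlaw j).aemeasurable) hind (by positivity) (by positivity) hdisj hH.measurable
    hg.measurable μ z0
    (fun b hb z => by
      have := hGC ((hbatch b hb).mono hD (by linarith)) x z
      rwa [hcard b hb] at this)
    (fun b hb w => by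
      have := hGN ((hbatch b hb).mono hC' (by linarith)) x w
      rwa [hcard b hb] at this)
  refine ⟨G, hGm, ?_, ?_⟩
  · refine le_trans ?_ hGp
    have h1 : (K : ℝ) * (D / M + C' / M) ≤ K * ((D + C') / M
        + 1 * Real.exp (-1 * (M : ℝ) / Real.log (M : ℝ))) := by
      refine mul_le_mul_of_nonneg_left ?_ (Nat.cast_nonneg _)
      rw [← add_div]
      linarith [Real.exp_pos (-1 * (M : ℝ) / Real.log (M : ℝ))]
    linarith
  · intro ω hω z u hrun
    obtain ⟨hlin, hquad⟩ := hrun.converges hC.le hH hx0 hx hg hμ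
      (fun b hb => (hbatch b hb).card_pos) hz0.1 (fun k hk => (hGood ω hω k hk).1)
      (fun k hk => (hGood ω hω k hk).2)
    rw [← hη] at hlin
    have hη_le : ∀ k ≤ K, GraHTP.signDist (z k) x ≤ η * ‖x‖ := fun k hk =>
      (hlin k hk).trans (mul_le_of_le_one_left (by positivity)
        (pow_le_one₀ (by norm_num) (by norm_num)))
    have hq : ∀ k, K₀ ≤ k → k < K →
        GraHTP.signDist (z (k + 1)) x ≤ β / ‖x‖ * GraHTP.signDist (z k) x ^ 2 := by
      intro k hk hkK
      refine hquad k hkK ((hlin k hkK.le).trans (le_trans ?_ (hres k hk)))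
      refine mul_le_mul_of_nonneg_left ?_ (by positivity)
      nlinarith
    refine ⟨?_, fun k hk hkK => ⟨hη_le k hkK.le, hq k hk hkK⟩⟩
    have hd0 : ∀ k, 0 ≤ GraHTP.signDist (z k) x := fun k =>
      le_min (norm_nonneg _) (norm_nonneg _)
    -- Scaled by `β / ‖x‖`, the error is squared at each iteration. It starts at most at `β η ≤
    -- 1/2`, already guaranteed by the basin.
    have hfin := GraHTP.le_half_pow_two_pow (N := N)
      (t := fun j => β / ‖x‖ * GraHTP.signDist (z (K₀ + j)) x)
      (fun j => mul_nonneg (by positivity) (hd0 _)) (by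
        have h1 := hη_le K₀ (by omega)
        calc β / ‖x‖ * GraHTP.signDist (z (K₀ + 0)) x ≤ β / ‖x‖ * (η * ‖x‖) :=
              mul_le_mul_of_nonneg_left h1 (by positivity)
          _ = β * η := by field_simp
          _ ≤ 1 / 2 := hβη) (by
        intro j hj
        have h1 := mul_le_mul_of_nonneg_left (hq (K₀ + j) (by omega) (by omega))
          (show 0 ≤ β / ‖x‖ by positivity)
        calc β / ‖x‖ * GraHTP.signDist (z (K₀ + (j + 1))) x ≤ _ := h1
          _ = _ := by ring) N le_rfl
    have h2 : β / ‖x‖ * GraHTP.signDist (z K) x ≤ ε := hfin.trans hNε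
    -- Since `β ≥ 1`, the scaled error dominates the relative error.
    have h3 : 1 / ‖x‖ * GraHTP.signDist (z K) x ≤ β / ‖x‖ * GraHTP.signDist (z K) x :=
      mul_le_mul_of_nonneg_right (div_le_div_of_nonneg_right hβ1 hR.le) (hd0 _)
    have h4 := h3.trans h2
    rwa [one_div, inv_mul_le_iff₀ hR, mul_comm] at h4
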